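/- All functions of $x\in\mathbb R$ below are $2\pi$-periodic (i.e. live on $\mathbb T=\mathbb R/2\pi\mathbb Z$), and $0<\epsilon<1$. Write $c^+=\max(0,c)$, $c^-=\max(0,-c)$. Let $\phi\in C_c^\infty(\mathbb R)$ with $\int\phi=1$, $\phi_\delta(x)=\delta^{-1}\phi(x/\delta)$, and, for a velocity $u^\epsilon(x,t)$, $$A^\epsilon(t)Y(x)=\tfrac1\epsilon\big[(Yu^{\epsilon+})(x-\epsilon,t)-(Y|u^\epsilon|)(x,t)+(Yu^{\epsilon-})(x+\epsilon,t)\big].$$ A family $(U_k^\epsilon)_k$ is called a *weak asymptotic method* for the Cauchy problem $\partial_tU_k+\partial_xF_k(U)=0$, $U_k(\cdot,0)=U_{k,0}$, if $U_k^\epsilon(x,\cdot)$ is differentiable on $[0,\infty)$ (one-sidedly at $0$), $\partial_tU_k^\epsilon(\cdot,t)$ and $F_k(U^\epsilon)(\cdot,t)$ are locally integrable and, for every $\psi\in C_c^\infty(\mathbb R)$ and every $k$, as $\epsilon\to0^+$, $$\int\big[\partial_tU_k^\epsilon(x,t)\,\psi(x)-F_k(U^\epsilon)(x,t)\,\psi'(x)\big]dx\to0$$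 uniformly for $t$ in each bounded interval $[0,T]$, and $\int U^\epsilon_k(x,0)\psi(x)\,dx\to\int U_{k,0}(x)\psi(x)\,dx$. A *regularization* of $g\in L^1(\mathbb T)$ is a family of continuous functions $g^\epsilon$ on $\mathbb T$, bounded in $L^1(\mathbb T)$ uniformly in small $\epsilon$, with $g^\epsilon\to g$ in the sense of distributions as $\epsilon\to 0^+$. Let $u_0\in L^\infty(\mathbb T)$. For $\beta>0$, a *$\beta$-velocity family* for $u_0$ is a family $u^\epsilon(x,t)$, $t\ge0$, continuous in $(x,t)$ and differentiable in $x$, which is a weak asymptotic method for $\partial_tu+\partial_x(u^2)=0$, $u(\cdot,0)=u_0$, satisfies $|u^\epsilon|\le M$ with $M$ independent of $\epsilon,x,t$ and, for every $T$, $|\partial_xu^\epsilon(x,t)|\le C_T\,\epsilon^{-\beta}$ for all $x$, all $t\in[0,T]$ and all $\epsilon$. **Theorem 2.** (a) For every $u_0\in L^\infty(\mathbb T)$ there are $\nu(\epsilon)>0$ with $\nu(\epsilon)\to0$ as $\epsilon\to 0^+$ and classical solutions $u^\epsilon$ on $\mathbb R\times[0,\infty)$ of $\partial_tu^\epsilon+\partial_x((u^\epsilon)^2)=\nu(\epsilon)\,\partial_{xx}u^\epsilon$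 that form a $\beta$-velocity family for $u_0$ for every $\beta>0$. (b) Let $\beta>0$, let $(u^\epsilon)$ be any $\beta$-velocity family for $u_0$, let $v_0,w_0,Z_0\in L^1(\mathbb T)$ with regularizations $v_0^\epsilon,w_0^\epsilon,Z_0^\epsilon$, let $n\in\mathbb N$, and let $\alpha,\gamma$ satisfy $\beta<\alpha$, $\gamma>(n+2)\alpha$, $2\gamma+(n+2)\alpha<1$. Then for each $\epsilon$ the linear differential equations in the Banach space of bounded continuous $2\pi$-periodic functions $$\dot X^\epsilon=2A^\epsilon X^\epsilon,\qquad \dot w^\epsilon=2A^\epsilon w^\epsilon-2\,\partial_x\big((v^\epsilon)^n\big),\qquad \dot Z^\epsilon=2A^\epsilon Z^\epsilon-6\,\partial_x\big[(v^\epsilon w^\epsilon)*\phi_{\epsilon^\gamma}\big],$$ where $v^\epsilon=X^\epsilon*\phi_{\epsilon^\alpha}$ (convolution in $x$), with initial values $v_0^\epsilon,w_0^\epsilon,Z_0^\epsilon$, have unique global solutions on $[0,\infty)$, and $(u^\epsilon,v^\epsilon,w^\epsilon,Z^\epsilon)$ is a weak asymptotic method for $$\partial_tu+\partial_x(u^2)=0,\quad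 \partial_tv+2\partial_x(uv)=0,\quad \partial_tw+2\partial_x(uw)+2\partial_x(v^n)=0,\quad \partial_tZ+2\partial_x(uZ)+6\partial_x(vw)=0$$ with initial data $(u_0,v_0,w_0,Z_0)$. (The Panov–Shelkovich $\delta''$-system is the case $n=2$.) (c) Let $p\in\mathbb N$ and consider the $\delta^{(p)}$-system $$\partial_tU_k+\partial_x\sum_{i+j=k}\binom kiU_iU_j=0,\qquad 0\le k\le p+1,$$ with data $U_{0,0}=u_0$ and $U_{k,0}\in L^1(\mathbb T)$ ($1\le k\le p+1$), the latter with regularizations $U_{k,0}^\epsilon$. Let $\beta>0$, let $(u^\epsilon)$ be any $\beta$-velocity family for $u_0$, and let $\beta<\alpha_1$, $5\alpha_k\le\alpha_{k+1}$ for $1\le k\le p$, and $\alpha_{p+1}<1$. Put $U_0^\epsilon=u^\epsilon$ and, for $1\le k\le p+1$, $U_k^\epsilon=X_k^\epsilon*\phi_{\epsilon^{\alpha_k}}$, where $$\dot X_k^\epsilon=2A^\epsilon X_k^\epsilon-\partial_x\sum_{i+j=k,\ i,j\ge1}\binom kiU_i^\epsilon U_j^\epsilon,\qquad X_k^\epsilon(\cdot,0)=U_{k,0}^\epsilon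 .$$ These linear differential equations have unique global solutions on $[0,\infty)$ in the same Banach space, and $(U_0^\epsilon,\dots,U_{p+1}^\epsilon)$ is a weak asymptotic method for the $\delta^{(p)}$-system with data $(U_{k,0})_{0\le k\le p+1}$. -/

import Mathlib

open Set Filter Topology MeasureTheory
open scoped ContDiff ENNReal BoundedContinuousFunction

noncomputable section

namespace WeakAsymptotic

/-- A smooth compactly supported function on the line. -/
def IsTest (ψ : ℝ → ℝ) : Prop :=
  ContDiff ℝ ∞ ψ ∧ HasCompactSupport ψ

/-- A smooth compactly supported function of integral one (no sign condition). -/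
def IsMollifier (φ : ℝ → ℝ) : Prop :=
  IsTest φ ∧ ∫ x, φ x = 1

/-- `(f * φ_δ)(x)`, where `φ_δ(y) = φ(y/δ)/δ`. -/
def mollify (φ : ℝ → ℝ) (δ : ℝ) (f : ℝ → ℝ) (x : ℝ) : ℝ :=
  ∫ y, f (x - y) * (δ⁻¹ * φ (y / δ))

/-- An integrable function on the torus `ℝ / 2πℤ`, seen as a periodic function on the line. -/
def IsTorusL1 (g : ℝ → ℝ) : Prop :=
  Function.Periodic g (2 * Real.pi) ∧ LocallyIntegrable g volume

/-- A bounded measurable function on the torus (up to null sets). -/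
def IsTorusLinfty (g : ℝ → ℝ) : Prop :=
  Function.Periodic g (2 * Real.pi) ∧ MemLp g ∞ volume

/-- `g ε → g` in the sense of distributions as `ε → 0⁺`. -/
def TendstoDistrib (gε : ℝ → ℝ → ℝ) (g : ℝ → ℝ) : Prop :=
  ∀ ψ : ℝ → ℝ, IsTest ψ →
    Tendsto (fun ε => ∫ x, gε ε x * ψ x) (𝓝[>] 0) (𝓝 (∫ x, g x * ψ x))

/-- Regularized initial data: continuous, periodic, bounded in `L¹` of a period uniformly in
(small) `ε`, and converging to `g`. -/
structure IsRegularization (g : ℝ → ℝ) (gε : ℝ → ℝ → ℝ) : Prop where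
  continuous : ∀ ε ∈ Ioo (0 : ℝ) 1, Continuous (gε ε)
  periodic : ∀ ε ∈ Ioo (0 : ℝ) 1, Function.Periodic (gε ε) (2 * Real.pi)
  bounded : ∃ C : ℝ, ∀ᶠ ε in 𝓝[>] (0 : ℝ), ∫ x in (-Real.pi)..Real.pi, |gε ε x| ≤ C
  tendsto : TendstoDistrib gε g

/-- `∫ (∂ₜU ψ - F ψ') dx` at parameter `ε` and time `t`. Functions of `(ε, t, x)` are written
`U ε t x`; the time derivative is one-sided at `t = 0`. -/
def weakResidual (U F : ℝ → ℝ → ℝ → ℝ) (ψ : ℝ → ℝ) (ε t : ℝ) : ℝ :=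
  ∫ x, (derivWithin (fun s => U ε s x) (Ici 0) t * ψ x - F ε t x * deriv ψ x)

/-- The family `U ε` tends to satisfy the Cauchy problem `∂ₜU + ∂ₓF = 0`, `U(·, 0) = g`, in the
sense of distributions in `x`, uniformly for `t` in bounded intervals of `[0, ∞)`. The first three
fields say that the quantities entering the residual are meaningful. -/
structure IsWeakAsymptotic (U F : ℝ → ℝ → ℝ → ℝ) (g : ℝ → ℝ) : Prop where
  differentiable : ∀ ε ∈ Ioo (0 : ℝ) 1, ∀ t, 0 ≤ t → ∀ x,
    DifferentiableWithinAt ℝ (fun s => U ε s x) (Ici 0) t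
  locInt_deriv : ∀ ε ∈ Ioo (0 : ℝ) 1, ∀ t, 0 ≤ t →
    LocallyIntegrable (fun x => derivWithin (fun s => U ε s x) (Ici 0) t) volume
  locInt_flux : ∀ ε ∈ Ioo (0 : ℝ) 1, ∀ t, 0 ≤ t → LocallyIntegrable (F ε t) volume
  residual : ∀ ψ : ℝ → ℝ, IsTest ψ → ∀ T : ℝ,
    TendstoUniformlyOn (weakResidual U F ψ) (fun _ => 0) (𝓝[>] 0) (Icc 0 T)
  initial : TendstoDistrib (fun ε => U ε 0) g

/-- Approximate solutions of `∂ₜu + ∂ₓ(u²) = 0`, `u(·, 0) = u₀`, that are bounded uniformly in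
`(ε, t, x)` and whose `x`-derivative is `O(ε^{-β})`, uniformly in `x` and in bounded times. -/
structure IsVelocityFamily (β : ℝ) (u₀ : ℝ → ℝ) (u : ℝ → ℝ → ℝ → ℝ) : Prop where
  continuous : ∀ ε ∈ Ioo (0 : ℝ) 1,
    ContinuousOn (fun q : ℝ × ℝ => u ε q.1 q.2) (Ici 0 ×ˢ univ)
  periodic : ∀ ε ∈ Ioo (0 : ℝ) 1, ∀ t, 0 ≤ t → Function.Periodic (u ε t) (2 * Real.pi)
  differentiable : ∀ ε ∈ Ioo (0 : ℝ) 1, ∀ t, 0 ≤ t → Differentiable ℝ (u ε t)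
  bounded : ∃ M : ℝ, ∀ ε ∈ Ioo (0 : ℝ) 1, ∀ t, 0 ≤ t → ∀ x, |u ε t x| ≤ M
  deriv_bound : ∀ T : ℝ, ∃ C : ℝ, ∀ ε ∈ Ioo (0 : ℝ) 1, ∀ t ∈ Icc 0 T, ∀ x,
    |deriv (u ε t) x| ≤ C / ε ^ β
  weak : IsWeakAsymptotic u (fun ε t x => u ε t x ^ 2) u₀

/-- A classical solution on `[0, ∞) × ℝ` of `∂ₜu + ∂ₓ(u²) = ν ∂ₓₓu`. -/
def IsViscousSolution (ν : ℝ) (u : ℝ → ℝ → ℝ) : Prop :=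
  ∀ t, 0 ≤ t → ContDiff ℝ 2 (u t) ∧ ∀ x,
    HasDerivWithinAt (fun s => u s x)
      (ν * iteratedDeriv 2 (u t) x - deriv (fun y => u t y ^ 2) x) (Ici 0) t

/-- `(1/ε) [(Y c⁺)(x - ε) - (Y |c|)(x) + (Y c⁻)(x + ε)]`, with `c⁺ = max 0 c` and
`c⁻ = max 0 (-c)`. -/
def upwind (ε : ℝ) (c Y : ℝ → ℝ) (x : ℝ) : ℝ :=
  (1 / ε) * (Y (x - ε) * max 0 (c (x - ε)) - Y x * |c x| + Y (x + ε) * max 0 (-c (x + ε)))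

/-- `Y` is a global solution, in the Banach space of bounded continuous functions on the line
with the sup norm and with `2π`-periodic values, of the linear differential equation
`dY/dt = 2 upwind(Y) - S`, `Y(0) = y₀`. -/
structure IsTransportSolution (ε : ℝ) (u S : ℝ → ℝ → ℝ) (y₀ : ℝ → ℝ) (Y : ℝ → (ℝ →ᵇ ℝ)) :
    Prop where
  initial : ∀ x, Y 0 x = y₀ x
  periodic : ∀ t, 0 ≤ t → Function.Periodic (Y t) (2 * Real.pi)
  ode : ∀ t, 0 ≤ t → ∃ G : ℝ →ᵇ ℝ,
    (∀ x, G x = 2 * upwind ε (u t) (Y t) x - S t x) ∧ HasDerivWithinAt Y G (Ici 0) t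

/-- `Y` mollified in space at scale `ε^α`. -/
def smoothed (φ : ℝ → ℝ) (α : ℝ) (Y : ℝ → ℝ → (ℝ →ᵇ ℝ)) (ε t x : ℝ) : ℝ :=
  mollify φ (ε ^ α) (Y ε t) x

/-- The construction of `(X, w, Z)` from the velocity `u`, with `v = smoothed φ α X`. -/
structure IsFourConstruction (φ : ℝ → ℝ) (n : ℕ) (α γ : ℝ) (u : ℝ → ℝ → ℝ → ℝ)
    (v₀ w₀ Z₀ : ℝ → ℝ → ℝ) (X w Z : ℝ → ℝ → (ℝ →ᵇ ℝ)) : Prop where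
  X_eq : ∀ ε ∈ Ioo (0 : ℝ) 1, IsTransportSolution ε (u ε) (fun _ _ => 0) (v₀ ε) (X ε)
  w_eq : ∀ ε ∈ Ioo (0 : ℝ) 1, IsTransportSolution ε (u ε)
    (fun t x => 2 * deriv (fun y => smoothed φ α X ε t y ^ n) x) (w₀ ε) (w ε)
  Z_eq : ∀ ε ∈ Ioo (0 : ℝ) 1, IsTransportSolution ε (u ε)
    (fun t x => 6 * deriv (mollify φ (ε ^ γ) (fun y => smoothed φ α X ε t y * w ε t y)) x)
    (Z₀ ε) (Z ε)

/-- `(u, v, w, Z)` is a weak asymptotic method for the Cauchy problem of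
`∂ₜu + ∂ₓ(u²) = 0`, `∂ₜv + 2∂ₓ(uv) = 0`, `∂ₜw + 2∂ₓ(uw) + 2∂ₓ(vⁿ) = 0`,
`∂ₜZ + 2∂ₓ(uZ) + 6∂ₓ(vw) = 0`. -/
structure IsWeakAsymptoticFour (n : ℕ) (u v w Z : ℝ → ℝ → ℝ → ℝ) (u₀ v₀ w₀ Z₀ : ℝ → ℝ) :
    Prop where
  u_eq : IsWeakAsymptotic u (fun ε t x => u ε t x ^ 2) u₀
  v_eq : IsWeakAsymptotic v (fun ε t x => 2 * (u ε t x * v ε t x)) v₀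
  w_eq : IsWeakAsymptotic w (fun ε t x => 2 * (u ε t x * w ε t x) + 2 * v ε t x ^ n) w₀
  Z_eq : IsWeakAsymptotic Z
    (fun ε t x => 2 * (u ε t x * Z ε t x) + 6 * (v ε t x * w ε t x)) Z₀

/-- The flux `∑_{i+j=k} C(k,i) U_i U_j` of the `k`-th equation of the hierarchy. -/
def hierarchyFlux (U : ℕ → ℝ → ℝ → ℝ → ℝ) (k : ℕ) (ε t x : ℝ) : ℝ :=
  ∑ q ∈ Finset.HasAntidiagonal.antidiagonal k, (k.choose q.1 : ℝ) * (U q.1 ε t x * U q.2 ε t x)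

/-- The part of the flux of the `k`-th equation that involves only `U_1, …, U_{k-1}`. -/
def hierarchySource (U : ℕ → ℝ → ℝ → ℝ → ℝ) (k : ℕ) (ε t x : ℝ) : ℝ :=
  ∑ q ∈ (Finset.HasAntidiagonal.antidiagonal k).filter (fun q => 1 ≤ q.1 ∧ 1 ≤ q.2),
    (k.choose q.1 : ℝ) * (U q.1 ε t x * U q.2 ε t x)

/-- `U_0 = u`, and `U_k` is `X_k` mollified at scale `ε^{α_k}` for `k ≥ 1`. -/
def hierarchyFamily (φ : ℝ → ℝ) (α : ℕ → ℝ) (u : ℝ → ℝ → ℝ → ℝ)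
    (X : ℕ → ℝ → ℝ → (ℝ →ᵇ ℝ)) (k : ℕ) : ℝ → ℝ → ℝ → ℝ :=
  if k = 0 then u else smoothed φ (α k) (X k)

/-- The construction of `X_1, …, X_{p+1}` from the velocity `u`. -/
def IsHierarchyConstruction (φ : ℝ → ℝ) (p : ℕ) (α : ℕ → ℝ) (u : ℝ → ℝ → ℝ → ℝ)
    (y₀ : ℕ → ℝ → ℝ → ℝ) (X : ℕ → ℝ → ℝ → (ℝ →ᵇ ℝ)) : Prop :=
  ∀ k ∈ Icc 1 (p + 1), ∀ ε ∈ Ioo (0 : ℝ) 1, IsTransportSolution ε (u ε)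
    (fun t x => deriv (hierarchySource (hierarchyFamily φ α u X) k ε t) x) (y₀ k ε) (X k ε)

/-- `U_0, …, U_{p+1}` is a weak asymptotic method for the Cauchy problem of
`∂ₜU_k + ∂ₓ ∑_{i+j=k} C(k,i) U_i U_j = 0`, `0 ≤ k ≤ p + 1`. -/
def IsWeakAsymptoticHierarchy (p : ℕ) (U : ℕ → ℝ → ℝ → ℝ → ℝ) (g : ℕ → ℝ → ℝ) : Prop :=
  ∀ k ≤ p + 1, IsWeakAsymptotic (U k) (hierarchyFlux U k) (g k)

end WeakAsymptotic

end

/-! Everything rests on controlling `L¹` norms over one period, up to powers of `ε`. Under the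
upwind operator mass leaves `x` at a rate proportional to `|u|` and lands at `x ± ε`. A short
explicit Euler step is therefore a redistribution of mass with nonnegative weights of sum one
(`periodL1_add_upwind_le`). Hence transport does not increase the `L¹` norm, although its generator
has size `1/ε`, and a source contributes only its norm integrated over time
(`IsTransportSolution.periodL1_le`).

Tested against a smooth `ψ`, the upwind operator equals `-∂ₓ(uY)` up to `O(ε ‖Y‖₁)`, by a
second-order Taylor expansion of `ψ` (`exists_upwind_consistency_bound`). If the unknown is `Y`
mollified at scale `δ`, moving the mollifier onto `ψ` leaves a commutator with `u`, of size `Lip(u)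
δ ‖Y‖₁` with `Lip(u) = O(ε^(-β))`, and an error `δ ‖s‖₁` from the source flux `s`
(`exists_mollified_residual_bound`). Both criteria for a weak asymptotic method,
`isWeakAsymptotic_smoothed` and `isWeakAsymptotic_transport`, thus reduce to inequalities between
exponents of `ε`.

The exponents come from the products in the sources. Mollification at scale `ε^α` bounds both the
sup norm and the `L¹` norm of the derivative by `ε^(-α)` times the `L¹` norm
(`exists_smoothed_bounds`). The systems are triangular, so growth exponents are computed one
equation after another, and the conditions on the scales leave every error a positive power of `ε`.
Existence and uniqueness hold because each equation is linear with bounded operators depending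
continuously on time, and its source is already known.

Velocities come from the Cole–Hopf transformation. The viscous solution is a weighted Gaussian
average of its initial value, which gives the maximum principle, and its slope is `O(1/ν)` when the
data are mollified at scale `ν`. A viscosity decaying like `1/log(1/ε)` makes the slope smaller than
every negative power of `ε`, up to a constant, while the residual `ν ∫ u ψ''` still vanishes in the
limit. -/

noncomputable section

namespace WeakAsymptotic

/-! ### The `L¹` norm over one period -/

/-- The `L¹` norm of a function over the period `[-π, π]`. -/
def periodL1 (f : ℝ → ℝ) : ℝ := ∫ x in (-Real.pi)..Real.pi, |f x|

lemma neg_pi_le_pi : -Real.pi ≤ Real.pi := by linarith [Real.pi_pos]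

lemma periodL1_nonneg (f : ℝ → ℝ) : 0 ≤ periodL1 f :=
  intervalIntegral.integral_nonneg neg_pi_le_pi fun _ _ => abs_nonneg _

lemma periodL1_mono {f g : ℝ → ℝ} (hf : Continuous f) (hg : Continuous g)
    (h : ∀ x, |f x| ≤ |g x|) : periodL1 f ≤ periodL1 g :=
  intervalIntegral.integral_mono_on neg_pi_le_pi (hf.abs.intervalIntegrable _ _)
    (hg.abs.intervalIntegrable _ _) fun x _ => h x

lemma periodL1_add_le {f g : ℝ → ℝ} (hf : Continuous f) (hg : Continuous g) :
    periodL1 (fun x => f x + g x) ≤ periodL1 f + periodL1 g := by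
  unfold periodL1
  rw [← intervalIntegral.integral_add (hf.abs.intervalIntegrable _ _)
    (hg.abs.intervalIntegrable _ _)]
  exact intervalIntegral.integral_mono_on neg_pi_le_pi ((hf.add hg).abs.intervalIntegrable _ _)
    ((hf.abs.add hg.abs).intervalIntegrable _ _) fun x _ => abs_add_le _ _

lemma periodL1_const_mul (c : ℝ) (f : ℝ → ℝ) :
    periodL1 (fun x => c * f x) = |c| * periodL1 f := by
  simp [periodL1, abs_mul]

lemma periodL1_mul_le {f g : ℝ → ℝ} {B : ℝ} (hf : Continuous f) (hg : Continuous g)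
    (hB : ∀ x, |f x| ≤ B) : periodL1 (fun x => f x * g x) ≤ B * periodL1 g := by
  have hB0 : 0 ≤ B := (abs_nonneg _).trans (hB 0)
  rw [← abs_of_nonneg hB0, ← periodL1_const_mul]
  refine periodL1_mono (hf.mul hg) (continuous_const.mul hg) fun x => ?_
  rw [abs_mul, abs_mul, abs_of_nonneg hB0]
  exact mul_le_mul_of_nonneg_right (hB x) (abs_nonneg _)

lemma periodL1_le_of_abs_le {f : ℝ → ℝ} {B : ℝ} (hf : Continuous f) (hB : ∀ x, |f x| ≤ B) :
    periodL1 f ≤ 2 * Real.pi * B := by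
  have h := intervalIntegral.integral_mono_on (μ := volume) neg_pi_le_pi
    (hf.abs.intervalIntegrable _ _) (continuous_const.intervalIntegrable _ _)
    (fun x _ => hB x)
  rw [intervalIntegral.integral_const, smul_eq_mul] at h
  unfold periodL1
  linarith

lemma periodL1_sum_le {ι : Type*} (s : Finset ι) {f : ι → ℝ → ℝ}
    (hf : ∀ i ∈ s, Continuous (f i)) :
    periodL1 (fun x => ∑ i ∈ s, f i x) ≤ ∑ i ∈ s, periodL1 (f i) := by
  unfold periodL1
  rw [← intervalIntegral.integral_finsetSum fun i hi => (hf i hi).abs.intervalIntegrable _ _]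
  exact intervalIntegral.integral_mono_on neg_pi_le_pi
    ((continuous_finsetSum s hf).abs.intervalIntegrable _ _)
    ((continuous_finsetSum s fun i hi => (hf i hi).abs).intervalIntegrable _ _)
    fun x _ => Finset.abs_sum_le_sum_abs _ _

lemma intervalIntegral_period {f : ℝ → ℝ} (hf : Function.Periodic f (2 * Real.pi)) (a : ℝ) :
    ∫ x in a..a + 2 * Real.pi, f x = ∫ x in (-Real.pi)..Real.pi, f x := by
  rw [hf.intervalIntegral_add_eq a (-Real.pi)]
  congr 1
  ring

lemma periodic_abs {f : ℝ → ℝ} {c : ℝ} (hf : Function.Periodic f c) :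
    Function.Periodic (fun x => |f x|) c := fun x => by simp [hf x]

lemma periodL1_comp_add {f : ℝ → ℝ} (hf : Function.Periodic f (2 * Real.pi)) (a : ℝ) :
    periodL1 (fun x => f (x + a)) = periodL1 f := by
  unfold periodL1
  rw [intervalIntegral.integral_comp_add_right (fun x => |f x|),
    ← intervalIntegral_period (periodic_abs hf) (-Real.pi + a)]
  congr 1
  ring

lemma periodL1_comp_sub_left {f : ℝ → ℝ} (hf : Function.Periodic f (2 * Real.pi)) (a : ℝ) :
    periodL1 (fun x => f (a - x)) = periodL1 f := by
  unfold periodL1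
  rw [intervalIntegral.integral_comp_sub_left (fun x => |f x|),
    ← intervalIntegral_period (periodic_abs hf) (a - Real.pi)]
  congr 1
  ring

/-- A periodic function paired with a bounded function of bounded support is controlled by its
`L¹` norm over a period. -/
lemma exists_pairing_bound (R : ℝ) : ∃ C : ℝ, 0 ≤ C ∧ ∀ (f g : ℝ → ℝ) (B : ℝ),
    LocallyIntegrable f volume → Function.Periodic f (2 * Real.pi) →
    (∀ x, R < |x| → g x = 0) → (∀ x, |g x| ≤ B) →
    |∫ x, f x * g x| ≤ C * B * periodL1 f := by
  -- The interval `[-mπ, mπ]` contains the support of `g` and consists of `m` periods, whence the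
  -- constant `m`.
  obtain ⟨m, hm⟩ := exists_nat_ge (R / Real.pi)
  have hpi := Real.pi_pos
  have hRm : R ≤ m * Real.pi := by rwa [div_le_iff₀ hpi] at hm
  refine ⟨m, Nat.cast_nonneg _, fun f g B hf hp hg hB => ?_⟩
  have hB0 : 0 ≤ B := (abs_nonneg _).trans (hB 0)
  have hfi : ∀ a b, IntervalIntegrable (fun x => |f x|) volume a b := fun a b =>
    ((intervalIntegrable_iff).2 ((hf.integrableOn_isCompact isCompact_uIcc).mono_set
      uIoc_subset_uIcc)).norm
  have hle : -(m * Real.pi) ≤ m * Real.pi := by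
    have : 0 ≤ (m : ℝ) * Real.pi := by positivity
    linarith
  have hfint : IntegrableOn (fun x => B * |f x|) (Icc (-(m * Real.pi)) (m * Real.pi)) :=
    ((hf.integrableOn_isCompact isCompact_Icc).norm).const_mul B
  have h1 : ‖∫ x, f x * g x‖ ≤
      ∫ x, (Icc (-(m * Real.pi)) (m * Real.pi)).indicator (fun x => B * |f x|) x := by
    refine norm_integral_le_of_norm_le (hfint.integrable_indicator measurableSet_Icc)
      (Eventually.of_forall fun x => ?_)
    by_cases hx : x ∈ Icc (-(m * Real.pi)) (m * Real.pi)
    · rw [indicator_of_mem hx, Real.norm_eq_abs, abs_mul, mul_comm]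
      exact mul_le_mul_of_nonneg_right (hB x) (abs_nonneg _)
    · rw [indicator_of_notMem hx, hg x]
      · simp
      · by_contra h
        exact hx (abs_le.1 ((not_lt.1 h).trans hRm))
  rw [integral_indicator measurableSet_Icc, integral_Icc_eq_integral_Ioc,
    ← intervalIntegral.integral_of_le hle, intervalIntegral.integral_const_mul] at h1
  have h2 := (periodic_abs hp).intervalIntegral_add_zsmul_eq m (-(m * Real.pi)) hfi
  have h3 : -(m * Real.pi) + (m : ℤ) • (2 * Real.pi) = m * Real.pi := by
    simp only [zsmul_eq_mul, Int.cast_natCast]; ring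
  rw [h3, intervalIntegral_period (periodic_abs hp)] at h2
  rw [h2] at h1
  rw [Real.norm_eq_abs] at h1
  refine h1.trans_eq ?_
  simp only [zsmul_eq_mul, Int.cast_natCast, periodL1]
  ring

/-! ### Test functions -/

namespace IsTest

variable {k : ℝ → ℝ}

lemma continuous (hk : IsTest k) : Continuous k := hk.1.continuous

lemma differentiable (hk : IsTest k) : Differentiable ℝ k := hk.1.differentiable (by simp)

lemma integrable (hk : IsTest k) : Integrable k :=
  hk.continuous.integrable_of_hasCompactSupport hk.2

lemma deriv (hk : IsTest k) : IsTest (deriv k) :=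
  ⟨hk.1.deriv', hk.2.deriv⟩

lemma comp_neg (hk : IsTest k) : IsTest (fun x => k (-x)) :=
  ⟨hk.1.comp contDiff_neg, hk.2.comp_homeomorph (Homeomorph.neg ℝ)⟩

lemma scaled (hk : IsTest k) {δ : ℝ} (hδ : δ ≠ 0) : IsTest (fun y => δ⁻¹ * k (y / δ)) := by
  refine ⟨contDiff_const.mul (hk.1.comp (contDiff_id.div_const δ)), ?_⟩
  have h : HasCompactSupport (fun y => k (y / δ)) := by
    have := hk.2.comp_homeomorph (Homeomorph.mulRight₀ δ⁻¹ (inv_ne_zero hδ))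
    simpa [Function.comp_def, div_eq_mul_inv] using this
  exact h.mul_left

lemma exists_bound (hk : IsTest k) : ∃ B : ℝ, ∀ x, |k x| ≤ B := by
  obtain ⟨B, hB⟩ := hk.2.exists_bound_of_continuous hk.continuous
  exact ⟨B, hB⟩

lemma exists_support_bound (hk : IsTest k) : ∃ R : ℝ, 0 < R ∧ ∀ x, R < |x| → k x = 0 := by
  obtain ⟨R, hR0, hR⟩ := hk.2.isCompact.isBounded.exists_pos_norm_le
  refine ⟨R, hR0, fun x hx => ?_⟩
  by_contra h
  exact absurd (hR x (subset_tsupport _ h)) (not_le.2 hx)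

end IsTest

lemma deriv_eq_zero_of_support {k : ℝ → ℝ} {R : ℝ} (h : ∀ x, R < |x| → k x = 0) (x : ℝ)
    (hx : R < |x|) : deriv k x = 0 := by
  have : k =ᶠ[𝓝 x] fun _ => 0 := by
    filter_upwards [(isOpen_lt continuous_const continuous_abs).mem_nhds hx] with y hy
    exact h y hy
  rw [this.deriv_eq, deriv_const]

/-! ### Mollification -/

section Mollify

variable {k f : ℝ → ℝ} {δ : ℝ}

lemma mollify_eq_convolution (k : ℝ → ℝ) (δ : ℝ) (f : ℝ → ℝ) :
    mollify k δ f =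
      convolution (fun y => δ⁻¹ * k (y / δ)) f (ContinuousLinearMap.mul ℝ ℝ) volume := by
  ext x
  simp only [mollify, convolution, ContinuousLinearMap.mul_apply']
  exact integral_congr_ae (Eventually.of_forall fun y => mul_comm _ _)

/-- The substitution `y = δ z` moves `δ` from the kernel to the argument of `f`, so that bounds
uniform in `δ` can be read off. -/
lemma mollify_eq_integral (k : ℝ → ℝ) (hδ : 0 < δ) (f : ℝ → ℝ) (x : ℝ) :
    mollify k δ f x = ∫ z, f (x - δ * z) * k z := by
  have h := Measure.integral_comp_div (fun z => f (x - δ * z) * k z) δ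
  rw [abs_of_pos hδ, smul_eq_mul] at h
  have h2 : ∫ z, f (x - δ * z) * k z = δ⁻¹ * ∫ y, f (x - δ * (y / δ)) * k (y / δ) := by
    rw [h, ← mul_assoc, inv_mul_cancel₀ hδ.ne', one_mul]
  rw [h2, ← integral_const_mul, mollify]
  refine integral_congr_ae (Eventually.of_forall fun y => ?_)
  have : δ * (y / δ) = y := by field_simp
  simp only [this]
  ring

lemma continuous_mollify (hk : IsTest k) (hδ : 0 < δ) (hf : LocallyIntegrable f volume) :
    Continuous (mollify k δ f) := by
  rw [mollify_eq_convolution]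
  exact (hk.scaled hδ.ne').2.continuous_convolution_left _ (hk.scaled hδ.ne').continuous hf

lemma contDiff_mollify (hk : IsTest k) (hδ : 0 < δ) (hf : LocallyIntegrable f volume) :
    ContDiff ℝ ∞ (mollify k δ f) := by
  rw [mollify_eq_convolution]
  exact (hk.scaled hδ.ne').2.contDiff_convolution_left _ (hk.scaled hδ.ne').1 hf

lemma deriv_scaled (hk : IsTest k) (y : ℝ) :
    deriv (fun y => δ⁻¹ * k (y / δ)) y = δ⁻¹ * (δ⁻¹ * deriv k (y / δ)) := by
  have h : HasDerivAt (fun y => δ⁻¹ * k (y / δ)) (δ⁻¹ * (deriv k (y / δ) * (1 / δ))) y :=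
    (HasDerivAt.comp y (hk.differentiable (y / δ)).hasDerivAt
      ((hasDerivAt_id y).div_const δ)).const_mul δ⁻¹
  rw [h.deriv]
  ring

/-- The derivative falls on the kernel: it costs a factor `δ⁻¹`, and `f` need only be locally
integrable. -/
lemma hasDerivAt_mollify (hk : IsTest k) (hδ : 0 < δ) (hf : LocallyIntegrable f volume) (x : ℝ) :
    HasDerivAt (mollify k δ f) (δ⁻¹ * mollify (deriv k) δ f x) x := by
  have hs := hk.scaled hδ.ne'
  have h := hs.2.hasDerivAt_convolution_left (ContinuousLinearMap.mul ℝ ℝ)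
    (hs.1.of_le (by simp)) hf x
  rw [← mollify_eq_convolution] at h
  refine h.congr_deriv ?_
  simp only [mollify, convolution, ContinuousLinearMap.mul_apply', deriv_scaled hk]
  rw [← integral_const_mul]
  refine integral_congr_ae (Eventually.of_forall fun y => ?_)
  simp only
  ring

/-- The derivative falls on `f`, without loss in `δ`. This keeps the derivatives of mollified test
functions bounded uniformly in the scale. -/
lemma hasDerivAt_mollify_of_test (hk : IsTest k) (hδ : 0 < δ) (hf : IsTest f) (x : ℝ) :
    HasDerivAt (mollify k δ f) (mollify k δ (deriv f) x) x := by
  have hs := hk.scaled hδ.ne'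
  have h := hf.2.hasDerivAt_convolution_right (ContinuousLinearMap.mul ℝ ℝ)
    (hs.continuous.locallyIntegrable (μ := volume)) (hf.1.of_le (by simp)) x
  rwa [← mollify_eq_convolution, ← mollify_eq_convolution] at h

lemma mollify_periodic (k : ℝ → ℝ) (δ : ℝ) {c : ℝ} (hf : Function.Periodic f c) :
    Function.Periodic (mollify k δ f) c := fun x => by
  unfold mollify
  congr 1
  ext y
  rw [show x + c - y = x - y + c by ring, hf]

/-- With `δ ≤ 1` the enlarged radius does not depend on `δ`, so a single constant of
`exists_pairing_bound` serves all scales. -/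
lemma mollify_support {R R' : ℝ} (hδ : 0 < δ) (hδ1 : δ ≤ 1) (hR' : 0 ≤ R')
    (hk : ∀ x, R' < |x| → k x = 0)
    (hf : ∀ x, R < |x| → f x = 0) (x : ℝ) (hx : R + R' < |x|) : mollify k δ f x = 0 := by
  rw [mollify_eq_integral k hδ]
  refine integral_eq_zero_of_ae (Eventually.of_forall fun z => ?_)
  by_cases hz : R' < |z|
  · simp [hk z hz]
  · have h1 : |δ * z| ≤ R' := by
      rw [abs_mul, abs_of_pos hδ]
      nlinarith [abs_nonneg z]
    have h2 : |x| ≤ |x - δ * z| + |δ * z| := by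
      have := abs_add_le (x - δ * z) (δ * z)
      simpa using this
    simp [hf (x - δ * z) (by linarith)]

lemma IsTest.mollify (hk : IsTest k) (hf : IsTest f) (hδ : 0 < δ) :
    IsTest (mollify k δ f) := by
  refine ⟨contDiff_mollify hk hδ hf.continuous.locallyIntegrable, ?_⟩
  rw [mollify_eq_convolution]
  exact (hk.scaled hδ.ne').2.convolution _ hf.2

/-- An almost everywhere bound is all that an initial velocity in `L∞` offers. -/
lemma abs_mollify_le (hk : IsTest k) (hδ : 0 < δ) {B : ℝ} (hB : ∀ᵐ x, |f x| ≤ B) (x : ℝ) :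
    |mollify k δ f x| ≤ B * ∫ z, |k z| := by
  have h : ∫ z, B * |k z| = B * ∫ z, |k z| := integral_const_mul _ _
  have hs := hk.scaled hδ.ne'
  have hB' : ∀ᵐ y, |f (x - y)| ≤ B :=
    (Measure.measurePreserving_sub_left volume x).quasiMeasurePreserving.ae hB
  have h1 : |mollify k δ f x| ≤ ∫ y, B * |δ⁻¹ * k (y / δ)| := by
    rw [← Real.norm_eq_abs]
    refine norm_integral_le_of_norm_le (hs.integrable.norm.const_mul B) ?_
    filter_upwards [hB'] with y hy
    rw [Real.norm_eq_abs, abs_mul]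
    exact mul_le_mul_of_nonneg_right hy (abs_nonneg _)
  refine h1.trans_eq ?_
  have h2 := Measure.integral_comp_div (fun z => B * |k z|) δ
  simp_rw [abs_mul, abs_of_pos (inv_pos.2 hδ)]
  rw [integral_const_mul, integral_const_mul]
  rw [integral_const_mul, integral_const_mul, abs_of_pos hδ, smul_eq_mul] at h2
  rw [mul_left_comm, h2, ← h]
  rw [inv_mul_cancel_left₀ hδ.ne', integral_const_mul]

lemma integrable_mollify_integrand (hk : IsTest k) {M : ℝ} (hf : Continuous f)
    (hM : ∀ x, |f x| ≤ M) (x : ℝ) : Integrable (fun z => f (x - δ * z) * k z) :=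
  hk.integrable.bdd_mul (c := M) (by fun_prop) (Eventually.of_forall fun z => hM _)

lemma integrable_abs_mul_test (hk : IsTest k) : Integrable (fun z => |z| * |k z|) :=
  (continuous_abs.mul hk.continuous.abs).integrable_of_hasCompactSupport
    (hk.2.norm.mul_left)

/-- Mollification and multiplication by a Lipschitz function almost commute. -/
lemma abs_mul_mollify_sub_le (hk : IsTest k) (hδ : 0 < δ) {u : ℝ → ℝ} {L B M : ℝ}
    (hL0 : 0 ≤ L) (hu : Continuous u)
    (hL : ∀ x y, |u x - u y| ≤ L * |x - y|) (hM : ∀ x, |u x| ≤ M)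
    (hf : Continuous f) (hB : ∀ x, |f x| ≤ B) (x : ℝ) :
    |u x * mollify k δ f x - mollify k δ (fun y => u y * f y) x| ≤
      L * B * (∫ z, |z| * |k z|) * δ := by
  have hB0 : 0 ≤ B := (abs_nonneg _).trans (hB 0)
  have hM0 : 0 ≤ M := (abs_nonneg _).trans (hM 0)
  rw [mollify_eq_integral k hδ, mollify_eq_integral k hδ, ← integral_const_mul,
    ← integral_sub ((integrable_mollify_integrand hk hf hB x).const_mul _)
      (integrable_mollify_integrand hk (f := fun y => u y * f y) (hu.mul hf) (M := M * B)
        (fun y => ?_) x)]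
  · rw [mul_assoc, mul_comm (∫ z, |z| * |k z|), ← mul_assoc, ← integral_const_mul]
    rw [← Real.norm_eq_abs]
    refine norm_integral_le_of_norm_le ((integrable_abs_mul_test hk).const_mul _)
      (Eventually.of_forall fun z => ?_)
    rw [show u x * (f (x - δ * z) * k z) - u (x - δ * z) * f (x - δ * z) * k z
      = (u x - u (x - δ * z)) * f (x - δ * z) * k z by ring, Real.norm_eq_abs, abs_mul, abs_mul]
    have h1 := hL x (x - δ * z)
    rw [sub_sub_cancel, abs_mul, abs_of_pos hδ] at h1
    calc _ ≤ (L * (δ * |z|)) * B * |k z| := by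
          gcongr
          exact hB _
      _ = _ := by ring
  · rw [abs_mul]
    exact mul_le_mul (hM y) (hB y) (abs_nonneg _) hM0

lemma mollify_const {φ : ℝ → ℝ} (hφ : IsMollifier φ) (hδ : 0 < δ) (c x : ℝ) :
    mollify φ δ (fun _ => c) x = c := by
  rw [mollify_eq_integral φ hδ, integral_const_mul, hφ.2, mul_one]

/-- The commutator estimate with the constant function 1 in place of the mollified factor, since
mollification fixes constants when `∫ φ = 1`. Neither a sign nor symmetry of `φ` enters. -/
lemma abs_mollify_sub_le {φ : ℝ → ℝ} (hφ : IsMollifier φ) (hδ : 0 < δ) {L M : ℝ} (hL0 : 0 ≤ L)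
    (hf : Continuous f) (hL : ∀ x y, |f x - f y| ≤ L * |x - y|) (hM : ∀ x, |f x| ≤ M) (x : ℝ) :
    |mollify φ δ f x - f x| ≤ L * (∫ z, |z| * |φ z|) * δ := by
  have h := abs_mul_mollify_sub_le (f := fun _ => 1) (B := 1) hφ.1 hδ hL0 hf hL hM
    continuous_const (by simp) x
  rw [mollify_const hφ hδ] at h
  rw [abs_sub_comm]
  simpa using h

lemma IsMollifier.comp_neg {φ : ℝ → ℝ} (hφ : IsMollifier φ) :
    IsMollifier (fun x => φ (-x)) :=
  ⟨hφ.1.comp_neg, by rw [integral_neg_eq_self]; exact hφ.2⟩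

/-- The adjoint of mollification by `k` is mollification by the reflection of `k`. -/
lemma integral_mollify_mul (hk : IsTest k) (hδ : 0 < δ) (hf : LocallyIntegrable f volume)
    {g : ℝ → ℝ} (hg : Continuous g) (hgs : HasCompactSupport g) :
    ∫ x, mollify k δ f x * g x = ∫ x, f x * mollify (fun y => k (-y)) δ g x := by
  set K : ℝ → ℝ := fun y => δ⁻¹ * k (y / δ) with hKdef
  have hK : IsTest K := hk.scaled hδ.ne'
  obtain ⟨R₁, -, h₁⟩ := hK.exists_support_bound
  obtain ⟨R₂, -, h₂⟩ : ∃ R : ℝ, 0 < R ∧ ∀ x, R < |x| → g x = 0 := by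
    obtain ⟨R, hR0, hR⟩ := hgs.isCompact.isBounded.exists_pos_norm_le
    refine ⟨R, hR0, fun x hx => ?_⟩
    by_contra h
    exact absurd (hR x (subset_tsupport _ h)) (not_le.2 hx)
  obtain ⟨B, hB⟩ := hgs.exists_bound_of_continuous hg
  -- `f` is only locally integrable. Cutting it off outside the region reached through the supports
  -- of `K` and `g` changes no integrand and makes Fubini applicable.
  set F : ℝ → ℝ := (Icc (-(R₂ + R₁)) (R₂ + R₁)).indicator f with hFdef
  have hF : Integrable F :=
    (hf.integrableOn_isCompact isCompact_Icc).integrable_indicator measurableSet_Icc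
  have hFf : ∀ x, |x| ≤ R₂ + R₁ → F x = f x := fun x hx =>
    indicator_of_mem (s := Icc _ _) (abs_le.1 hx) f
  have e1 : ∀ x y, f (x - y) * K y * g x = K y * F (x - y) * g x := fun x y => by
    by_cases hy : R₁ < |y|
    · simp [h₁ y hy]
    by_cases hx : R₂ < |x|
    · simp [h₂ x hx]
    rw [hFf (x - y) (by linarith [abs_sub x y, not_lt.1 hy, not_lt.1 hx])]
    ring
  have e2 : ∀ x y, K y * F x * g (x + y) = f x * (K y * g (x + y)) := fun x y => by
    by_cases hy : R₁ < |y|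
    · simp [h₁ y hy]
    by_cases hx : R₂ < |x + y|
    · simp [h₂ _ hx]
    rw [hFf x]
    · ring
    · have := abs_sub (x + y) y
      simp only [add_sub_cancel_right] at this
      linarith [not_lt.1 hy, not_lt.1 hx]
  have i1 : Integrable (Function.uncurry fun x y => K y * F (x - y) * g x)
      (volume.prod volume) := by
    have h := Integrable.convolution_integrand (ContinuousLinearMap.mul ℝ ℝ)
      (μ := volume) (ν := volume) hK.integrable hF
    refine (h.bdd_mul (f := fun p : ℝ × ℝ => g p.1) (c := B)
      (hg.comp continuous_fst).aestronglyMeasurable (Eventually.of_forall fun p => hB _)).congr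
      (Eventually.of_forall fun p => ?_)
    simp only [ContinuousLinearMap.mul_apply', Function.uncurry]
    ring
  have i2 : Integrable (Function.uncurry fun x y => K y * F x * g (x + y))
      (volume.prod volume) := by
    have h := hF.mul_prod (μ := volume) (ν := volume) hK.integrable
    refine (h.bdd_mul (f := fun p : ℝ × ℝ => g (p.1 + p.2)) (c := B)
      (by fun_prop) (Eventually.of_forall fun p => hB _)).congr
      (Eventually.of_forall fun p => ?_)
    simp only [Function.uncurry]
    ring
  calc ∫ x, mollify k δ f x * g x = ∫ x, ∫ y, K y * F (x - y) * g x := by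
        congr 1; ext x
        rw [mollify, ← integral_mul_const]
        congr 1; ext y
        exact e1 x y
    _ = ∫ y, ∫ x, K y * F (x - y) * g x := integral_integral_swap i1
    _ = ∫ y, ∫ x, K y * F x * g (x + y) := by
        congr 1; ext y
        rw [← integral_add_right_eq_self _ y]
        simp
    _ = ∫ x, ∫ y, K y * F x * g (x + y) := (integral_integral_swap i2).symm
    _ = _ := by
        congr 1; ext x
        simp_rw [e2]
        rw [integral_const_mul, mollify, ← integral_neg_eq_self]
        congr 2; ext y
        simp only [hKdef, neg_div, sub_eq_add_neg]
        ring

/-- The value at `x` pairs a translate of `f` with a kernel of height `O(δ⁻¹)` whose support stays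
in a fixed ball because `δ ≤ 1`. Through this bound sup norms of mollified components cost powers of
`ε`. -/
lemma exists_mollify_sup_bound (hk : IsTest k) : ∃ C : ℝ, 0 ≤ C ∧ ∀ (δ : ℝ) (f : ℝ → ℝ),
    0 < δ → δ ≤ 1 → Continuous f → Function.Periodic f (2 * Real.pi) →
    ∀ x, |mollify k δ f x| ≤ C * δ⁻¹ * periodL1 f := by
  obtain ⟨R, hR0, hR⟩ := hk.exists_support_bound
  obtain ⟨B, hB⟩ := hk.exists_bound
  obtain ⟨C, hC0, hC⟩ := exists_pairing_bound R
  have hB0 : 0 ≤ B := (abs_nonneg _).trans (hB 0)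
  refine ⟨C * B, by positivity, fun δ f hδ hδ1 hf hp x => ?_⟩
  have h := hC (fun y => f (x - y)) (fun y => δ⁻¹ * k (y / δ)) (δ⁻¹ * B)
    (by fun_prop : Continuous fun y => f (x - y)).locallyIntegrable
    (fun y => by simp only [show x - (y + 2 * Real.pi) = x - y - 2 * Real.pi by ring, hp.sub_eq])
    (fun y hy => ?_) (fun y => ?_)
  · rw [periodL1_comp_sub_left hp] at h
    refine h.trans_eq ?_
    ring
  · rw [hR, mul_zero]
    rw [abs_div, abs_of_pos hδ, lt_div_iff₀ hδ]
    nlinarith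
  · rw [abs_mul, abs_of_pos (inv_pos.2 hδ)]
    gcongr
    exact hB _

lemma exists_abs_bound_of_periodic (hf : Continuous f)
    (hp : Function.Periodic f (2 * Real.pi)) : ∃ M : ℝ, 0 ≤ M ∧ ∀ x, |f x| ≤ M := by
  obtain ⟨M, hM⟩ := isCompact_Icc.exists_bound_of_continuousOn (s := Icc 0 (0 + 2 * Real.pi))
    hf.continuousOn
  have h : ∀ x, |f x| ≤ M := fun x => by
    obtain ⟨y, hy, hxy⟩ := hp.exists_mem_Ico₀ (by positivity) x
    rw [hxy]
    exact hM y ⟨hy.1, by simpa using hy.2.le⟩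
  exact ⟨M, (abs_nonneg _).trans (h 0), h⟩

/-- By Fubini, since all translates of `f` have the same norm over a period. No power of `δ` is
lost. -/
lemma periodL1_mollify_le (hk : IsTest k) (hδ : 0 < δ) (hf : Continuous f)
    (hp : Function.Periodic f (2 * Real.pi)) :
    periodL1 (mollify k δ f) ≤ (∫ z, |k z|) * periodL1 f := by
  obtain ⟨M, hM0, hM⟩ := exists_abs_bound_of_periodic hf hp
  have i1 : Integrable (Function.uncurry fun x z => |f (x - δ * z)| * |k z|)
      ((volume.restrict (Ioc (-Real.pi) Real.pi)).prod volume) := by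
    have h : Integrable (fun p : ℝ × ℝ => (1 : ℝ) * |k p.2|)
      ((volume.restrict (Ioc (-Real.pi) Real.pi)).prod volume) :=
      (integrable_const (1 : ℝ)).mul_prod hk.integrable.norm
    refine (h.bdd_mul (f := fun p : ℝ × ℝ => |f (p.1 - δ * p.2)|) (c := M)
      (by fun_prop) (Eventually.of_forall fun p => ?_)).congr
      (Eventually.of_forall fun p => ?_)
    · simpa using hM _
    · simp [Function.uncurry]
  have h1 : periodL1 (mollify k δ f) ≤
      ∫ x in (-Real.pi)..Real.pi, ∫ z, |f (x - δ * z)| * |k z| := by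
    unfold periodL1
    rw [intervalIntegral.integral_of_le neg_pi_le_pi, intervalIntegral.integral_of_le neg_pi_le_pi]
    refine integral_mono ?_ i1.integral_prod_left fun x => ?_
    · exact ((continuous_mollify hk hδ hf.locallyIntegrable).abs.integrableOn_Icc).mono_set
        Ioc_subset_Icc_self
    · simp only
      rw [mollify_eq_integral k hδ, ← Real.norm_eq_abs]
      refine (norm_integral_le_integral_norm _).trans_eq ?_
      simp
  refine h1.trans_eq ?_
  rw [intervalIntegral.integral_of_le neg_pi_le_pi, integral_integral_swap i1,
    ← integral_mul_const]
  congr 1; ext z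
  rw [integral_mul_const, mul_comm]
  congr 1
  rw [← intervalIntegral.integral_of_le neg_pi_le_pi]
  have := periodL1_comp_add hp (-(δ * z))
  simpa only [periodL1, ← sub_eq_add_neg] using this

end Mollify

/-! ### Linear differential equations in a Banach space -/

section LinearODE

variable {E : Type*} [NormedAddCommGroup E] [NormedSpace ℝ E]

/-- The terms of the Picard series of the linear equation `y' = A t y + b t`, `y 0 = y₀`. -/
def picardTerm (A : ℝ → E →L[ℝ] E) (b : ℝ → E) (y₀ : E) : ℕ → ℝ → E
  | 0, t => y₀ + ∫ s in (0 : ℝ)..t, b s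
  | n + 1, t => ∫ s in (0 : ℝ)..t, A s (picardTerm A b y₀ n s)

lemma abs_sinh_le_cosh (x : ℝ) : |Real.sinh x| ≤ Real.cosh x := by
  rw [abs_le]
  have h1 := Real.cosh_add_sinh x
  have h2 := Real.cosh_sub_sinh x
  constructor <;> linarith [Real.exp_pos x, Real.exp_pos (-x)]

lemma integral_cosh_mul {a : ℝ} (ha : a ≠ 0) (t : ℝ) :
    ∫ s in (0 : ℝ)..t, Real.cosh (a * s) = Real.sinh (a * t) / a := by
  have h : ∀ s ∈ uIcc 0 t, HasDerivAt (fun s => Real.sinh (a * s) / a) (Real.cosh (a * s)) s := by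
    intro s _
    have := ((Real.hasDerivAt_sinh (a * s)).comp s ((hasDerivAt_id s).const_mul a)).div_const a
    refine this.congr_deriv ?_
    field_simp
  rw [intervalIntegral.integral_eq_sub_of_hasDerivAt h
    (Continuous.intervalIntegrable (by fun_prop) _ _)]
  simp

variable {A : ℝ → E →L[ℝ] E} {b : ℝ → E}

lemma hasDerivAt_picardTerm_zero [CompleteSpace E] (hb : Continuous b) (y₀ : E) (t : ℝ) :
    HasDerivAt (picardTerm A b y₀ 0) (b t) t :=
  (intervalIntegral.integral_hasDerivAt_right (hb.intervalIntegrable _ _)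
    (hb.stronglyMeasurableAtFilter _ _) hb.continuousAt).const_add y₀

lemma continuous_picardTerm [CompleteSpace E] (hA : Continuous A) (hb : Continuous b) (y₀ : E) (n : ℕ) :
    Continuous (picardTerm A b y₀ n) := by
  induction n with
  | zero =>
    exact continuous_iff_continuousAt.2 fun t => (hasDerivAt_picardTerm_zero hb y₀ t).continuousAt
  | succ n ih =>
    have hc : Continuous fun s => A s (picardTerm A b y₀ n s) := hA.clm_apply ih
    exact continuous_iff_continuousAt.2 fun t =>
      (intervalIntegral.integral_hasDerivAt_right (hc.intervalIntegrable 0 t)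
        (hc.stronglyMeasurableAtFilter _ _) hc.continuousAt).continuousAt

lemma hasDerivAt_picardTerm_succ [CompleteSpace E] (hA : Continuous A) (hb : Continuous b)
    (y₀ : E) (n : ℕ) (t : ℝ) :
    HasDerivAt (picardTerm A b y₀ (n + 1)) (A t (picardTerm A b y₀ n t)) t := by
  have hc : Continuous fun s => A s (picardTerm A b y₀ n s) :=
    hA.clm_apply (continuous_picardTerm hA hb y₀ n)
  exact intervalIntegral.integral_hasDerivAt_right (hc.intervalIntegrable 0 t)
    (hc.stronglyMeasurableAtFilter _ _) hc.continuousAt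

/-- The weight `cosh (2Kt)` absorbs the time integral: `K` times its integral is `sinh (2Kt) / 2`,
so each Picard step halves the constant. Being even, the weight handles both signs of time at once.
-/
lemma norm_picardTerm_le {K C T : ℝ} (hK : 0 < K) (hAK : ∀ t, ‖A t‖ ≤ K) (y₀ : E)
    (hC : ∀ t ∈ Icc (-T) T, ‖picardTerm A b y₀ 0 t‖ ≤ C) (n : ℕ) :
    ∀ t ∈ Icc (-T) T, ‖picardTerm A b y₀ n t‖ ≤ C * (1 / 2) ^ n * Real.cosh (2 * K * t) := by
  induction n with
  | zero =>
    intro t ht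
    have h0 : 0 ≤ C := (norm_nonneg _).trans (hC t ht)
    calc _ ≤ C * 1 := by rw [mul_one]; exact hC t ht
      _ ≤ C * Real.cosh (2 * K * t) := by gcongr; exact Real.one_le_cosh _
      _ = _ := by simp
  | succ n ih =>
    intro t ht
    have h0 : 0 ≤ C := (norm_nonneg _).trans (hC t ht)
    have hsub : ∀ s ∈ uIoc 0 t, s ∈ Icc (-T) T := fun s hs => by
      have hT : (0 : ℝ) ∈ Icc (-T) T := by
        constructor <;> linarith [ht.1, ht.2]
      exact uIcc_subset_Icc hT ht (uIoc_subset_uIcc hs)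
    have h1 : ‖picardTerm A b y₀ (n + 1) t‖ ≤
        |∫ s in (0 : ℝ)..t, K * (C * (1 / 2) ^ n) * Real.cosh (2 * K * s)| := by
      refine intervalIntegral.norm_integral_le_abs_of_norm_le ?_
        (Continuous.intervalIntegrable (by fun_prop) _ _)
      filter_upwards [ae_restrict_mem measurableSet_uIoc] with s hs
      calc _ ≤ ‖A s‖ * ‖picardTerm A b y₀ n s‖ := (A s).le_opNorm _
        _ ≤ K * (C * (1 / 2) ^ n * Real.cosh (2 * K * s)) := by
          gcongr
          · exact hAK s
          · exact ih s (hsub s hs)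
        _ = _ := by ring
    refine h1.trans ?_
    rw [intervalIntegral.integral_const_mul, integral_cosh_mul (by positivity), abs_mul, abs_div,
      abs_of_nonneg (by positivity : 0 ≤ K * (C * (1 / 2) ^ n)),
      abs_of_pos (by positivity : 0 < 2 * K), pow_succ]
    calc _ = C * ((1 / 2) ^ n * (1 / 2)) * |Real.sinh (2 * K * t)| := by field_simp
      _ ≤ _ := by gcongr; exact abs_sinh_le_cosh _

/-- A linear differential equation with continuous, bounded coefficient operator has a global
solution. -/
theorem exists_linear_ode_solution [CompleteSpace E] {K : ℝ} (hA : Continuous A) (hAK : ∀ t, ‖A t‖ ≤ K)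
    (hb : Continuous b) (y₀ : E) :
    ∃ y : ℝ → E, y 0 = y₀ ∧ ∀ t, HasDerivAt y (A t (y t) + b t) t := by
  -- The weight of rate `2K` requires `K > 0`; enlarging the bound is harmless.
  wlog hK : 0 < K generalizing K
  · exact this (K := max K 1) (fun t => (hAK t).trans (le_max_left _ _)) (by simp)
  set g := picardTerm A b y₀ with hg
  have key : ∀ t, Summable (fun n => g n t) ∧
      HasDerivAt (fun s => ∑' n, g n s) (A t (∑' n, g n t) + b t) t := by
    intro t₀
    set T := |t₀| + 1 with hT
    obtain ⟨C, hC⟩ := isCompact_Icc.exists_bound_of_continuousOn (s := Icc (-T) T)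
      (continuous_picardTerm hA hb y₀ 0).continuousOn
    obtain ⟨Cb, hCb⟩ := isCompact_Icc.exists_bound_of_continuousOn (s := Icc (-T) T)
      hb.continuousOn
    have hbound := norm_picardTerm_le hK hAK y₀ hC
    have h0T : (0 : ℝ) ∈ Icc (-T) T := by
      constructor <;> linarith [abs_nonneg t₀]
    have hC0 : 0 ≤ C := (norm_nonneg _).trans (hC 0 h0T)
    have hcosh : ∀ t ∈ Icc (-T) T, Real.cosh (2 * K * t) ≤ Real.cosh (2 * K * T) := by
      intro t ht
      rw [Real.cosh_le_cosh, abs_mul (2 * K) t, abs_mul (2 * K) T]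
      refine mul_le_mul_of_nonneg_left ?_ (abs_nonneg _)
      rw [abs_of_nonneg (by positivity : 0 ≤ T)]
      exact abs_le.2 ht
    have hgeo : Summable fun n : ℕ => C * (1 / 2 : ℝ) ^ n * Real.cosh (2 * K * T) :=
      (summable_geometric_two.mul_left C).mul_right _
    have hle : ∀ n, ∀ t ∈ Icc (-T) T, ‖g n t‖ ≤ C * (1 / 2) ^ n * Real.cosh (2 * K * T) :=
      fun n t ht => (hbound n t ht).trans (by gcongr; exact hcosh t ht)
    have hsum : ∀ t ∈ Icc (-T) T, Summable fun n => g n t := fun t ht =>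
      Summable.of_norm_bounded hgeo fun n => hle n t ht
    -- Termwise derivatives: the zeroth term yields the source, each later one the operator applied
    -- to its predecessor. Their sum is the right-hand side of the equation.
    let g' : ℕ → ℝ → E := fun n t => match n with
      | 0 => b t
      | n + 1 => A t (g n t)
    let U : ℕ → ℝ := fun n => match n with
      | 0 => Cb
      | n + 1 => K * (C * (1 / 2) ^ n * Real.cosh (2 * K * T))
    have hU : Summable U := (summable_nat_add_iff 1).1 (hgeo.mul_left K)
    have ht₀ : t₀ ∈ Ioo (-T) T := by
      exact abs_lt.1 (by linarith)
    have hd := hasDerivAt_tsum_of_isPreconnected (g := g) (g' := g') (y₀ := t₀) (y := t₀)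
      hU isOpen_Ioo
      isPreconnected_Ioo (fun n t _ => by
        cases n with
        | zero => exact hasDerivAt_picardTerm_zero hb y₀ t
        | succ n => exact hasDerivAt_picardTerm_succ hA hb y₀ n t)
      (fun n t ht => by
        cases n with
        | zero => exact hCb t (Ioo_subset_Icc_self ht)
        | succ n =>
          exact ((A t).le_opNorm _).trans (mul_le_mul (hAK t) (hle n t (Ioo_subset_Icc_self ht))
            (norm_nonneg _) hK.le))
      ht₀ (hsum _ (Ioo_subset_Icc_self ht₀)) ht₀
    have hs := hsum _ (Ioo_subset_Icc_self ht₀)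
    refine ⟨hs, hd.congr_deriv ?_⟩
    have hs1 : Summable fun n => A t₀ (g n t₀) := hs.mapL (A t₀)
    have hs2 : Summable fun n => g' n t₀ := (summable_nat_add_iff 1).1 hs1
    rw [hs2.tsum_eq_zero_add, ContinuousLinearMap.map_tsum _ hs, add_comm]
  refine ⟨fun t => ∑' n, g n t, ?_, fun t => (key t).2⟩
  change ∑' n, g n 0 = y₀
  rw [tsum_eq_single 0]
  · simp [hg, picardTerm]
  · intro n hn
    obtain ⟨m, rfl⟩ := Nat.exists_eq_succ_of_ne_zero hn
    simp [hg, picardTerm]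

/-- Grönwall with Lipschitz constant `K`. Only one-sided derivatives at nonnegative times are used,
which is what `IsTransportSolution` supplies. -/
lemma linear_ode_unique {K : ℝ} (hAK : ∀ t, 0 ≤ t → ‖A t‖ ≤ K) {y z : ℝ → E}
    (hy : ∀ t, 0 ≤ t → HasDerivWithinAt y (A t (y t) + b t) (Ici 0) t)
    (hz : ∀ t, 0 ≤ t → HasDerivWithinAt z (A t (z t) + b t) (Ici 0) t)
    (h0 : y 0 = z 0) (t : ℝ) (ht : 0 ≤ t) : y t = z t := by
  have hL : ∀ s ∈ Ico 0 t, LipschitzOnWith K.toNNReal (fun x => A s x + b s) univ := fun s hs => by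
    refine LipschitzOnWith.of_dist_le_mul fun x _ x' _ => ?_
    have hK0 : 0 ≤ K := (norm_nonneg _).trans (hAK s hs.1)
    rw [dist_add_right, dist_eq_norm, dist_eq_norm, ← map_sub, Real.coe_toNNReal _ hK0]
    exact ((A s).le_opNorm _).trans (mul_le_mul_of_nonneg_right (hAK s hs.1) (norm_nonneg _))
  have hcont : ∀ w : ℝ → E, (∀ t, 0 ≤ t → HasDerivWithinAt w (A t (w t) + b t) (Ici 0) t) →
      ContinuousOn w (Icc 0 t) := fun w hw s hs =>
    (hw s hs.1).continuousWithinAt.mono Icc_subset_Ici_self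
  exact ODE_solution_unique_of_mem_Icc_right hL (hcont y hy)
    (fun s hs => (hy s hs.1).mono (Ici_subset_Ici.2 hs.1)) (fun _ _ => mem_univ _) (hcont z hz)
    (fun s hs => (hz s hs.1).mono (Ici_subset_Ici.2 hs.1)) (fun _ _ => mem_univ _) h0
    ⟨ht, le_rfl⟩

end LinearODE

/-! ### Operators on bounded continuous functions -/

/-- Translation `Y ↦ Y(· + a)` on bounded continuous functions. -/
def translateL (a : ℝ) : (ℝ →ᵇ ℝ) →L[ℝ] (ℝ →ᵇ ℝ) :=
  LinearMap.mkContinuous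
    { toFun := fun Y => Y.compContinuous ⟨fun x => x + a, by fun_prop⟩
      map_add' := fun _ _ => rfl
      map_smul' := fun _ _ => rfl } 1
    (fun Y => (BoundedContinuousFunction.norm_compContinuous_le Y _).trans_eq (one_mul _).symm)

@[simp] lemma translateL_apply (a : ℝ) (Y : ℝ →ᵇ ℝ) (x : ℝ) : translateL a Y x = Y (x + a) := rfl

/-- The upwind operator with velocity `c`, as a continuous linear map. -/
def upwindL (ε : ℝ) (c : ℝ →ᵇ ℝ) : (ℝ →ᵇ ℝ) →L[ℝ] (ℝ →ᵇ ℝ) :=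
  (1 / ε) • ((translateL (-ε)).comp (ContinuousLinearMap.mul ℝ (ℝ →ᵇ ℝ) (0 ⊔ c))
    - ContinuousLinearMap.mul ℝ (ℝ →ᵇ ℝ) |c|
    + (translateL ε).comp (ContinuousLinearMap.mul ℝ (ℝ →ᵇ ℝ) (0 ⊔ -c)))

lemma upwindL_apply (ε : ℝ) (c Y : ℝ →ᵇ ℝ) (x : ℝ) : upwindL ε c Y x = upwind ε c Y x := by
  simp [upwindL, upwind, sub_eq_add_neg]
  ring

/-- Lattice operations are continuous in the sup norm, so the operator depends on the velocity
continuously in operator norm, as the Picard series requires. -/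
lemma continuous_upwindL (ε : ℝ) : Continuous (upwindL ε) := by
  unfold upwindL
  have h1 : Continuous fun c : ℝ →ᵇ ℝ => (0 : ℝ →ᵇ ℝ) ⊔ c := continuous_const.sup continuous_id
  have h2 : Continuous fun c : ℝ →ᵇ ℝ => (0 : ℝ →ᵇ ℝ) ⊔ -c := continuous_const.sup continuous_neg
  have h3 : Continuous fun c : ℝ →ᵇ ℝ => |c| := continuous_id.sup continuous_neg
  have hm := (ContinuousLinearMap.mul ℝ (ℝ →ᵇ ℝ)).continuous
  exact (((continuous_const.clm_comp (hm.comp h1)).sub (hm.comp h3)).add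
    (continuous_const.clm_comp (hm.comp h2))).const_smul (1 / ε)

lemma abs_upwind_le {ε M N : ℝ} (hε : 0 < ε) {c Y : ℝ → ℝ} (hM : ∀ x, |c x| ≤ M)
    (hN : ∀ x, |Y x| ≤ N) (x : ℝ) : |upwind ε c Y x| ≤ 1 / ε * (3 * M) * N := by
  have hM0 : 0 ≤ M := (abs_nonneg _).trans (hM 0)
  have hN0 : 0 ≤ N := (abs_nonneg _).trans (hN 0)
  have h1 : ∀ y, |Y y * max 0 (c y)| ≤ N * M := fun y => by
    rw [abs_mul, abs_of_nonneg (le_max_left (0 : ℝ) _)]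
    exact mul_le_mul (hN y) (max_le hM0 ((le_abs_self _).trans (hM y))) (le_max_left _ _) hN0
  have h2 : ∀ y, |Y y * max 0 (-c y)| ≤ N * M := fun y => by
    rw [abs_mul, abs_of_nonneg (le_max_left (0 : ℝ) _)]
    exact mul_le_mul (hN y) (max_le hM0 ((neg_le_abs _).trans (hM y))) (le_max_left _ _) hN0
  have h3 : |(Y x * |c x|)| ≤ N * M := by
    rw [abs_mul, abs_abs]
    exact mul_le_mul (hN x) (hM x) (abs_nonneg _) hN0
  rw [upwind, abs_mul, abs_of_pos (by positivity : 0 < 1 / ε), mul_assoc]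
  refine mul_le_mul_of_nonneg_left ?_ (by positivity)
  have := abs_add_le (Y (x - ε) * max 0 (c (x - ε)) - Y x * |c x|)
    (Y (x + ε) * max 0 (-c (x + ε)))
  have := abs_sub (Y (x - ε) * max 0 (c (x - ε))) (Y x * |c x|)
  linarith [h1 (x - ε), h2 (x + ε)]

/-- Mollification on bounded continuous functions. -/
def mollifyL {k : ℝ → ℝ} (hk : IsTest k) {δ : ℝ} (hδ : 0 < δ) : (ℝ →ᵇ ℝ) →L[ℝ] (ℝ →ᵇ ℝ) :=
  LinearMap.mkContinuous
    { toFun := fun Y => BoundedContinuousFunction.ofNormedAddCommGroup (mollify k δ Y)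
        (continuous_mollify hk hδ Y.continuous.locallyIntegrable) (‖Y‖ * ∫ z, |k z|)
        (abs_mollify_le hk hδ (Eventually.of_forall Y.norm_coe_le_norm))
      map_add' := fun Y Y' => by
        ext x
        simp only [BoundedContinuousFunction.coe_ofNormedAddCommGroup,
          BoundedContinuousFunction.coe_add, Pi.add_apply, mollify_eq_integral k hδ, add_mul]
        exact integral_add
          (integrable_mollify_integrand hk Y.continuous Y.norm_coe_le_norm x)
          (integrable_mollify_integrand hk Y'.continuous Y'.norm_coe_le_norm x)
      map_smul' := fun a Y => by
        ext x
        simp only [BoundedContinuousFunction.coe_ofNormedAddCommGroup,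
          BoundedContinuousFunction.coe_smul, mollify_eq_integral k hδ, smul_eq_mul,
          RingHom.id_apply, mul_assoc]
        exact integral_const_mul _ _ }
    (∫ z, |k z|)
    (fun Y => by
      refine (BoundedContinuousFunction.norm_le (mul_nonneg
        (integral_nonneg fun _ => abs_nonneg _) (norm_nonneg _))).2 fun x => ?_
      rw [mul_comm]
      exact abs_mollify_le hk hδ (Eventually.of_forall Y.norm_coe_le_norm) x)

@[simp] lemma mollifyL_apply {k : ℝ → ℝ} (hk : IsTest k) {δ : ℝ} (hδ : 0 < δ) (Y : ℝ →ᵇ ℝ)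
    (x : ℝ) : mollifyL hk hδ Y x = mollify k δ Y x := rfl

/-- A jointly continuous curve of periodic functions is continuous for the sup norm. -/
lemma continuous_of_periodic_of_continuous_uncurry {F : ℝ → (ℝ →ᵇ ℝ)}
    (hF : Continuous fun q : ℝ × ℝ => F q.1 q.2)
    (hp : ∀ t, Function.Periodic (F t) (2 * Real.pi)) : Continuous F := by
  refine continuous_iff_continuousAt.2 fun t => Metric.tendsto_nhds.2 fun e he => ?_
  -- Currying gives convergence uniform on one compact period; periodicity extends it to the line.
  have h := (ContinuousMap.curry ⟨fun q : ℝ × ℝ => F q.1 q.2, hF⟩).continuous.tendsto t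
  rw [ContinuousMap.tendsto_iff_forall_isCompact_tendstoUniformlyOn] at h
  have h2 := Metric.tendstoUniformlyOn_iff.1 (h (Icc 0 (0 + 2 * Real.pi)) isCompact_Icc) (e / 2)
    (by positivity)
  filter_upwards [h2] with s hs
  refine lt_of_le_of_lt ((BoundedContinuousFunction.dist_le (by positivity)).2 fun x => ?_)
    (half_lt_self he)
  have hper : Function.Periodic (fun x => dist (F s x) (F t x)) (2 * Real.pi) := fun x => by
    simp only [hp s x, hp t x]
  obtain ⟨y, hy, hxy⟩ := hper.exists_mem_Ico₀ (by positivity) x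
  rw [hxy, dist_comm]
  exact (hs y ⟨hy.1, by simpa using hy.2.le⟩).le

/-! ### The transport equation -/

/-- A jointly continuous periodic velocity bounded by `M`. -/
structure IsBoundedVelocity (u : ℝ → ℝ → ℝ) (M : ℝ) : Prop where
  continuousOn : ContinuousOn (fun q : ℝ × ℝ => u q.1 q.2) (Ici 0 ×ˢ univ)
  periodic : ∀ t, 0 ≤ t → Function.Periodic (u t) (2 * Real.pi)
  bounded : ∀ t, 0 ≤ t → ∀ x, |u t x| ≤ M

namespace IsBoundedVelocity

variable {u : ℝ → ℝ → ℝ} {M : ℝ}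

/-- Clamping the time at zero extends the velocity to all times, so that the equation can be solved
on the whole line and then restricted to `t ≥ 0`. -/
lemma continuous_uncurry (hu : IsBoundedVelocity u M) :
    Continuous fun q : ℝ × ℝ => u (max q.1 0) q.2 :=
  hu.continuousOn.comp_continuous (f := fun q : ℝ × ℝ => (max q.1 0, q.2)) (by fun_prop)
    fun q => ⟨le_max_right q.1 0, mem_univ _⟩

lemma continuous (hu : IsBoundedVelocity u M) {t : ℝ} (ht : 0 ≤ t) : Continuous (u t) := by
  have h := hu.continuous_uncurry.comp (Continuous.prodMk_right t)
  simpa [Function.comp_def, max_eq_left ht] using h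

/-- The velocity as a curve of bounded continuous functions, constant for negative times. -/
def curve (hu : IsBoundedVelocity u M) (t : ℝ) : ℝ →ᵇ ℝ :=
  BoundedContinuousFunction.ofNormedAddCommGroup (u (max t 0))
    (hu.continuous (le_max_right _ _)) M (hu.bounded _ (le_max_right _ _))

lemma curve_coe (hu : IsBoundedVelocity u M) {t : ℝ} (ht : 0 ≤ t) : ⇑(hu.curve t) = u t := by
  simp [curve, max_eq_left ht]

lemma continuous_curve (hu : IsBoundedVelocity u M) : Continuous hu.curve :=
  continuous_of_periodic_of_continuous_uncurry hu.continuous_uncurry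
    fun _ => hu.periodic _ (le_max_right _ _)

/-- The operators `2 upwind`. -/
def generator (hu : IsBoundedVelocity u M) (ε t : ℝ) : (ℝ →ᵇ ℝ) →L[ℝ] (ℝ →ᵇ ℝ) :=
  (2 : ℝ) • upwindL ε (hu.curve t)

lemma generator_apply (hu : IsBoundedVelocity u M) (ε : ℝ) {t : ℝ} (ht : 0 ≤ t) (Y : ℝ →ᵇ ℝ)
    (x : ℝ) : hu.generator ε t Y x = 2 * upwind ε (u t) Y x := by
  simp [generator, upwindL_apply, hu.curve_coe ht]

lemma continuous_generator (hu : IsBoundedVelocity u M) (ε : ℝ) : Continuous (hu.generator ε) :=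
  ((continuous_upwindL ε).comp hu.continuous_curve).const_smul (2 : ℝ)

lemma norm_generator_le (hu : IsBoundedVelocity u M) {ε : ℝ} (hε : 0 < ε) (t : ℝ) :
    ‖hu.generator ε t‖ ≤ 2 * (1 / ε * (3 * M)) := by
  have hM0 : 0 ≤ M := (abs_nonneg _).trans (hu.bounded 0 le_rfl 0)
  refine ContinuousLinearMap.opNorm_le_bound _ (by positivity) fun Y => ?_
  refine (BoundedContinuousFunction.norm_le (by positivity)).2 fun x => ?_
  have h : hu.generator ε t Y x = 2 * upwind ε (hu.curve t) Y x := by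
    simp [generator, upwindL_apply]
  rw [h, Real.norm_eq_abs, abs_mul, abs_two, mul_assoc]
  exact mul_le_mul_of_nonneg_left (abs_upwind_le hε (hu.bounded _ (le_max_right t 0))
    Y.norm_coe_le_norm x) zero_le_two

end IsBoundedVelocity

lemma upwind_add_period (ε : ℝ) {c Y : ℝ → ℝ} (hc : Function.Periodic c (2 * Real.pi)) (x : ℝ) :
    upwind ε c Y (x + 2 * Real.pi) = upwind ε c (fun y => Y (y + 2 * Real.pi)) x := by
  simp only [upwind]
  rw [show x + 2 * Real.pi - ε = x - ε + 2 * Real.pi by ring,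
    show x + 2 * Real.pi + ε = x + ε + 2 * Real.pi by ring, hc, hc, hc]

section Transport

variable {ε M : ℝ} {u S : ℝ → ℝ → ℝ} {y₀ : ℝ → ℝ} {Y : ℝ → (ℝ →ᵇ ℝ)}

/-- Global solvability of the transport equation with a continuous curve of periodic sources. -/
theorem exists_transportSolution (hε : 0 < ε) (hu : IsBoundedVelocity u M)
    {b : ℝ → (ℝ →ᵇ ℝ)} (hb : ContinuousOn b (Ici 0))
    (hbp : ∀ t, 0 ≤ t → Function.Periodic (b t) (2 * Real.pi))
    (hS : ∀ t, 0 ≤ t → ∀ x, S t x = b t x)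
    (hy : Continuous y₀) (hyp : Function.Periodic y₀ (2 * Real.pi)) :
    ∃ Y : ℝ → (ℝ →ᵇ ℝ), IsTransportSolution ε u S y₀ Y := by
  obtain ⟨B, hB0, hB⟩ := exists_abs_bound_of_periodic hy hyp
  let y : ℝ →ᵇ ℝ := BoundedContinuousFunction.ofNormedAddCommGroup y₀ hy B hB
  have hb' : Continuous fun t => -b (max t 0) :=
    (hb.comp_continuous (f := fun t => max t 0) (by fun_prop) fun t => le_max_right t 0).neg
  obtain ⟨Y, hY0, hY⟩ := exists_linear_ode_solution (hu.continuous_generator ε)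
    (hu.norm_generator_le hε) hb' y
  have hbt : ∀ t, 0 ≤ t → -b (max t 0) = -b t := fun t ht => by rw [max_eq_left ht]
  -- The translate by a period solves the same initial value problem, so uniqueness makes the
  -- solution periodic.
  have hper : ∀ t, 0 ≤ t → translateL (2 * Real.pi) (Y t) = Y t := by
    refine linear_ode_unique (A := hu.generator ε) (b := fun t => -b (max t 0))
      (fun t _ => hu.norm_generator_le hε t) (fun t ht => ?_)
      (fun t ht => (hY t).hasDerivWithinAt) ?_
    · refine (((translateL (2 * Real.pi)).hasFDerivAt.comp_hasDerivAt t (hY t)).congr_deriv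
        ?_).hasDerivWithinAt
      ext x
      simp only [hbt t ht, map_add, BoundedContinuousFunction.coe_add, Pi.add_apply,
        translateL_apply, hu.generator_apply ε ht, upwind_add_period ε (hu.periodic t ht),
        BoundedContinuousFunction.coe_neg, Pi.neg_apply, hbp t ht x]
      rfl
    · rw [hY0]
      ext x
      exact hyp x
  refine ⟨Y, fun x => by rw [hY0]; rfl, fun t ht x => ?_, fun t ht => ⟨_, fun x => ?_,
    (hY t).hasDerivWithinAt⟩⟩
  · exact DFunLike.congr_fun (hper t ht) x
  · rw [hbt t ht, BoundedContinuousFunction.coe_add, Pi.add_apply, hu.generator_apply ε ht, hS t ht]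
    rfl

lemma IsTransportSolution.continuousOn (hY : IsTransportSolution ε u S y₀ Y) :
    ContinuousOn Y (Ici 0) := fun t ht => by
  obtain ⟨G, -, hG⟩ := hY.ode t ht
  exact hG.continuousWithinAt

/-- The difference solves the homogeneous equation. The sources may be different expressions with
equal values, because in a triangular system each one is built from its own earlier components. -/
theorem IsTransportSolution.unique (hε : 0 < ε) (hu : IsBoundedVelocity u M)
    {S' : ℝ → ℝ → ℝ} {Y' : ℝ → (ℝ →ᵇ ℝ)} (hSS : ∀ t, 0 ≤ t → ∀ x, S t x = S' t x)
    (hY : IsTransportSolution ε u S y₀ Y) (hY' : IsTransportSolution ε u S' y₀ Y')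
    (t : ℝ) (ht : 0 ≤ t) : Y t = Y' t := by
  have h := linear_ode_unique (A := hu.generator ε) (b := fun _ => 0)
    (y := fun t => Y t - Y' t) (z := fun _ => 0) (fun t _ => hu.norm_generator_le hε t)
    (fun t ht => ?_) (fun t ht => ?_) ?_ t ht
  · exact sub_eq_zero.1 h
  · obtain ⟨G, hG, hGd⟩ := hY.ode t ht
    obtain ⟨G', hG', hGd'⟩ := hY'.ode t ht
    refine (hGd.sub hGd').congr_deriv ?_
    ext x
    simp only [BoundedContinuousFunction.coe_sub, Pi.sub_apply, hG, hG', map_sub, add_zero,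
      hu.generator_apply ε ht, hSS t ht]
    ring
  · simpa using hasDerivWithinAt_const t (Ici 0) (0 : ℝ →ᵇ ℝ)
  · ext x
    simp [hY.initial, hY'.initial]

lemma continuous_upwind (ε : ℝ) {c Z : ℝ → ℝ} (hc : Continuous c) (hZ : Continuous Z) :
    Continuous (upwind ε c Z) := by
  unfold upwind
  fun_prop

/-- The equation itself exhibits the source as a difference of continuous functions. -/
lemma IsTransportSolution.continuous_source (hu : IsBoundedVelocity u M)
    (hY : IsTransportSolution ε u S y₀ Y) {t : ℝ} (ht : 0 ≤ t) : Continuous (S t) := by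
  obtain ⟨G, hG, -⟩ := hY.ode t ht
  have h : S t = fun x => 2 * upwind ε (u t) (Y t) x - G x := by
    ext x; rw [hG]; ring
  rw [h]
  exact (continuous_const.mul (continuous_upwind ε (hu.continuous ht) (Y t).continuous)).sub
    G.continuous

/-- An explicit Euler step of the upwind scheme contracts the `L¹` norm. -/
lemma periodL1_add_upwind_le {h : ℝ} (hε : 0 < ε) {c Z : ℝ → ℝ} (hc : Continuous c)
    (hcp : Function.Periodic c (2 * Real.pi)) (hM : ∀ x, |c x| ≤ M) (hZ : Continuous Z)
    (hZp : Function.Periodic Z (2 * Real.pi)) (hh : 0 ≤ h) (hhM : h * M ≤ ε) :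
    periodL1 (fun x => Z x + h * upwind ε c Z x) ≤ periodL1 Z := by
  set r := h / ε with hr
  have hr0 : 0 ≤ r := by positivity
  have hrM : ∀ x, r * |c x| ≤ 1 := fun x => by
    rw [hr, div_mul_eq_mul_div, div_le_one hε]
    exact (mul_le_mul_of_nonneg_left (hM x) hh).trans hhM
  -- The mass at `x` splits into `D`, which stays, `P`, which moves right by `ε`, and `Q`, which
  -- moves left. The condition `h * M ≤ ε` makes the three weights nonnegative, and they add up to
  -- one.
  set P : ℝ → ℝ := fun x => Z x * (r * max 0 (c x)) with hP
  set Q : ℝ → ℝ := fun x => Z x * (r * max 0 (-c x)) with hQ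
  set D : ℝ → ℝ := fun x => Z x * (1 - r * |c x|) with hD
  have hPc : Continuous P := by fun_prop
  have hQc : Continuous Q := by fun_prop
  have hDc : Continuous D := by fun_prop
  have hPp : Function.Periodic P (2 * Real.pi) := fun x => by simp only [hP, hZp x, hcp x]
  have hQp : Function.Periodic Q (2 * Real.pi) := fun x => by simp only [hQ, hZp x, hcp x]
  have e : (fun x => Z x + h * upwind ε c Z x) = fun x => (D x + P (x + -ε)) + Q (x + ε) := by
    ext x
    simp only [upwind, hD, hP, hQ, hr, ← sub_eq_add_neg]
    ring
  have hsum : periodL1 D + periodL1 P + periodL1 Q = periodL1 Z := by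
    unfold periodL1
    rw [← intervalIntegral.integral_add (hDc.abs.intervalIntegrable _ _)
      (hPc.abs.intervalIntegrable _ _), ← intervalIntegral.integral_add
      (Continuous.intervalIntegrable (by fun_prop) _ _) (hQc.abs.intervalIntegrable _ _)]
    congr 1
    ext x
    have h1 : max 0 (c x) + max 0 (-c x) = |c x| := by
      rcases le_total 0 (c x) with h | h
      · rw [max_eq_right h, max_eq_left (by linarith), abs_of_nonneg h, add_zero]
      · rw [max_eq_left h, max_eq_right (by linarith), abs_of_nonpos h, zero_add]
    simp only [hD, hP, hQ, abs_mul, abs_of_nonneg hr0, abs_of_nonneg (le_max_left (0 : ℝ) _),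
      abs_of_nonneg (sub_nonneg.2 (hrM x))]
    linear_combination (|Z x| * r) * h1
  rw [e]
  refine (periodL1_add_le (by fun_prop) (by fun_prop)).trans ?_
  refine (add_le_add_left (periodL1_add_le hDc (by fun_prop)) _).trans ?_
  rw [periodL1_comp_add hPp, periodL1_comp_add hQp, hsum]

lemma periodL1_le_norm (Y : ℝ →ᵇ ℝ) : periodL1 Y ≤ 2 * Real.pi * ‖Y‖ :=
  periodL1_le_of_abs_le Y.continuous Y.norm_coe_le_norm

lemma continuous_periodL1 : Continuous fun Y : ℝ →ᵇ ℝ => periodL1 Y := by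
  have h : ∀ Y Z : ℝ →ᵇ ℝ, periodL1 Y ≤ periodL1 Z + 2 * Real.pi * ‖Y - Z‖ := fun Y Z => by
    have h1 := periodL1_add_le Z.continuous (Y - Z).continuous
    simp only [BoundedContinuousFunction.coe_sub, Pi.sub_apply, add_sub_cancel] at h1
    have h2 := periodL1_le_norm (Y - Z)
    rw [BoundedContinuousFunction.coe_sub] at h2
    exact h1.trans (by simpa using h2)
  refine (LipschitzWith.of_le_add_mul (2 * Real.pi).toNNReal fun Y Z => ?_).continuous
  rw [Real.coe_toNNReal _ (by positivity), dist_eq_norm]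
  exact h Y Z

/-- Grönwall with the operator norm would give `exp(C/ε)`. Instead `Y z` is an Euler step from `Y
t`, plus the source, plus an error `o(z - t)` in sup norm. The Euler step does not increase the
norm, so the norm grows at rate at most `B`, independently of `ε`. -/
theorem IsTransportSolution.periodL1_le (hε : 0 < ε) (hu : IsBoundedVelocity u M)
    (hY : IsTransportSolution ε u S y₀ Y) {B T : ℝ}
    (hS : ∀ t ∈ Icc 0 T, periodL1 (S t) ≤ B) :
    ∀ t ∈ Icc 0 T, periodL1 (Y t) ≤ periodL1 y₀ + B * t := by
  have h := le_gronwallBound_of_liminf_deriv_right_le (f := fun t => periodL1 (Y t))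
    (f' := fun _ => B) (δ := periodL1 y₀) (K := 0) (ε := B) (a := 0) (b := T)
    (continuous_periodL1.comp_continuousOn (hY.continuousOn.mono Icc_subset_Ici_self))
    (fun t ht r hr => ?_) (by simp [show ⇑(Y 0) = y₀ from funext hY.initial]) (by simp)
  · intro t ht
    have := h t ht
    rwa [gronwallBound_K0, sub_zero] at this
  · refine Eventually.frequently ?_
    obtain ⟨G, hG, hGd⟩ := hY.ode t ht.1
    have hslope : Tendsto (fun z => slope Y t z - G) (𝓝[>] t) (𝓝 0) := by
      have := (hasDerivWithinAt_iff_tendsto_slope' (notMem_Ioi.2 le_rfl)).1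
        (hGd.mono (fun z hz => ht.1.trans (le_of_lt hz)) : HasDerivWithinAt Y G (Ioi t) t)
      simpa using this.sub_const G
    have hlim : Tendsto (fun z => B + 2 * Real.pi * ‖slope Y t z - G‖) (𝓝[>] t) (𝓝 B) := by
      simpa using ((hslope.norm.const_mul (2 * Real.pi)).const_add B)
    -- The generator is twice the upwind operator, so the Euler step has length `2 (z - t)`; close
    -- to `t` it meets the stability condition.
    have hsmall : ∀ᶠ z in 𝓝[>] t, 2 * (z - t) * M ≤ ε := by
      have : Tendsto (fun z => 2 * (z - t) * M) (𝓝[>] t) (𝓝 (2 * (t - t) * M)) :=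
        (Continuous.tendsto (by fun_prop) t).mono_left nhdsWithin_le_nhds
      rw [sub_self, mul_zero, zero_mul] at this
      exact (this.eventually (gt_mem_nhds hε)).mono fun z hz => hz.le
    filter_upwards [hlim.eventually (gt_mem_nhds hr), hsmall, self_mem_nhdsWithin] with z hz hzM hzt
    refine lt_of_le_of_lt ?_ hz
    have hh : 0 < z - t := sub_pos.2 hzt
    rw [inv_mul_le_iff₀ hh]
    set e : ℝ →ᵇ ℝ := slope Y t z - G with he
    have hYz : ⇑(Y z) = fun x => (Y t x + 2 * (z - t) * upwind ε (u t) (Y t) x)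
        + ((-(z - t)) * S t x + (z - t) * e x) := by
      ext x
      have h1 : (z - t) • e = Y z - Y t - (z - t) • G := by
        rw [he, smul_sub, sub_smul_slope]
        rfl
      have h2 := DFunLike.congr_fun h1 x
      simp only [BoundedContinuousFunction.coe_smul, BoundedContinuousFunction.coe_sub,
        Pi.sub_apply, smul_eq_mul, hG] at h2
      linear_combination -h2
    have hSc := hY.continuous_source hu ht.1
    have huc := hu.continuous ht.1
    have hup := continuous_upwind ε huc (Y t).continuous
    have h1 : periodL1 (Y z) ≤ periodL1 (Y t) + ((z - t) * B + (z - t) * (2 * Real.pi * ‖e‖)) := by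
      rw [hYz]
      refine (periodL1_add_le (by fun_prop) (by fun_prop)).trans (add_le_add ?_ ?_)
      · exact periodL1_add_upwind_le hε huc (hu.periodic t ht.1) (hu.bounded t ht.1)
          (Y t).continuous (hY.periodic t ht.1) (by positivity) hzM
      · refine (periodL1_add_le (by fun_prop) (by fun_prop)).trans (add_le_add ?_ ?_)
        · rw [periodL1_const_mul, abs_neg, abs_of_pos hh]
          exact mul_le_mul_of_nonneg_left (hS t ⟨ht.1, ht.2.le⟩) hh.le
        · rw [periodL1_const_mul, abs_of_pos hh]
          exact mul_le_mul_of_nonneg_left (periodL1_le_norm e) hh.le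
    linarith

end Transport

/-! ### Consistency estimates at fixed parameter and time -/

lemma integrable_mul_test {f ψ : ℝ → ℝ} (hf : Continuous f) (hψ : IsTest ψ) :
    Integrable fun x => f x * ψ x :=
  (hf.mul hψ.continuous).integrable_of_hasCompactSupport hψ.2.mul_left

lemma IsTest.exists_lipschitz {ψ : ℝ → ℝ} (hψ : IsTest ψ) :
    ∃ L : ℝ, 0 ≤ L ∧ ∀ x y, |ψ x - ψ y| ≤ L * |x - y| := by
  obtain ⟨L, hL⟩ := hψ.deriv.exists_bound
  refine ⟨L, (abs_nonneg _).trans (hL 0), fun x y => ?_⟩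
  have := convex_univ.norm_image_sub_le_of_norm_deriv_le
    (fun z _ => hψ.differentiable z) (fun z _ => hL z) (mem_univ y) (mem_univ x)
  simpa using this

/-- The mean value inequality for `y ↦ Ψ y - y * Ψ'(x)` between `x` and `x + h`. The missing factor
one half is immaterial. -/
lemma abs_sub_sub_mul_deriv_le {Ψ : ℝ → ℝ} (hΨ : IsTest Ψ) {B : ℝ}
    (hB : ∀ x, |deriv (deriv Ψ) x| ≤ B) (x h : ℝ) :
    |Ψ (x + h) - Ψ x - h * deriv Ψ x| ≤ B * h ^ 2 := by
  have hd : ∀ y ∈ uIcc x (x + h), HasDerivWithinAt (fun y => Ψ y - y * deriv Ψ x)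
      (deriv Ψ y - 1 * deriv Ψ x) (uIcc x (x + h)) y := fun y _ =>
    ((hΨ.differentiable y).hasDerivAt.sub
      ((hasDerivAt_id y).mul_const (deriv Ψ x))).hasDerivWithinAt
  have hb : ∀ y ∈ uIcc x (x + h), ‖deriv Ψ y - 1 * deriv Ψ x‖ ≤ B * |h| := fun y hy => by
    have h1 := convex_univ.norm_image_sub_le_of_norm_deriv_le
      (fun z _ => hΨ.deriv.differentiable z) (fun z _ => hB z) (mem_univ x) (mem_univ y)
    have h2 : |y - x| ≤ |h| := by
      have := abs_sub_left_of_mem_uIcc hy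
      simpa using this
    rw [one_mul]
    refine h1.trans (mul_le_mul_of_nonneg_left h2 ((abs_nonneg _).trans (hB 0)))
  have h3 := (convex_uIcc x (x + h)).norm_image_sub_le_of_norm_hasDerivWithin_le hd hb
    left_mem_uIcc right_mem_uIcc
  rw [Real.norm_eq_abs, Real.norm_eq_abs, add_sub_cancel_left, mul_assoc, abs_mul_abs_self] at h3
  calc _ = |Ψ (x + h) - (x + h) * deriv Ψ x - (Ψ x - x * deriv Ψ x)| := by congr 1; ring
    _ ≤ B * (h * h) := h3
    _ = _ := by ring

/-- The upwind operator is consistent with `-∂ₓ(c ·)` in the sense of distributions, with an error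
controlled by the `L¹` norm. -/
lemma exists_upwind_consistency_bound (R : ℝ) : ∃ C : ℝ, 0 ≤ C ∧
    ∀ (ε M B : ℝ) (c Y Ψ : ℝ → ℝ), 0 < ε → ε ≤ 1 → Continuous c → (∀ x, |c x| ≤ M) →
    Continuous Y → Function.Periodic Y (2 * Real.pi) → IsTest Ψ → (∀ x, R < |x| → Ψ x = 0) →
    (∀ x, |deriv (deriv Ψ) x| ≤ B) →
    |(∫ x, upwind ε c Y x * Ψ x) - ∫ x, Y x * (c x * deriv Ψ x)| ≤
      C * (M * B * ε) * periodL1 Y := by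
  -- Shifts by `ε ≤ 1` enlarge the support by at most one.
  obtain ⟨C, hC0, hC⟩ := exists_pairing_bound (R + 1)
  refine ⟨C, hC0, fun ε M B c Y Ψ hε hε1 hc hM hY hYp hΨ hR hB => ?_⟩
  have hM0 : 0 ≤ M := (abs_nonneg _).trans (hM 0)
  have hB0 : 0 ≤ B := (abs_nonneg _).trans (hB 0)
  have hΨs : ∀ a, IsTest fun x => Ψ (x + a) := fun a =>
    ⟨hΨ.1.comp (contDiff_id.add contDiff_const), hΨ.2.comp_homeomorph (Homeomorph.addRight a)⟩
  set P : ℝ → ℝ := fun x => Y x * max 0 (c x) with hP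
  set Q : ℝ → ℝ := fun x => Y x * max 0 (-c x) with hQ
  have hPc : Continuous P := by fun_prop
  have hQc : Continuous Q := by fun_prop
  have hAc : Continuous fun x => Y x * |c x| := by fun_prop
  have iP : Integrable fun x => P (x - ε) * Ψ x :=
    integrable_mul_test (f := fun x => P (x - ε)) (by fun_prop) hΨ
  have iQ : Integrable fun x => Q (x + ε) * Ψ x :=
    integrable_mul_test (f := fun x => Q (x + ε)) (by fun_prop) hΨ
  have iA := integrable_mul_test hAc hΨ
  have iP' := integrable_mul_test hPc (hΨs ε)
  have iQ' := integrable_mul_test hQc (hΨs (-ε))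
  have tP : ∫ x, P (x - ε) * Ψ x = ∫ x, P x * Ψ (x + ε) := by
    rw [← integral_add_right_eq_self _ ε]; simp
  have tQ : ∫ x, Q (x + ε) * Ψ x = ∫ x, Q x * Ψ (x + -ε) := by
    rw [← integral_add_right_eq_self _ (-ε)]; simp
  -- With the shifts moved onto `Ψ`, zeroth-order terms cancel because `c⁺ + c⁻ = |c|`, and
  -- first-order terms form the transport term because `c⁺ - c⁻ = c`. What remains are Taylor
  -- remainders; neither `Y` nor `c` is differentiated.
  set g : ℝ → ℝ := fun x => 1 / ε * (max 0 (c x) * (Ψ (x + ε) - Ψ x - ε * deriv Ψ x)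
    + max 0 (-c x) * (Ψ (x + -ε) - Ψ x - (-ε) * deriv Ψ x)) with hg
  have hpm : ∀ x, max 0 (c x) + max 0 (-c x) = |c x| ∧ max 0 (c x) - max 0 (-c x) = c x := by
    intro x
    rcases le_total 0 (c x) with h | h
    · rw [max_eq_right h, max_eq_left (by linarith), abs_of_nonneg h]; constructor <;> ring
    · rw [max_eq_left h, max_eq_right (by linarith), abs_of_nonpos h]; constructor <;> ring
  have e : (∫ x, upwind ε c Y x * Ψ x) - ∫ x, Y x * (c x * deriv Ψ x) = ∫ x, Y x * g x := by
    have e1 : ∫ x, upwind ε c Y x * Ψ x =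
        1 / ε * ((∫ x, P x * Ψ (x + ε)) - (∫ x, Y x * |c x| * Ψ x) + ∫ x, Q x * Ψ (x + -ε)) := by
      rw [← tP, ← tQ, ← integral_sub iP iA, ← integral_add (iP.sub' iA) iQ, ← integral_const_mul]
      congr 1; ext x
      simp only [upwind, hP, hQ]
      ring
    have iD := integrable_mul_test (f := fun x => Y x * c x) (by fun_prop) hΨ.deriv
    rw [e1, ← integral_sub iP' iA, ← integral_add (iP'.sub' iA) iQ', ← integral_const_mul]
    have e2 : ∫ x, Y x * (c x * deriv Ψ x) = ∫ x, Y x * c x * deriv Ψ x := by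
      congr 1; ext x; ring
    rw [e2, ← integral_sub (((iP'.sub' iA).fun_add iQ').const_mul _) iD]
    congr 1; ext x
    simp only [hg, hP, hQ]
    obtain ⟨h1, h2⟩ := hpm x
    generalize max 0 (c x) = m at h1 h2 ⊢
    generalize max 0 (-c x) = n at h1 h2 ⊢
    rw [← h1, ← h2]
    field_simp
    ring
  rw [e]
  refine hC Y g _ hY.locallyIntegrable hYp (fun x hx => ?_) (fun x => ?_)
  · have h0 : |ε| ≤ 1 := by rwa [abs_of_pos hε]
    have h1 := abs_sub (x + ε) ε
    have h2 := abs_sub (x + -ε) (-ε)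
    simp only [add_sub_cancel_right, abs_neg] at h1 h2
    simp only [hg]
    rw [hR x (by linarith), hR (x + ε) (by linarith), hR (x + -ε) (by linarith),
      deriv_eq_zero_of_support hR x (by linarith)]
    ring
  · simp only [hg]
    rw [abs_mul, abs_of_pos (by positivity : 0 < 1 / ε)]
    have h1 := abs_sub_sub_mul_deriv_le hΨ hB x ε
    have h2 := abs_sub_sub_mul_deriv_le hΨ hB x (-ε)
    have p1 := le_max_left 0 (c x)
    have p2 := le_max_left 0 (-c x)
    calc _ ≤ 1 / ε * (max 0 (c x) * (B * ε ^ 2) + max 0 (-c x) * (B * (-ε) ^ 2)) := by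
          refine mul_le_mul_of_nonneg_left ((abs_add_le _ _).trans ?_) (by positivity)
          rw [abs_mul, abs_mul, abs_of_nonneg p1, abs_of_nonneg p2]
          gcongr
      _ = 1 / ε * ((max 0 (c x) + max 0 (-c x)) * (B * ε ^ 2)) := by ring
      _ = |c x| * B * ε := by rw [(hpm x).1]; field_simp
      _ ≤ M * B * ε := by gcongr; exact hM x

/-- By duality the mollifier acts on `ψ`, whose Lipschitz constant yields the factor `δ`. Only the
`L¹` norm of `f` is needed. -/
lemma exists_mollify_pairing_bound {φ ψ : ℝ → ℝ} (hφ : IsMollifier φ) (hψ : IsTest ψ) :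
    ∃ C : ℝ, 0 ≤ C ∧ ∀ (δ : ℝ) (f : ℝ → ℝ), 0 < δ → δ ≤ 1 → LocallyIntegrable f volume →
    Function.Periodic f (2 * Real.pi) →
    |(∫ x, mollify φ δ f x * ψ x) - ∫ x, f x * ψ x| ≤ C * δ * periodL1 f := by
  obtain ⟨R₁, hR₁, h₁⟩ := hφ.comp_neg.1.exists_support_bound
  obtain ⟨R₂, hR₂, h₂⟩ := hψ.exists_support_bound
  obtain ⟨C, hC0, hC⟩ := exists_pairing_bound (R₂ + R₁)
  obtain ⟨L, hL0, hL⟩ := hψ.exists_lipschitz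
  obtain ⟨B, hB⟩ := hψ.exists_bound
  set J := ∫ z, |z| * |φ (-z)| with hJ
  have hJ0 : 0 ≤ J := integral_nonneg fun z => by positivity
  refine ⟨C * (L * J), by positivity, fun δ f hδ hδ1 hf hp => ?_⟩
  have hm := hφ.comp_neg.1.mollify hψ hδ
  have hfint : ∀ g : ℝ → ℝ, IsTest g → Integrable fun x => f x * g x := fun g hg =>
    hf.integrable_smul_right_of_hasCompactSupport hg.continuous hg.2
  rw [integral_mollify_mul hφ.1 hδ hf hψ.continuous hψ.2,
    ← integral_sub (hfint _ hm) (hfint _ hψ)]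
  simp_rw [← mul_sub]
  refine (hC f _ (L * J * δ) hf hp (fun x hx => ?_) (fun x => ?_)).trans_eq (by ring)
  · rw [mollify_support hδ hδ1 hR₁.le h₁ h₂ x hx, h₂ x (by linarith), sub_zero]
  · exact abs_mollify_sub_le hφ.comp_neg hδ hL0 hψ.continuous hL hB x

lemma integral_deriv_mul_test {s ψ : ℝ → ℝ} (hs : Differentiable ℝ s) (hs' : Continuous (deriv s))
    (hψ : IsTest ψ) : ∫ x, deriv s x * ψ x = -∫ x, s x * deriv ψ x := by
  rw [integral_mul_deriv_eq_deriv_mul_of_integrable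
    (fun x _ => (hs x).hasDerivAt) (fun x _ => (hψ.differentiable x).hasDerivAt)
    (integrable_mul_test hs.continuous hψ.deriv) (integrable_mul_test hs' hψ)
    (integrable_mul_test hs.continuous hψ), neg_neg]

/-- Residual of an unmollified solution of the upwind equation. -/
lemma exists_residual_bound {ψ : ℝ → ℝ} (hψ : IsTest ψ) : ∃ C : ℝ, 0 ≤ C ∧
    ∀ (ε M : ℝ) (c Y G s r : ℝ → ℝ), 0 < ε → ε ≤ 1 → Continuous c → (∀ x, |c x| ≤ M) →
    Continuous Y → Function.Periodic Y (2 * Real.pi) → Differentiable ℝ s → Continuous (deriv s) →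
    Continuous r → (∀ x, G x = 2 * upwind ε c Y x - deriv s x) →
    |∫ x, (G x * ψ x - (2 * (c x * Y x) + r x) * deriv ψ x)| ≤
      C * (M * ε * periodL1 Y) + |∫ x, (s x - r x) * deriv ψ x| := by
  obtain ⟨R, -, hR⟩ := hψ.exists_support_bound
  obtain ⟨B, hB⟩ := hψ.deriv.deriv.exists_bound
  obtain ⟨C, hC0, hC⟩ := exists_upwind_consistency_bound R
  have hB0 : 0 ≤ B := (abs_nonneg _).trans (hB 0)
  refine ⟨2 * C * B, by positivity, fun ε M c Y G s r hε hε1 hc hM hY hYp hs hs' hr hG => ?_⟩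
  have h := hC ε M B c Y ψ hε hε1 hc hM hY hYp hψ hR hB
  have i1 := integrable_mul_test (continuous_upwind ε hc hY) hψ
  have i2 := integrable_mul_test hs' hψ
  have i3 := integrable_mul_test (f := fun x => Y x * c x) (by fun_prop) hψ.deriv
  have i3' : Integrable fun x => Y x * (c x * deriv ψ x) := by simpa only [mul_assoc] using i3
  have i4 := integrable_mul_test hr hψ.deriv
  have i5 := integrable_mul_test hs.continuous hψ.deriv
  have e : ∫ x, (G x * ψ x - (2 * (c x * Y x) + r x) * deriv ψ x) =
      2 * ((∫ x, upwind ε c Y x * ψ x) - ∫ x, Y x * (c x * deriv ψ x))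
        + ∫ x, (s x - r x) * deriv ψ x := by
    have e1 : ∫ x, (s x - r x) * deriv ψ x =
        -(∫ x, deriv s x * ψ x) - ∫ x, r x * deriv ψ x := by
      simp_rw [sub_mul]
      rw [integral_sub i5 i4, integral_deriv_mul_test hs hs' hψ, neg_neg]
    rw [e1, ← integral_sub i1 i3', ← integral_const_mul, ← integral_neg,
      ← integral_sub i2.fun_neg i4, ← integral_add ((i1.sub' i3').const_mul 2) (i2.fun_neg.sub' i4)]
    congr 1; ext x
    simp only [hG]
    ring
  rw [e]
  refine (abs_add_le _ _).trans (add_le_add ?_ le_rfl)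
  rw [abs_mul, abs_two]
  calc _ ≤ 2 * (C * (M * B * ε) * periodL1 Y) := by gcongr
    _ = _ := by ring

/-- Residual of a mollified solution of the upwind equation. -/
lemma exists_mollified_residual_bound {φ ψ : ℝ → ℝ} (hφ : IsMollifier φ) (hψ : IsTest ψ) :
    ∃ C : ℝ, 0 ≤ C ∧
    ∀ (ε δ M L : ℝ) (c Y G s : ℝ → ℝ), 0 < ε → ε ≤ 1 → 0 < δ → δ ≤ 1 → Continuous c →
    (∀ x, |c x| ≤ M) → 0 ≤ L → (∀ x y, |c x - c y| ≤ L * |x - y|) →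
    Continuous Y → Function.Periodic Y (2 * Real.pi) → Differentiable ℝ s → Continuous (deriv s) →
    Function.Periodic s (2 * Real.pi) → Continuous G →
    (∀ x, G x = 2 * upwind ε c Y x - deriv s x) →
    |∫ x, (mollify φ δ G x * ψ x - (2 * (c x * mollify φ δ Y x) + s x) * deriv ψ x)| ≤
      C * (M * ε * periodL1 Y + L * δ * periodL1 Y + δ * periodL1 s) := by
  set φ' : ℝ → ℝ := fun x => φ (-x) with hφ'
  have hφm : IsMollifier φ' := hφ.comp_neg
  obtain ⟨R₁, hR₁, h₁⟩ := hφm.1.exists_support_bound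
  obtain ⟨R₂, hR₂, h₂⟩ := hψ.exists_support_bound
  obtain ⟨B₁, hB₁⟩ := hψ.deriv.exists_bound
  obtain ⟨B₂, hB₂⟩ := hψ.deriv.deriv.exists_bound
  obtain ⟨C₁, hC₁0, hC₁⟩ := exists_upwind_consistency_bound (R₂ + R₁)
  obtain ⟨C₂, hC₂0, hC₂⟩ := exists_pairing_bound (R₂ + R₁)
  obtain ⟨C₃, hC₃0, hC₃⟩ := exists_mollify_pairing_bound hφ hψ.deriv
  set I := ∫ z, |φ' z| with hI
  set J := ∫ z, |z| * |φ' z| with hJ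
  have hI0 : 0 ≤ I := integral_nonneg fun z => by positivity
  have hJ0 : 0 ≤ J := integral_nonneg fun z => by positivity
  have hB₁0 : 0 ≤ B₁ := (abs_nonneg _).trans (hB₁ 0)
  have hB₂0 : 0 ≤ B₂ := (abs_nonneg _).trans (hB₂ 0)
  refine ⟨2 * (C₁ * (B₂ * I)) + 2 * (C₂ * (B₁ * J)) + C₃, by positivity,
    fun ε δ M L c Y G s hε hε1 hδ hδ1 hc hM hL0 hL hY hYp hs hs' hsp hGc hG => ?_⟩
  have hM0 : 0 ≤ M := (abs_nonneg _).trans (hM 0)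
  -- Testing the mollified equation against `ψ` amounts to testing the original one against `Ψ`.
  set Ψ := mollify φ' δ ψ with hΨdef
  have hΨ : IsTest Ψ := hφm.1.mollify hψ hδ
  have hΨd : deriv Ψ = mollify φ' δ (deriv ψ) :=
    funext fun x => (hasDerivAt_mollify_of_test hφm.1 hδ hψ x).deriv
  have hΨdd : deriv (deriv Ψ) = mollify φ' δ (deriv (deriv ψ)) := by
    rw [hΨd]
    exact funext fun x => (hasDerivAt_mollify_of_test hφm.1 hδ hψ.deriv x).deriv
  have h2' := deriv_eq_zero_of_support h₂
  have hcψ : Continuous fun x => c x * deriv ψ x := hc.mul hψ.deriv.continuous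
  have hcψs : HasCompactSupport fun x => c x * deriv ψ x := hψ.deriv.2.mul_left
  -- The commutator of mollification with multiplication by the velocity, the only place where the
  -- slope of `c` enters.
  set κ : ℝ → ℝ := fun x => c x * deriv Ψ x - mollify φ' δ (fun y => c y * deriv ψ y) x with hκ
  have hκs : ∀ x, R₂ + R₁ < |x| → κ x = 0 := fun x hx => by
    simp only [hκ]
    rw [hΨd, mollify_support hδ hδ1 hR₁.le h₁ h2' x hx, mollify_support hδ hδ1 hR₁.le h₁
      (fun y hy => by rw [h2' y hy, mul_zero]) x hx]
    ring
  have hκb : ∀ x, |κ x| ≤ L * B₁ * J * δ := fun x => by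
    simp only [hκ, hΨd]
    exact abs_mul_mollify_sub_le hφm.1 hδ hL0 hc hL hM hψ.deriv.continuous hB₁ x
  have hmY : Continuous (mollify φ δ Y) := continuous_mollify hφ.1 hδ hY.locallyIntegrable
  have hmG : Continuous (mollify φ δ G) := continuous_mollify hφ.1 hδ hGc.locallyIntegrable
  have hmcψ : Continuous (mollify φ' δ fun y => c y * deriv ψ y) :=
    continuous_mollify hφm.1 hδ hcψ.locallyIntegrable
  have i1 := integrable_mul_test (continuous_upwind ε hc hY) hΨ
  have i2 := integrable_mul_test hs' hΨ
  have i3 : Integrable fun x => Y x * (c x * deriv Ψ x) := by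
    simpa only [mul_assoc] using
      integrable_mul_test (f := fun x => Y x * c x) (by fun_prop) hΨ.deriv
  have i5 := integrable_mul_test hs.continuous hψ.deriv
  have i6 : Integrable fun x => mollify φ δ Y x * (c x * deriv ψ x) :=
    (hmY.mul hcψ).integrable_of_hasCompactSupport hcψs.mul_left
  have i7 := integrable_mul_test hmG hψ
  have i8 : Integrable fun x => Y x * mollify φ' δ (fun y => c y * deriv ψ y) x := by
    refine (hY.mul hmcψ).integrable_of_hasCompactSupport (HasCompactSupport.mul_left ?_)
    rw [mollify_eq_convolution]
    exact (hφm.1.scaled hδ.ne').2.convolution _ hcψs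
  -- Three errors: consistency of the upwind operator, the commutator, and the discrepancy between
  -- `s`, which stands in the flux, and its mollification, which the scheme produces.
  have e : ∫ x, (mollify φ δ G x * ψ x - (2 * (c x * mollify φ δ Y x) + s x) * deriv ψ x) =
      2 * ((∫ x, upwind ε c Y x * Ψ x) - ∫ x, Y x * (c x * deriv Ψ x))
        + 2 * (∫ x, Y x * κ x)
        + ((∫ x, mollify φ δ s x * deriv ψ x) - ∫ x, s x * deriv ψ x) := by
    have a1 : ∫ x, mollify φ δ G x * ψ x =
        2 * (∫ x, upwind ε c Y x * Ψ x) - ∫ x, deriv s x * Ψ x := by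
      rw [integral_mollify_mul hφ.1 hδ hGc.locallyIntegrable hψ.continuous hψ.2,
        ← integral_const_mul, ← integral_sub (i1.const_mul 2) i2]
      congr 1; ext x
      rw [hG]
      ring
    have a2 : ∫ x, deriv s x * Ψ x = -∫ x, mollify φ δ s x * deriv ψ x := by
      rw [integral_deriv_mul_test hs hs' hΨ, hΨd, integral_mollify_mul hφ.1 hδ
        hs.continuous.locallyIntegrable hψ.deriv.continuous hψ.deriv.2]
    have a3 : ∫ x, Y x * κ x =
        (∫ x, Y x * (c x * deriv Ψ x)) - ∫ x, mollify φ δ Y x * (c x * deriv ψ x) := by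
      rw [integral_mollify_mul hφ.1 hδ hY.locallyIntegrable hcψ hcψs, ← integral_sub i3 i8]
      congr 1; ext x
      simp only [hκ]
      ring
    have a4 : ∫ x, (mollify φ δ G x * ψ x - (2 * (c x * mollify φ δ Y x) + s x) * deriv ψ x) =
        (∫ x, mollify φ δ G x * ψ x) - (2 * (∫ x, mollify φ δ Y x * (c x * deriv ψ x))
          + ∫ x, s x * deriv ψ x) := by
      rw [← integral_const_mul, ← integral_add (i6.const_mul 2) i5,
        ← integral_sub i7 ((i6.const_mul 2).fun_add i5)]
      congr 1; ext x
      ring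
    rw [a4, a1, a2, a3]
    ring
  have b1 := hC₁ ε M (B₂ * I) c Y Ψ hε hε1 hc hM hY hYp hΨ
    (fun x hx => mollify_support hδ hδ1 hR₁.le h₁ h₂ x hx)
    (fun x => by
      rw [hΨdd]
      exact abs_mollify_le hφm.1 hδ (Eventually.of_forall hB₂) x)
  have b2 := hC₂ Y κ _ hY.locallyIntegrable hYp hκs hκb
  have b3 := hC₃ δ s hδ hδ1 hs.continuous.locallyIntegrable hsp
  rw [e]
  have hN := periodL1_nonneg Y
  have hN' := periodL1_nonneg s
  have t1 : 0 ≤ M * ε * periodL1 Y := by positivity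
  have t2 : 0 ≤ L * δ * periodL1 Y := by positivity
  have t3 : 0 ≤ δ * periodL1 s := by positivity
  refine (abs_add_three _ _ _).trans ?_
  rw [abs_mul, abs_mul, abs_two]
  have d1 : 0 ≤ C₁ * (B₂ * I) := by positivity
  have d2 : 0 ≤ C₂ * (B₁ * J) := by positivity
  calc _ ≤ 2 * (C₁ * (M * (B₂ * I) * ε) * periodL1 Y)
        + 2 * (C₂ * (L * B₁ * J * δ) * periodL1 Y) + C₃ * δ * periodL1 s := by gcongr
    _ = 2 * (C₁ * (B₂ * I)) * (M * ε * periodL1 Y)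
        + 2 * (C₂ * (B₁ * J)) * (L * δ * periodL1 Y) + C₃ * (δ * periodL1 s) := by ring
    _ ≤ _ := by
      nlinarith [mul_nonneg d1 t2, mul_nonneg d1 t3, mul_nonneg d2 t1, mul_nonneg d2 t3,
        mul_nonneg hC₃0 t1, mul_nonneg hC₃0 t2]

/-! ### Power bounds in the small parameter -/

/-- `N ε t = O(ε^{-a})` as `ε → 0⁺`, uniformly for `t ∈ [0, T]`. -/
def IsPowBounded (T a : ℝ) (N : ℝ → ℝ → ℝ) : Prop :=
  ∃ C : ℝ, 0 ≤ C ∧ ∀ᶠ ε in 𝓝[>] (0 : ℝ), ∀ t ∈ Icc 0 T, N ε t ≤ C * ε ^ (-a)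

lemma eventually_mem_Ioo : ∀ᶠ ε in 𝓝[>] (0 : ℝ), ε ∈ Ioo (0 : ℝ) 1 :=
  Ioo_mem_nhdsGT one_pos

section PowBounded

variable {T a b : ℝ} {N N' : ℝ → ℝ → ℝ}

lemma IsPowBounded.mono_exp (h : IsPowBounded T a N) (hab : a ≤ b) : IsPowBounded T b N := by
  obtain ⟨C, hC0, hC⟩ := h
  refine ⟨C, hC0, ?_⟩
  filter_upwards [hC, eventually_mem_Ioo] with ε hε h01 t ht
  exact (hε t ht).trans (mul_le_mul_of_nonneg_left
    (Real.rpow_le_rpow_of_exponent_ge h01.1 h01.2.le (by linarith)) hC0)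

lemma IsPowBounded.of_le (h : IsPowBounded T a N) {c : ℝ} (hc : 0 ≤ c)
    (hle : ∀ ε ∈ Ioo (0 : ℝ) 1, ∀ t ∈ Icc 0 T, N' ε t ≤ c * N ε t) : IsPowBounded T a N' := by
  obtain ⟨C, hC0, hC⟩ := h
  refine ⟨c * C, by positivity, ?_⟩
  filter_upwards [hC, eventually_mem_Ioo] with ε hε h01 t ht
  rw [mul_assoc]
  exact (hle ε h01 t ht).trans (mul_le_mul_of_nonneg_left (hε t ht) hc)

lemma IsPowBounded.add (h : IsPowBounded T a N) (h' : IsPowBounded T a N') :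
    IsPowBounded T a fun ε t => N ε t + N' ε t := by
  obtain ⟨C, hC0, hC⟩ := h
  obtain ⟨C', hC0', hC'⟩ := h'
  refine ⟨C + C', by positivity, ?_⟩
  filter_upwards [hC, hC'] with ε h1 h2 t ht
  rw [add_mul]
  exact add_le_add (h1 t ht) (h2 t ht)

lemma IsPowBounded.const_mul (h : IsPowBounded T a N) {c : ℝ} (hc : 0 ≤ c) :
    IsPowBounded T a fun ε t => c * N ε t :=
  h.of_le hc fun _ _ _ _ => le_rfl

lemma IsPowBounded.mul (h : IsPowBounded T a N) (h' : IsPowBounded T b N')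
    (h0 : ∀ ε ∈ Ioo (0 : ℝ) 1, ∀ t ∈ Icc 0 T, 0 ≤ N' ε t) :
    IsPowBounded T (a + b) fun ε t => N ε t * N' ε t := by
  obtain ⟨C, hC0, hC⟩ := h
  obtain ⟨C', hC0', hC'⟩ := h'
  refine ⟨C * C', by positivity, ?_⟩
  filter_upwards [hC, hC', eventually_mem_Ioo] with ε h1 h2 h01 t ht
  have hε := h01.1
  rw [neg_add, Real.rpow_add hε]
  calc _ ≤ C * ε ^ (-a) * (C' * ε ^ (-b)) :=
        mul_le_mul (h1 t ht) (h2 t ht) (h0 ε h01 t ht) (by positivity)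
    _ = _ := by ring

lemma isPowBounded_const (c : ℝ) : IsPowBounded T 0 fun _ _ => c :=
  ⟨|c|, abs_nonneg c, Eventually.of_forall fun ε t _ => by simpa using le_abs_self c⟩

lemma isPowBounded_rpow (b : ℝ) : IsPowBounded T (-b) fun ε _ => ε ^ b :=
  ⟨1, zero_le_one, Eventually.of_forall fun ε t _ => by simp⟩

lemma isPowBounded_sum {ι : Type*} (s : Finset ι) {N : ι → ℝ → ℝ → ℝ}
    (h : ∀ i ∈ s, IsPowBounded T a (N i)) : IsPowBounded T a fun ε t => ∑ i ∈ s, N i ε t := by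
  classical
  induction s using Finset.induction_on with
  | empty =>
    exact ⟨0, le_rfl, Eventually.of_forall fun ε t _ => by simp⟩
  | insert i s hi ih =>
    simp_rw [Finset.sum_insert hi]
    exact (h i (Finset.mem_insert_self i s)).add
      (ih fun j hj => h j (Finset.mem_insert_of_mem hj))

lemma IsPowBounded.pow (h : IsPowBounded T a N)
    (h0 : ∀ ε ∈ Ioo (0 : ℝ) 1, ∀ t ∈ Icc 0 T, 0 ≤ N ε t) (n : ℕ) :
    IsPowBounded T (n * a) fun ε t => N ε t ^ n := by
  induction n with
  | zero => simpa using isPowBounded_const 1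
  | succ n ih =>
    have := ih.mul h h0
    simpa only [Nat.cast_succ, add_mul, one_mul, pow_succ] using this

lemma IsPowBounded.tendstoUniformlyOn (h : IsPowBounded T a N) (ha : a < 0)
    {r : ℝ → ℝ → ℝ} (hr : ∀ ε ∈ Ioo (0 : ℝ) 1, ∀ t ∈ Icc 0 T, |r ε t| ≤ N ε t) :
    TendstoUniformlyOn r (fun _ => 0) (𝓝[>] 0) (Icc 0 T) := by
  obtain ⟨C, hC0, hC⟩ := h
  have hlim : Tendsto (fun ε : ℝ => C * ε ^ (-a)) (𝓝[>] 0) (𝓝 0) := by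
    have h1 : Tendsto (fun ε : ℝ => ε ^ (-a)) (𝓝 0) (𝓝 0) := by
      have := (Real.continuousAt_rpow_const 0 (-a) (Or.inr (by linarith))).tendsto
      rwa [Real.zero_rpow (by linarith)] at this
    simpa using (h1.mono_left nhdsWithin_le_nhds).const_mul C
  rw [Metric.tendstoUniformlyOn_iff]
  intro e he
  filter_upwards [hC, eventually_mem_Ioo, hlim.eventually (gt_mem_nhds he)] with ε h1 h01 h2 t ht
  rw [dist_zero_left, Real.norm_eq_abs]
  exact ((hr ε h01 t ht).trans (h1 t ht)).trans_lt h2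

end PowBounded

/-! ### Consequences for families of solutions -/

section Families

variable {φ u₀ g : ℝ → ℝ} {β : ℝ} {u : ℝ → ℝ → ℝ → ℝ} {gε : ℝ → ℝ → ℝ}
  {Y : ℝ → ℝ → (ℝ →ᵇ ℝ)} {s : ℝ → ℝ → ℝ → ℝ}

lemma IsVelocityFamily.exists_isBoundedVelocity (hu : IsVelocityFamily β u₀ u) :
    ∃ M : ℝ, ∀ ε ∈ Ioo (0 : ℝ) 1, IsBoundedVelocity (u ε) M := by
  obtain ⟨M, hM⟩ := hu.bounded
  exact ⟨M, fun ε hε => ⟨hu.continuous ε hε, hu.periodic ε hε, hM ε hε⟩⟩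

lemma IsVelocityFamily.exists_lipschitz (hu : IsVelocityFamily β u₀ u) (T : ℝ) :
    ∃ C : ℝ, 0 ≤ C ∧ ∀ ε ∈ Ioo (0 : ℝ) 1, ∀ t ∈ Icc 0 T, ∀ x y,
      |u ε t x - u ε t y| ≤ C * ε ^ (-β) * |x - y| := by
  obtain ⟨C, hC⟩ := hu.deriv_bound T
  refine ⟨|C|, abs_nonneg C, fun ε hε t ht x y => ?_⟩
  have hb : ∀ z, |deriv (u ε t) z| ≤ |C| * ε ^ (-β) := fun z => by
    have hpos := Real.rpow_pos_of_pos hε.1 β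
    rw [Real.rpow_neg hε.1.le, ← div_eq_mul_inv]
    exact (hC ε hε t ht z).trans (div_le_div_of_nonneg_right (le_abs_self C) hpos.le)
  have := convex_univ.norm_image_sub_le_of_norm_deriv_le
    (fun z _ => hu.differentiable ε hε t ht.1 z) (fun z _ => hb z) (mem_univ y) (mem_univ x)
  simpa using this

lemma IsRegularization.isPowBounded (hg : IsRegularization g gε) (T : ℝ) :
    IsPowBounded T 0 fun ε _ => periodL1 (gε ε) := by
  obtain ⟨C, hC⟩ := hg.bounded
  refine ⟨|C|, abs_nonneg C, hC.mono fun ε hε t _ => ?_⟩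
  rw [neg_zero, Real.rpow_zero, mul_one]
  exact hε.trans (le_abs_self C)

/-- Transport costs nothing in `L¹` and the time interval is bounded, so a solution inherits the
growth exponent of its source. The bounded initial data fit in because `a ≥ 0`. -/
lemma isPowBounded_periodL1_solution (hu : IsVelocityFamily β u₀ u) (hg : IsRegularization g gε)
    {S : ℝ → ℝ → ℝ → ℝ}
    (hY : ∀ ε ∈ Ioo (0 : ℝ) 1, IsTransportSolution ε (u ε) (S ε) (gε ε) (Y ε)) {T a : ℝ}
    (ha : 0 ≤ a) (hS : IsPowBounded T a fun ε t => periodL1 (S ε t)) :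
    IsPowBounded T a fun ε t => periodL1 (Y ε t) := by
  obtain ⟨M, hM⟩ := hu.exists_isBoundedVelocity
  obtain ⟨C, hC0, hC⟩ := hS
  obtain ⟨C', hC0', hC'⟩ := (hg.isPowBounded T).mono_exp ha
  refine ⟨C' + C * |T|, by positivity, ?_⟩
  filter_upwards [hC, hC', eventually_mem_Ioo] with ε h1 h2 h01 t ht
  have h3 := (hY ε h01).periodL1_le h01.1 (hM ε h01) h1 t ht
  have hε := h01.1
  have hT : t ≤ |T| := ht.2.trans (le_abs_self T)
  calc _ ≤ C' * ε ^ (-a) + C * ε ^ (-a) * |T| := by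
        refine h3.trans (add_le_add (h2 t ht) ?_)
        gcongr
    _ = _ := by ring

/-- Evaluation at a point is a bounded functional, so a derivative in sup norm gives one at each
`x`. The map `Λ` will be a mollification or the identity, according to the kind of unknown. -/
lemma IsTransportSolution.hasDerivWithinAt_clm {ε t : ℝ} {u S : ℝ → ℝ → ℝ} {y₀ : ℝ → ℝ}
    {Y : ℝ → (ℝ →ᵇ ℝ)} (hY : IsTransportSolution ε u S y₀ Y) (ht : 0 ≤ t)
    (Λ : (ℝ →ᵇ ℝ) →L[ℝ] (ℝ →ᵇ ℝ)) :
    ∃ G : ℝ →ᵇ ℝ, (∀ x, G x = 2 * upwind ε (u t) (Y t) x - S t x) ∧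
      ∀ x, HasDerivWithinAt (fun s => Λ (Y s) x) (Λ G x) (Ici 0) t := by
  obtain ⟨G, hG, hGd⟩ := hY.ode t ht
  refine ⟨G, hG, fun x => ?_⟩
  exact (((BoundedContinuousFunction.evalCLM ℝ x).comp Λ).hasFDerivAt (x := Y t)
    ).comp_hasDerivWithinAt t hGd

/-- Mollified solutions of the upwind equation form a weak asymptotic method, provided the `L¹`
norms grow slowly enough. -/
theorem isWeakAsymptotic_smoothed (hφ : IsMollifier φ) (hu : IsVelocityFamily β u₀ u)
    {α a b : ℝ} (hg : IsRegularization g gε)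
    (hY : ∀ ε ∈ Ioo (0 : ℝ) 1,
      IsTransportSolution ε (u ε) (fun t x => deriv (s ε t) x) (gε ε) (Y ε))
    (hs : ∀ ε ∈ Ioo (0 : ℝ) 1, ∀ t, 0 ≤ t → Differentiable ℝ (s ε t))
    (hsp : ∀ ε ∈ Ioo (0 : ℝ) 1, ∀ t, 0 ≤ t → Function.Periodic (s ε t) (2 * Real.pi))
    {F : ℝ → ℝ → ℝ → ℝ} (hF : ∀ ε ∈ Ioo (0 : ℝ) 1, ∀ t, 0 ≤ t → ∀ x,
      F ε t x = 2 * (u ε t x * smoothed φ α Y ε t x) + s ε t x)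
    (ha : ∀ T, IsPowBounded T a fun ε t => periodL1 (Y ε t))
    (hb : ∀ T, IsPowBounded T b fun ε t => periodL1 (s ε t))
    (hα : 0 < α) (ha1 : a < 1) (haβ : a + β < α) (hbα : b < α) :
    IsWeakAsymptotic (smoothed φ α Y) F g := by
  obtain ⟨M, hM⟩ := hu.exists_isBoundedVelocity
  have hδ : ∀ ε ∈ Ioo (0 : ℝ) 1, 0 < ε ^ α := fun ε hε => Real.rpow_pos_of_pos hε.1 α
  have hδ1 : ∀ ε ∈ Ioo (0 : ℝ) 1, ε ^ α ≤ 1 := fun ε hε =>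
    Real.rpow_le_one hε.1.le hε.2.le hα.le
  have hder : ∀ ε ∈ Ioo (0 : ℝ) 1, ∀ t, 0 ≤ t → ∃ G : ℝ →ᵇ ℝ,
      (∀ x, G x = 2 * upwind ε (u ε t) (Y ε t) x - deriv (s ε t) x) ∧
      ∀ x, HasDerivWithinAt (fun τ => smoothed φ α Y ε τ x) (mollify φ (ε ^ α) G x) (Ici 0) t :=
    fun ε hε t ht => (hY ε hε).hasDerivWithinAt_clm ht (mollifyL hφ.1 (hδ ε hε))
  have hsm : ∀ ε ∈ Ioo (0 : ℝ) 1, ∀ t, Continuous (smoothed φ α Y ε t) := fun ε hε t =>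
    continuous_mollify hφ.1 (hδ ε hε) (Y ε t).continuous.locallyIntegrable
  refine ⟨fun ε hε t ht x => ?_, fun ε hε t ht => ?_, fun ε hε t ht => ?_, fun ψ hψ T => ?_,
    fun ψ hψ => ?_⟩
  · obtain ⟨G, -, hG⟩ := hder ε hε t ht
    exact (hG x).differentiableWithinAt
  · obtain ⟨G, -, hG⟩ := hder ε hε t ht
    rw [show (fun x => derivWithin (fun τ => smoothed φ α Y ε τ x) (Ici 0) t)
      = mollify φ (ε ^ α) G from
      funext fun x => (hG x).derivWithin (uniqueDiffOn_Ici 0 t ht)]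
    exact (continuous_mollify hφ.1 (hδ ε hε) G.continuous.locallyIntegrable).locallyIntegrable
  · rw [show F ε t = fun x => 2 * (u ε t x * smoothed φ α Y ε t x) + s ε t x from
      funext (hF ε hε t ht)]
    have h1 := (hM ε hε).continuous ht
    have h2 := hsm ε hε t
    have h3 := (hs ε hε t ht).continuous
    exact (by fun_prop : Continuous _).locallyIntegrable
  · obtain ⟨C, hC0, hC⟩ := exists_mollified_residual_bound hφ hψ
    obtain ⟨L, hL0, hL⟩ := hu.exists_lipschitz T
    have hM0 : 0 ≤ |M| := abs_nonneg M
    have hYn : ∀ ε ∈ Ioo (0 : ℝ) 1, ∀ t ∈ Icc 0 T, 0 ≤ periodL1 (Y ε t) :=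
      fun ε _ t _ => periodL1_nonneg _
    have hsn : ∀ ε ∈ Ioo (0 : ℝ) 1, ∀ t ∈ Icc 0 T, 0 ≤ periodL1 (s ε t) :=
      fun ε _ t _ => periodL1_nonneg _
    -- The exponents of the consistency, commutator and source errors. Their negativity is exactly
    -- `ha1`, `haβ` and `hbα`.
    set m := max (-1 + a) (max (β + -α + a) (-α + b)) with hm
    have t1 : IsPowBounded T m fun ε t => |M| * (ε ^ (1 : ℝ) * periodL1 (Y ε t)) :=
      (((isPowBounded_rpow 1).mul (ha T) hYn).const_mul hM0).mono_exp (le_max_left _ _)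
    have t2 : IsPowBounded T m
        fun ε t => L * (ε ^ (-β) * ε ^ α * periodL1 (Y ε t)) := by
      have h1 : IsPowBounded T β fun ε _ => ε ^ (-β) := by
        simpa using isPowBounded_rpow (T := T) (-β)
      exact (((h1.mul (isPowBounded_rpow α) fun ε hε t _ => (hδ ε hε).le).mul (ha T)
        hYn).const_mul hL0).mono_exp ((le_max_left _ _).trans (le_max_right _ _))
    have t3 : IsPowBounded T m fun ε t => ε ^ α * periodL1 (s ε t) :=
      ((isPowBounded_rpow α).mul (hb T) hsn).mono_exp
        ((le_max_right _ _).trans (le_max_right _ _))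
    refine (((t1.add t2).add t3).const_mul hC0).tendstoUniformlyOn
      (by simp only [hm, max_lt_iff]; constructor; linarith; constructor <;> linarith)
      fun ε hε t ht => ?_
    obtain ⟨G, hG, hGd⟩ := hder ε hε t ht.1
    have hres : weakResidual (smoothed φ α Y) F ψ ε t =
        ∫ x, (mollify φ (ε ^ α) G x * ψ x -
          (2 * (u ε t x * mollify φ (ε ^ α) (Y ε t) x) + s ε t x) * deriv ψ x) := by
      unfold weakResidual
      congr 1; ext x
      rw [(hGd x).derivWithin (uniqueDiffOn_Ici 0 t ht.1), hF ε hε t ht.1]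
      rfl
    rw [hres]
    have hε0 := hε.1
    refine (hC ε (ε ^ α) |M| (L * ε ^ (-β)) (u ε t) (Y ε t) G (s ε t) hε.1 hε.2.le (hδ ε hε)
      (hδ1 ε hε) ((hM ε hε).continuous ht.1)
      (fun x => ((hM ε hε).bounded t ht.1 x).trans (le_abs_self M)) (by positivity)
      (hL ε hε t ht) (Y ε t).continuous ((hY ε hε).periodic t ht.1) (hs ε hε t ht.1)
      ((hY ε hε).continuous_source (hM ε hε) ht.1) (hsp ε hε t ht.1) G.continuous hG).trans_eq ?_
    rw [Real.rpow_one]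
    ring
  · obtain ⟨C, hC0, hC⟩ := exists_mollify_pairing_bound hφ hψ
    -- Mollifying the initial data changes their pairing with `ψ` by `O(ε ^ α)`, because they are
    -- bounded in `L¹`.
    have hlim : Tendsto (fun ε => (∫ x, smoothed φ α Y ε 0 x * ψ x) - ∫ x, gε ε x * ψ x)
        (𝓝[>] 0) (𝓝 0) := by
      have hu' : TendstoUniformlyOn
          (fun ε (_ : ℝ) => (∫ x, smoothed φ α Y ε 0 x * ψ x) - ∫ x, gε ε x * ψ x)
          (fun _ => 0) (𝓝[>] 0) (Icc 0 0) := by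
        refine ((((isPowBounded_rpow α).mul (hg.isPowBounded 0)
          fun _ _ _ _ => periodL1_nonneg _).const_mul hC0).tendstoUniformlyOn (by linarith))
          fun ε hε t _ => ?_
        have h0 : ⇑(Y ε 0) = gε ε := funext (hY ε hε).initial
        have := hC (ε ^ α) (gε ε) (hδ ε hε) (hδ1 ε hε)
          (hg.continuous ε hε).locallyIntegrable (hg.periodic ε hε)
        simp only [smoothed, h0]
        rwa [← mul_assoc]
      exact hu'.tendsto_at (x := 0) ⟨le_rfl, le_rfl⟩
    have := hlim.add (hg.tendsto ψ hψ)
    simpa using this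

/-- Solutions of the upwind equation form a weak asymptotic method, provided their `L¹` norms
grow slowly enough and the fluxes `s` and `r` are asymptotically equal. -/
theorem isWeakAsymptotic_transport (hu : IsVelocityFamily β u₀ u)
    {a : ℝ} (hg : IsRegularization g gε)
    (hY : ∀ ε ∈ Ioo (0 : ℝ) 1,
      IsTransportSolution ε (u ε) (fun t x => deriv (s ε t) x) (gε ε) (Y ε))
    (hs : ∀ ε ∈ Ioo (0 : ℝ) 1, ∀ t, 0 ≤ t → Differentiable ℝ (s ε t))
    {r F : ℝ → ℝ → ℝ → ℝ} (hr : ∀ ε ∈ Ioo (0 : ℝ) 1, ∀ t, 0 ≤ t → Continuous (r ε t))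
    (hF : ∀ ε ∈ Ioo (0 : ℝ) 1, ∀ t, 0 ≤ t → ∀ x, F ε t x = 2 * (u ε t x * Y ε t x) + r ε t x)
    (ha : ∀ T, IsPowBounded T a fun ε t => periodL1 (Y ε t)) (ha1 : a < 1)
    {b : ℝ} (hb : b < 0) (hsr : ∀ ψ : ℝ → ℝ, IsTest ψ → ∀ T,
      IsPowBounded T b fun ε t => |∫ x, (s ε t x - r ε t x) * deriv ψ x|) :
    IsWeakAsymptotic (fun ε t x => Y ε t x) F g := by
  obtain ⟨M, hM⟩ := hu.exists_isBoundedVelocity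
  have hder : ∀ ε ∈ Ioo (0 : ℝ) 1, ∀ t, 0 ≤ t → ∃ G : ℝ →ᵇ ℝ,
      (∀ x, G x = 2 * upwind ε (u ε t) (Y ε t) x - deriv (s ε t) x) ∧
      ∀ x, HasDerivWithinAt (fun τ => Y ε τ x) (G x) (Ici 0) t :=
    fun ε hε t ht => (hY ε hε).hasDerivWithinAt_clm ht (ContinuousLinearMap.id ℝ _)
  refine ⟨fun ε hε t ht x => ?_, fun ε hε t ht => ?_, fun ε hε t ht => ?_, fun ψ hψ T => ?_,
    fun ψ hψ => ?_⟩
  · obtain ⟨G, -, hG⟩ := hder ε hε t ht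
    exact (hG x).differentiableWithinAt
  · obtain ⟨G, -, hG⟩ := hder ε hε t ht
    rw [show (fun x => derivWithin (fun τ => Y ε τ x) (Ici 0) t) = G from
      funext fun x => (hG x).derivWithin (uniqueDiffOn_Ici 0 t ht)]
    exact G.continuous.locallyIntegrable
  · rw [show F ε t = fun x => 2 * (u ε t x * Y ε t x) + r ε t x from funext (hF ε hε t ht)]
    have h1 := (hM ε hε).continuous ht
    have h3 := hr ε hε t ht
    exact (by fun_prop : Continuous _).locallyIntegrable
  · obtain ⟨C, hC0, hC⟩ := exists_residual_bound hψ
    have hM0 : 0 ≤ |M| := abs_nonneg M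
    have hYn : ∀ ε ∈ Ioo (0 : ℝ) 1, ∀ t ∈ Icc 0 T, 0 ≤ periodL1 (Y ε t) :=
      fun ε _ t _ => periodL1_nonneg _
    -- Without mollification of the unknown there is no commutator, hence no condition linking `a`
    -- to `β`.
    have t1 : IsPowBounded T (max (-1 + a) b)
        fun ε t => C * (|M| * (ε ^ (1 : ℝ) * periodL1 (Y ε t))) :=
      ((((isPowBounded_rpow 1).mul (ha T) hYn).const_mul hM0).const_mul hC0).mono_exp
        (le_max_left _ _)
    refine (t1.add ((hsr ψ hψ T).mono_exp (le_max_right _ _))).tendstoUniformlyOn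
      (max_lt (by linarith) hb) fun ε hε t ht => ?_
    obtain ⟨G, hG, hGd⟩ := hder ε hε t ht.1
    have hres : weakResidual (fun ε t x => Y ε t x) F ψ ε t =
        ∫ x, (G x * ψ x - (2 * (u ε t x * Y ε t x) + r ε t x) * deriv ψ x) := by
      unfold weakResidual
      congr 1; ext x
      rw [(hGd x).derivWithin (uniqueDiffOn_Ici 0 t ht.1), hF ε hε t ht.1]
    rw [hres]
    refine (hC ε |M| (u ε t) (Y ε t) G (s ε t) (r ε t) hε.1 hε.2.le
      ((hM ε hε).continuous ht.1)
      (fun x => ((hM ε hε).bounded t ht.1 x).trans (le_abs_self M))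
      (Y ε t).continuous ((hY ε hε).periodic t ht.1) (hs ε hε t ht.1)
      ((hY ε hε).continuous_source (hM ε hε) ht.1) (hr ε hε t ht.1) hG).trans_eq ?_
    rw [Real.rpow_one]
    ring
  · refine (hg.tendsto ψ hψ).congr' ?_
    filter_upwards [eventually_mem_Ioo] with ε hε
    simp only [(hY ε hε).initial]

end Families

/-! ### Bounds for smoothed solutions -/

lemma rpow_scale_pos {ε : ℝ} (hε : ε ∈ Ioo (0 : ℝ) 1) (α : ℝ) : 0 < ε ^ α :=
  Real.rpow_pos_of_pos hε.1 α

lemma rpow_scale_le_one {ε α : ℝ} (hε : ε ∈ Ioo (0 : ℝ) 1) (hα : 0 < α) : ε ^ α ≤ 1 :=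
  Real.rpow_le_one hε.1.le hε.2.le hα.le

lemma isPowBounded_inv_rpow {T : ℝ} (α : ℝ) : IsPowBounded T α fun ε _ => (ε ^ α)⁻¹ := by
  refine ⟨1, zero_le_one, ?_⟩
  filter_upwards [eventually_mem_Ioo] with ε hε t _
  rw [Real.rpow_neg hε.1.le, one_mul]

section Smoothed

variable {φ : ℝ → ℝ} {α ε t : ℝ} {Y : ℝ → ℝ → (ℝ →ᵇ ℝ)}

lemma continuous_smoothed (hφ : IsTest φ) (hε : ε ∈ Ioo (0 : ℝ) 1) (t : ℝ) :
    Continuous (smoothed φ α Y ε t) :=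
  continuous_mollify hφ (rpow_scale_pos hε α) (Y ε t).continuous.locallyIntegrable

lemma hasDerivAt_smoothed (hφ : IsTest φ) (hε : ε ∈ Ioo (0 : ℝ) 1) (t x : ℝ) :
    HasDerivAt (smoothed φ α Y ε t) ((ε ^ α)⁻¹ * smoothed (deriv φ) α Y ε t x) x :=
  hasDerivAt_mollify hφ (rpow_scale_pos hε α) (Y ε t).continuous.locallyIntegrable x

lemma deriv_smoothed (hφ : IsTest φ) (hε : ε ∈ Ioo (0 : ℝ) 1) (t : ℝ) :
    deriv (smoothed φ α Y ε t) = fun x => (ε ^ α)⁻¹ * smoothed (deriv φ) α Y ε t x :=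
  funext fun x => (hasDerivAt_smoothed hφ hε t x).deriv

lemma continuous_deriv_smoothed (hφ : IsTest φ) (hε : ε ∈ Ioo (0 : ℝ) 1) (t : ℝ) :
    Continuous (deriv (smoothed φ α Y ε t)) := by
  rw [deriv_smoothed hφ hε]
  exact continuous_const.mul (continuous_smoothed hφ.deriv hε t)

lemma smoothed_periodic (h : Function.Periodic (Y ε t) (2 * Real.pi)) :
    Function.Periodic (smoothed φ α Y ε t) (2 * Real.pi) :=
  mollify_periodic φ _ h

/-- Bounds for a smoothed function by the `L¹` norm over a period. -/
lemma exists_smoothed_bounds (hφ : IsTest φ) : ∃ C : ℝ, 0 ≤ C ∧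
    ∀ (α : ℝ) (Y : ℝ → ℝ → (ℝ →ᵇ ℝ)) (ε t : ℝ), 0 < α → ε ∈ Ioo (0 : ℝ) 1 →
    Function.Periodic (Y ε t) (2 * Real.pi) →
    (∀ x, |smoothed φ α Y ε t x| ≤ C * ((ε ^ α)⁻¹ * periodL1 (Y ε t))) ∧
    periodL1 (smoothed φ α Y ε t) ≤ C * periodL1 (Y ε t) ∧
    periodL1 (deriv (smoothed φ α Y ε t)) ≤ C * ((ε ^ α)⁻¹ * periodL1 (Y ε t)) := by
  obtain ⟨C₁, hC₁0, hC₁⟩ := exists_mollify_sup_bound hφ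
  set C₂ := ∫ z, |φ z|
  set C₃ := ∫ z, |deriv φ z|
  have hC₂0 : 0 ≤ C₂ := integral_nonneg fun _ => abs_nonneg _
  have hC₃0 : 0 ≤ C₃ := integral_nonneg fun _ => abs_nonneg _
  refine ⟨C₁ + C₂ + C₃, by positivity, fun α Y ε t hα hε hp => ?_⟩
  have hδ := rpow_scale_pos hε α
  have hN := periodL1_nonneg (Y ε t)
  refine ⟨fun x => ?_, ?_, ?_⟩
  · refine (hC₁ _ _ hδ (rpow_scale_le_one hε hα) (Y ε t).continuous hp x).trans ?_
    rw [mul_assoc]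
    gcongr
    linarith
  · refine (periodL1_mollify_le hφ hδ (Y ε t).continuous hp).trans ?_
    gcongr
    linarith
  · rw [deriv_smoothed hφ hε, periodL1_const_mul, abs_of_pos (inv_pos.2 hδ)]
    calc _ ≤ (ε ^ α)⁻¹ * (C₃ * periodL1 (Y ε t)) := by
          gcongr
          exact periodL1_mollify_le hφ.deriv hδ (Y ε t).continuous hp
      _ = C₃ * ((ε ^ α)⁻¹ * periodL1 (Y ε t)) := by ring
      _ ≤ _ := by gcongr; linarith

lemma isPowBounded_inv_scale_mul {T a : ℝ}
    (h : IsPowBounded T a fun ε t => periodL1 (Y ε t)) :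
    IsPowBounded T (α + a) fun ε t => (ε ^ α)⁻¹ * periodL1 (Y ε t) :=
  (isPowBounded_inv_rpow α).mul h fun _ _ _ _ => periodL1_nonneg _

lemma inv_scale_mul_nonneg (hε : ε ∈ Ioo (0 : ℝ) 1) :
    0 ≤ (ε ^ α)⁻¹ * periodL1 (Y ε t) :=
  mul_nonneg (inv_nonneg.2 (rpow_scale_pos hε α).le) (periodL1_nonneg _)

end Smoothed

/-! ### The system with four components -/

section Four

variable {φ u₀ v₀ w₀ Z₀ : ℝ → ℝ} {n : ℕ} {α β γ : ℝ} {u : ℝ → ℝ → ℝ → ℝ}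
  {v₀ε w₀ε Z₀ε : ℝ → ℝ → ℝ} {X w Z : ℝ → ℝ → (ℝ →ᵇ ℝ)}

lemma deriv_smoothed_pow (hφ : IsTest φ) {ε : ℝ} (hε : ε ∈ Ioo (0 : ℝ) 1) (n : ℕ) (t x : ℝ) :
    deriv (fun y => smoothed φ α X ε t y ^ n) x =
      n * smoothed φ α X ε t x ^ (n - 1) * ((ε ^ α)⁻¹ * smoothed (deriv φ) α X ε t x) :=
  ((hasDerivAt_smoothed hφ hε t x).pow n).deriv

lemma deriv_mollify_smoothed_mul (hφ : IsTest φ) {ε : ℝ} (hε : ε ∈ Ioo (0 : ℝ) 1) (t x : ℝ) :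
    deriv (mollify φ (ε ^ γ) (fun y => smoothed φ α X ε t y * w ε t y)) x =
      (ε ^ γ)⁻¹ * mollify (deriv φ) (ε ^ γ) (fun y => smoothed φ α X ε t y * w ε t y) x :=
  (hasDerivAt_mollify hφ (rpow_scale_pos hε γ)
    ((continuous_smoothed hφ hε t).mul (w ε t).continuous).locallyIntegrable x).deriv

/-- `X` drives `w`, and both drive `Z`. Once differentiated explicitly, each source is made of
bounded operators and products applied to solutions already found, hence is a continuous curve in
the sup norm. -/
theorem exists_fourConstruction (hφ : IsTest φ) (hu : IsVelocityFamily β u₀ u)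
    (hv : IsRegularization v₀ v₀ε) (hw : IsRegularization w₀ w₀ε) (hZ : IsRegularization Z₀ Z₀ε)
    (n : ℕ) (α γ : ℝ) :
    ∃ X w Z : ℝ → ℝ → (ℝ →ᵇ ℝ), IsFourConstruction φ n α γ u v₀ε w₀ε Z₀ε X w Z := by
  obtain ⟨M, hM⟩ := hu.exists_isBoundedVelocity
  have hX : ∀ ε ∈ Ioo (0 : ℝ) 1, ∃ X : ℝ → (ℝ →ᵇ ℝ),
      IsTransportSolution ε (u ε) (fun _ _ => 0) (v₀ε ε) X := fun ε hε =>
    exists_transportSolution (b := fun _ => 0) hε.1 (hM ε hε) continuousOn_const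
      (fun _ _ _ => rfl) (fun _ _ _ => rfl) (hv.continuous ε hε) (hv.periodic ε hε)
  choose! X hX using hX
  have hw' : ∀ ε ∈ Ioo (0 : ℝ) 1, ∃ w : ℝ → (ℝ →ᵇ ℝ), IsTransportSolution ε (u ε)
      (fun t x => 2 * deriv (fun y => smoothed φ α X ε t y ^ n) x) (w₀ε ε) w := fun ε hε => by
    have hδ := rpow_scale_pos hε α
    have hXc := (hX ε hε).continuousOn
    have h1 : ContinuousOn (fun t => mollifyL hφ hδ (X ε t)) (Ici 0) :=
      (mollifyL hφ hδ).continuous.comp_continuousOn hXc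
    have h2 : ContinuousOn (fun t => mollifyL hφ.deriv hδ (X ε t)) (Ici 0) :=
      (mollifyL hφ.deriv hδ).continuous.comp_continuousOn hXc
    -- The truncated exponent `n - 1` does no harm at `n = 0`, thanks to the factor `n`.
    refine exists_transportSolution (b := fun t => (2 * n * (ε ^ α)⁻¹ : ℝ) •
        (mollifyL hφ hδ (X ε t) ^ (n - 1) * mollifyL hφ.deriv hδ (X ε t))) hε.1 (hM ε hε)
      (((h1.fun_pow (n - 1)).fun_mul h2).fun_const_smul _) (fun t ht x => ?_) (fun t ht x => ?_)
      (hw.continuous ε hε) (hw.periodic ε hε)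
    · have hp := (hX ε hε).periodic t ht
      simp only [BoundedContinuousFunction.coe_smul, BoundedContinuousFunction.coe_mul,
        BoundedContinuousFunction.coe_pow, Pi.mul_apply, Pi.pow_apply, mollifyL_apply,
        mollify_periodic _ _ hp x]
    · rw [deriv_smoothed_pow hφ hε]
      simp only [BoundedContinuousFunction.coe_smul, BoundedContinuousFunction.coe_mul,
        BoundedContinuousFunction.coe_pow, Pi.mul_apply, Pi.pow_apply, mollifyL_apply,
        smul_eq_mul, smoothed]
      ring
  choose! w hw' using hw'
  have hZ' : ∀ ε ∈ Ioo (0 : ℝ) 1, ∃ Z : ℝ → (ℝ →ᵇ ℝ), IsTransportSolution ε (u ε)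
      (fun t x => 6 * deriv (mollify φ (ε ^ γ) (fun y => smoothed φ α X ε t y * w ε t y)) x)
      (Z₀ε ε) Z := fun ε hε => by
    have hδ := rpow_scale_pos hε α
    have hη := rpow_scale_pos hε γ
    have h1 : ContinuousOn (fun t => mollifyL hφ hδ (X ε t)) (Ici 0) :=
      (mollifyL hφ hδ).continuous.comp_continuousOn (hX ε hε).continuousOn
    refine exists_transportSolution (b := fun t => (6 * (ε ^ γ)⁻¹ : ℝ) •
        mollifyL hφ.deriv hη (mollifyL hφ hδ (X ε t) * w ε t)) hε.1 (hM ε hε)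
      (((mollifyL hφ.deriv hη).continuous.comp_continuousOn
        (h1.fun_mul (hw' ε hε).continuousOn)).fun_const_smul _) (fun t ht x => ?_) (fun t ht x => ?_)
      (hZ.continuous ε hε) (hZ.periodic ε hε)
    · have hp : Function.Periodic (mollifyL hφ hδ (X ε t) * w ε t) (2 * Real.pi) :=
        (mollify_periodic φ (ε ^ α) ((hX ε hε).periodic t ht)).mul ((hw' ε hε).periodic t ht)
      simp only [BoundedContinuousFunction.coe_smul, mollifyL_apply, mollify_periodic _ _ hp x]
    · rw [deriv_mollify_smoothed_mul hφ hε]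
      simp only [BoundedContinuousFunction.coe_smul, mollifyL_apply, smul_eq_mul, ← mul_assoc]
      rfl
  choose! Z hZ' using hZ'
  exact ⟨X, w, Z, hX, hw', hZ'⟩

theorem fourConstruction_unique (hu : IsVelocityFamily β u₀ u)
    {X' w' Z' : ℝ → ℝ → (ℝ →ᵇ ℝ)} (h : IsFourConstruction φ n α γ u v₀ε w₀ε Z₀ε X w Z)
    (h' : IsFourConstruction φ n α γ u v₀ε w₀ε Z₀ε X' w' Z') (ε : ℝ) (hε : ε ∈ Ioo (0 : ℝ) 1)
    (t : ℝ) (ht : 0 ≤ t) : X ε t = X' ε t ∧ w ε t = w' ε t ∧ Z ε t = Z' ε t := by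
  obtain ⟨M, hM⟩ := hu.exists_isBoundedVelocity
  have hX : ∀ t, 0 ≤ t → X ε t = X' ε t :=
    (h.X_eq ε hε).unique hε.1 (hM ε hε) (fun _ _ _ => rfl) (h'.X_eq ε hε)
  have hv : ∀ t, 0 ≤ t → smoothed φ α X ε t = smoothed φ α X' ε t := fun t ht => by
    funext x
    simp only [smoothed, hX t ht]
  have hw : ∀ t, 0 ≤ t → w ε t = w' ε t :=
    (h.w_eq ε hε).unique hε.1 (hM ε hε) (fun t ht x => by rw [hv t ht]) (h'.w_eq ε hε)
  have hZ : ∀ t, 0 ≤ t → Z ε t = Z' ε t :=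
    (h.Z_eq ε hε).unique hε.1 (hM ε hε) (fun t ht x => by rw [hv t ht, hw t ht]) (h'.Z_eq ε hε)
  exact ⟨hX t ht, hw t ht, hZ t ht⟩

lemma periodL1_zero : periodL1 (fun _ => 0) = 0 := by simp [periodL1]

lemma isPowBounded_zero (T a : ℝ) : IsPowBounded T a fun _ _ => 0 :=
  ⟨0, le_rfl, Eventually.of_forall fun ε t _ => by simp⟩

/-- Bookkeeping of exponents. `‖X‖₁` is bounded, so `sup |v|` and `‖∂ₓv‖₁` are `O(ε^(-α))`. Then
`‖∂ₓ(vⁿ)‖₁`, and with it `‖w‖₁`, is `O(ε^(-nα))`, so `‖vw‖₁` is `O(ε^(-(n+1)α))`. Since `w` is not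
mollified, its product with `v` is mollified at scale `ε^γ` before being differentiated, which gives
`‖Z‖₁ = O(ε^(-γ-(n+1)α))`. The requirements are that this last exponent stay below 1 and that `γ >
(n+1)α`, so that mollifying `vw` is negligible. -/
theorem isWeakAsymptoticFour (hφ : IsMollifier φ) (hu : IsVelocityFamily β u₀ u) (hβ : 0 < β)
    (hα : β < α) (hγ : (n + 2) * α < γ) (hγ1 : 2 * γ + (n + 2) * α < 1)
    (hv₀ : IsRegularization v₀ v₀ε) (hw₀ : IsRegularization w₀ w₀ε) (hZ₀ : IsRegularization Z₀ Z₀ε)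
    (h : IsFourConstruction φ n α γ u v₀ε w₀ε Z₀ε X w Z) :
    IsWeakAsymptoticFour n u (smoothed φ α X) (fun ε t x => w ε t x) (fun ε t x => Z ε t x)
      u₀ v₀ w₀ Z₀ := by
  have hα0 : 0 < α := hβ.trans hα
  have hnα : 0 ≤ (n : ℝ) * α := by positivity
  have hγ0 : 0 < γ := by nlinarith
  obtain ⟨C, hC0, hC⟩ := exists_smoothed_bounds hφ.1
  have hXp : ∀ ε ∈ Ioo (0 : ℝ) 1, ∀ t, 0 ≤ t → Function.Periodic (X ε t) (2 * Real.pi) :=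
    fun ε hε => (h.X_eq ε hε).periodic
  have hwp : ∀ ε ∈ Ioo (0 : ℝ) 1, ∀ t, 0 ≤ t → Function.Periodic (w ε t) (2 * Real.pi) :=
    fun ε hε => (h.w_eq ε hε).periodic
  have hvc : ∀ ε ∈ Ioo (0 : ℝ) 1, ∀ t, Continuous (smoothed φ α X ε t) :=
    fun ε hε t => continuous_smoothed hφ.1 hε t
  have hX1 : ∀ T, IsPowBounded T 0 fun ε t => periodL1 (X ε t) := fun T =>
    isPowBounded_periodL1_solution hu hv₀ h.X_eq le_rfl (by
      simp only [periodL1_zero]; exact isPowBounded_zero T 0)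
  have hsup : ∀ T, IsPowBounded T α fun ε t => (ε ^ α)⁻¹ * periodL1 (X ε t) := fun T => by
    simpa using isPowBounded_inv_scale_mul (α := α) (hX1 T)
  have hsw : ∀ ε ∈ Ioo (0 : ℝ) 1, IsTransportSolution ε (u ε)
      (fun t x => deriv (fun y => 2 * smoothed φ α X ε t y ^ n) x) (w₀ε ε) (w ε) := fun ε hε => by
    have := h.w_eq ε hε
    simpa only [deriv_const_mul_field] using this
  have hw1 : ∀ T, IsPowBounded T (n * α) fun ε t => periodL1 (w ε t) := fun T => by
    refine isPowBounded_periodL1_solution hu hw₀ h.w_eq hnα ?_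
    -- In `∂ₓ(vⁿ)`, `n - 1` factors are taken in sup norm and `∂ₓv` in `L¹`, each at most `C * K`
    -- with `K` below. The leading 2 is the coefficient of the source.
    refine (((hsup T).pow (fun ε hε t _ => inv_scale_mul_nonneg hε) n)).of_le
      (c := 2 * (n * C ^ n)) (by positivity) fun ε hε t ht => ?_
    obtain ⟨b1, -, b3⟩ := hC α X ε t hα0 hε (hXp ε hε t ht.1)
    rw [periodL1_const_mul, abs_two, mul_assoc]
    refine mul_le_mul_of_nonneg_left ?_ zero_le_two
    set K := (ε ^ α)⁻¹ * periodL1 (X ε t) with hK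
    have hK0 : 0 ≤ K := inv_scale_mul_nonneg hε
    -- At `n = 0` the identity `(n - 1) + 1 = n` fails, but the source vanishes.
    rcases n.eq_zero_or_pos with rfl | hn
    · simp [periodL1_zero]
    have e : deriv (fun y => smoothed φ α X ε t y ^ n) = fun x =>
        (n * smoothed φ α X ε t x ^ (n - 1)) * deriv (smoothed φ α X ε t) x := by
      funext x
      rw [deriv_smoothed_pow hφ.1 hε, deriv_smoothed hφ.1 hε]
    rw [e]
    refine (periodL1_mul_le (f := fun x => n * smoothed φ α X ε t x ^ (n - 1))
      (B := n * (C * K) ^ (n - 1))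
      (continuous_const.mul ((hvc ε hε t).pow _)) (continuous_deriv_smoothed hφ.1 hε t)
      fun x => ?_).trans ?_
    · rw [abs_mul, abs_pow, Nat.abs_cast]
      gcongr
      exact b1 x
    · calc _ ≤ n * (C * K) ^ (n - 1) * (C * K) := by gcongr
        _ = n * (C * K) ^ n := by rw [mul_assoc, ← pow_succ, Nat.sub_add_cancel hn]
        _ = _ := by rw [mul_pow, mul_assoc]
  have hvw : ∀ T, IsPowBounded T (α + n * α) fun ε t =>
      periodL1 (fun y => smoothed φ α X ε t y * w ε t y) := fun T => by
    refine ((hsup T).mul (hw1 T) fun _ _ _ _ => periodL1_nonneg _).of_le hC0 fun ε hε t ht => ?_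
    refine (periodL1_mul_le (hvc ε hε t) (w ε t).continuous
      (hC α X ε t hα0 hε (hXp ε hε t ht.1)).1).trans_eq ?_
    ring
  have hvwp : ∀ ε ∈ Ioo (0 : ℝ) 1, ∀ t, 0 ≤ t →
      Function.Periodic (fun y => smoothed φ α X ε t y * w ε t y) (2 * Real.pi) :=
    fun ε hε t ht => (smoothed_periodic (hXp ε hε t ht)).mul (hwp ε hε t ht)
  have hvwc : ∀ ε ∈ Ioo (0 : ℝ) 1, ∀ t, Continuous fun y => smoothed φ α X ε t y * w ε t y :=
    fun ε hε t => (hvc ε hε t).mul (w ε t).continuous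
  have hsZ : ∀ ε ∈ Ioo (0 : ℝ) 1, IsTransportSolution ε (u ε)
      (fun t x => deriv (fun z => 6 * mollify φ (ε ^ γ)
        (fun y => smoothed φ α X ε t y * w ε t y) z) x) (Z₀ε ε) (Z ε) := fun ε hε => by
    have := h.Z_eq ε hε
    simpa only [deriv_const_mul_field] using this
  have hZ1 : ∀ T, IsPowBounded T (γ + (α + n * α)) fun ε t => periodL1 (Z ε t) := fun T => by
    refine isPowBounded_periodL1_solution hu hZ₀ h.Z_eq (by positivity) ?_
    set I := ∫ z, |deriv φ z| with hI
    have hI0 : 0 ≤ I := integral_nonneg fun _ => abs_nonneg _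
    refine ((isPowBounded_inv_rpow γ).mul (hvw T) fun _ _ _ _ => periodL1_nonneg _).of_le
      (c := 6 * I) (by positivity) fun ε hε t ht => ?_
    have hη := rpow_scale_pos hε γ
    simp_rw [deriv_mollify_smoothed_mul hφ.1 hε]
    rw [periodL1_const_mul, periodL1_const_mul, abs_of_pos (inv_pos.2 hη),
      abs_of_pos (by norm_num : (0 : ℝ) < 6)]
    calc _ ≤ 6 * ((ε ^ γ)⁻¹ * (I * periodL1 fun y => smoothed φ α X ε t y * w ε t y)) := by
          gcongr
          exact periodL1_mollify_le hφ.1.deriv hη (hvwc ε hε t) (hvwp ε hε t ht.1)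
      _ = _ := by ring
  refine ⟨hu.weak, ?_, ?_, ?_⟩
  · refine isWeakAsymptotic_smoothed (s := fun _ _ _ => 0) (a := 0) (b := 0) hφ hu hv₀
      (fun ε hε => by simpa using h.X_eq ε hε) (fun _ _ _ _ => differentiable_const 0)
      (fun _ _ _ _ _ => rfl) (fun _ _ _ _ _ => (add_zero _).symm) hX1 (fun T => ?_) hα0 one_pos
      (by linarith) hα0
    simp only [periodL1_zero]
    exact isPowBounded_zero T 0
  -- The flux `vⁿ` enters the scheme unmollified, so `s = r`, and `-1` stands for any negative
  -- exponent.
  · refine isWeakAsymptotic_transport (r := fun ε t x => 2 * smoothed φ α X ε t x ^ n) hu hw₀ hsw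
      (fun ε hε t ht => ?_) (fun ε hε t ht => ?_) (fun _ _ _ _ _ => rfl) hw1 (by nlinarith)
      (b := -1) (by norm_num) fun ψ hψ T => ?_
    · exact fun x => ((hasDerivAt_smoothed hφ.1 hε t x).differentiableAt.pow n).const_mul 2
    · exact continuous_const.mul ((hvc ε hε t).pow n)
    · simpa using isPowBounded_zero T (-1)
  -- The scheme contains the mollified product and the system the product itself; after pairing they
  -- differ by `O(ε^(γ-(n+1)α))`.
  · refine isWeakAsymptotic_transport
      (r := fun ε t x => 6 * (smoothed φ α X ε t x * w ε t x)) hu hZ₀ hsZ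
      (fun ε hε t ht => ?_) (fun ε hε t ht => ?_) (fun _ _ _ _ _ => rfl) hZ1 (by nlinarith)
      (b := -γ + (α + n * α)) (by nlinarith) fun ψ hψ T => ?_
    · exact fun x => ((hasDerivAt_mollify hφ.1 (rpow_scale_pos hε γ)
        (hvwc ε hε t).locallyIntegrable x).differentiableAt).const_mul 6
    · exact continuous_const.mul (hvwc ε hε t)
    · obtain ⟨C', hC0', hC'⟩ := exists_mollify_pairing_bound hφ hψ.deriv
      refine ((isPowBounded_rpow γ).mul (hvw T) fun _ _ _ _ => periodL1_nonneg _).of_le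
        (c := 6 * C') (by positivity) fun ε hε t ht => ?_
      have hη := rpow_scale_pos hε γ
      have hb := hC' _ _ hη (rpow_scale_le_one hε hγ0) (hvwc ε hε t).locallyIntegrable
        (hvwp ε hε t ht.1)
      have i1 := integrable_mul_test
        (continuous_mollify hφ.1 hη (hvwc ε hε t).locallyIntegrable) hψ.deriv
      have i2 := integrable_mul_test (hvwc ε hε t) hψ.deriv
      simp_rw [← mul_sub, mul_assoc (6 : ℝ), sub_mul]
      rw [integral_const_mul, integral_sub i1 i2, abs_mul, abs_of_pos (by norm_num : (0 : ℝ) < 6)]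
      refine mul_le_mul_of_nonneg_left (hb.trans_eq ?_) (by norm_num)
      ring

end Four

/-! ### The hierarchy -/

section Hierarchy

variable {φ u₀ : ℝ → ℝ} {p : ℕ} {α : ℕ → ℝ} {β : ℝ} {u : ℝ → ℝ → ℝ → ℝ}
  {g : ℕ → ℝ → ℝ} {gε : ℕ → ℝ → ℝ → ℝ} {X : ℕ → ℝ → ℝ → (ℝ →ᵇ ℝ)}

/-- The pairs of indices occurring in the source of the `k`-th equation. -/
def sourcePairs (k : ℕ) : Finset (ℕ × ℕ) :=
  (Finset.HasAntidiagonal.antidiagonal k).filter (fun q => 1 ≤ q.1 ∧ 1 ≤ q.2)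

lemma mem_sourcePairs {k : ℕ} {q : ℕ × ℕ} :
    q ∈ sourcePairs k ↔ q.1 + q.2 = k ∧ 1 ≤ q.1 ∧ 1 ≤ q.2 := by
  simp [sourcePairs, Finset.mem_filter]

lemma hierarchyFamily_of_pos {k : ℕ} (hk : 1 ≤ k) :
    hierarchyFamily φ α u X k = smoothed φ (α k) (X k) := by
  simp [hierarchyFamily, show k ≠ 0 by omega]

lemma hierarchySource_eq (k : ℕ) (ε t x : ℝ) :
    hierarchySource (hierarchyFamily φ α u X) k ε t x =
      ∑ q ∈ sourcePairs k, (k.choose q.1 : ℝ) *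
        (smoothed φ (α q.1) (X q.1) ε t x * smoothed φ (α q.2) (X q.2) ε t x) := by
  refine Finset.sum_congr rfl fun q hq => ?_
  obtain ⟨-, h1, h2⟩ := mem_sourcePairs.1 hq
  rw [hierarchyFamily_of_pos h1, hierarchyFamily_of_pos h2]

/-- The pairs `(0, k)` and `(k, 0)`, distinct because `k ≥ 1`, carry the binomial coefficient 1 and
produce the transport term. -/
lemma hierarchyFlux_eq {k : ℕ} (hk : 1 ≤ k) (ε t x : ℝ) :
    hierarchyFlux (hierarchyFamily φ α u X) k ε t x =
      2 * (u ε t x * smoothed φ (α k) (X k) ε t x) +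
        hierarchySource (hierarchyFamily φ α u X) k ε t x := by
  unfold hierarchyFlux hierarchySource
  rw [← Finset.sum_filter_add_sum_filter_not _ (fun q : ℕ × ℕ => 1 ≤ q.1 ∧ 1 ≤ q.2), add_comm]
  congr 1
  have h : (Finset.HasAntidiagonal.antidiagonal k).filter
      (fun q : ℕ × ℕ => ¬(1 ≤ q.1 ∧ 1 ≤ q.2)) = {(0, k), (k, 0)} := by
    ext ⟨i, j⟩
    simp only [Finset.mem_filter, Finset.HasAntidiagonal.mem_antidiagonal, Finset.mem_insert,
      Finset.mem_singleton, Prod.mk.injEq]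
    omega
  have hne : ((0, k) : ℕ × ℕ) ≠ (k, 0) := by
    simp only [ne_eq, Prod.mk.injEq]
    omega
  rw [h, Finset.sum_pair hne, ← hierarchyFamily_of_pos (φ := φ) (u := u) hk]
  simp only [Nat.choose_zero_right, Nat.choose_self, Nat.cast_one, one_mul]
  rw [show hierarchyFamily φ α u X 0 = u from if_pos rfl]
  ring

lemma hasDerivAt_hierarchySource (hφ : IsTest φ) {ε : ℝ} (hε : ε ∈ Ioo (0 : ℝ) 1) (k : ℕ)
    (t x : ℝ) :
    HasDerivAt (hierarchySource (hierarchyFamily φ α u X) k ε t)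
      (∑ q ∈ sourcePairs k, (k.choose q.1 : ℝ) *
        (deriv (smoothed φ (α q.1) (X q.1) ε t) x * smoothed φ (α q.2) (X q.2) ε t x +
          smoothed φ (α q.1) (X q.1) ε t x * deriv (smoothed φ (α q.2) (X q.2) ε t) x)) x := by
  rw [show hierarchySource (hierarchyFamily φ α u X) k ε t = fun x =>
      ∑ q ∈ sourcePairs k, (k.choose q.1 : ℝ) *
        (smoothed φ (α q.1) (X q.1) ε t x * smoothed φ (α q.2) (X q.2) ε t x) from
    funext (hierarchySource_eq k ε t)]
  refine HasDerivAt.fun_sum fun q _ => HasDerivAt.const_mul _ ?_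
  exact (hasDerivAt_smoothed hφ hε t x).differentiableAt.hasDerivAt.mul
    (hasDerivAt_smoothed hφ hε t x).differentiableAt.hasDerivAt

/-- Both indices of a source pair lie strictly between 0 and `k`. This makes the hierarchy
triangular. -/
lemma hierarchySource_congr {X' : ℕ → ℝ → ℝ → (ℝ →ᵇ ℝ)} {k : ℕ} {ε t : ℝ}
    (h : ∀ i ∈ Ico 1 k, X i ε t = X' i ε t) :
    hierarchySource (hierarchyFamily φ α u X) k ε t =
      hierarchySource (hierarchyFamily φ α u X') k ε t := by
  funext x
  rw [hierarchySource_eq, hierarchySource_eq]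
  refine Finset.sum_congr rfl fun q hq => ?_
  obtain ⟨h0, h1, h2⟩ := mem_sourcePairs.1 hq
  simp only [smoothed, h q.1 ⟨h1, by omega⟩, h q.2 ⟨h2, by omega⟩]

theorem exists_hierarchyConstruction (hφ : IsTest φ) (hu : IsVelocityFamily β u₀ u) (α : ℕ → ℝ)
    (hg : ∀ k ∈ Icc 1 (p + 1), IsRegularization (g k) (gε k)) :
    ∃ X : ℕ → ℝ → ℝ → (ℝ →ᵇ ℝ), IsHierarchyConstruction φ p α u gε X := by
  obtain ⟨M, hM⟩ := hu.exists_isBoundedVelocity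
  -- Induction on the number `m` of equations already solved.
  suffices h : ∀ m ≤ p + 1, ∃ X : ℕ → ℝ → ℝ → (ℝ →ᵇ ℝ), ∀ k ∈ Icc 1 m,
      ∀ ε ∈ Ioo (0 : ℝ) 1, IsTransportSolution ε (u ε)
        (fun t x => deriv (hierarchySource (hierarchyFamily φ α u X) k ε t) x) (gε k ε) (X k ε) from
    h (p + 1) le_rfl
  intro m
  induction m with
  | zero => exact fun _ => ⟨fun _ _ _ => 0, fun k hk => absurd (hk.1.trans hk.2) (by norm_num)⟩
  | succ m ih =>
    intro hm
    obtain ⟨X, hX⟩ := ih (by omega)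
    have hY : ∀ ε ∈ Ioo (0 : ℝ) 1, ∃ Y : ℝ → (ℝ →ᵇ ℝ), IsTransportSolution ε (u ε)
        (fun t x => deriv (hierarchySource (hierarchyFamily φ α u X) (m + 1) ε t) x)
        (gε (m + 1) ε) Y := fun ε hε => by
      have hg' := hg (m + 1) ⟨by omega, hm⟩
      have hδ : ∀ i, 0 < ε ^ α i := fun i => rpow_scale_pos hε (α i)
      have hmem : ∀ q ∈ sourcePairs (m + 1), q.1 ∈ Icc 1 m ∧ q.2 ∈ Icc 1 m := fun q hq => by
        obtain ⟨h0, h1, h2⟩ := mem_sourcePairs.1 hq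
        exact ⟨⟨h1, by omega⟩, ⟨h2, by omega⟩⟩
      have hc : ∀ i ∈ Icc 1 m, ContinuousOn (fun t => mollifyL hφ (hδ i) (X i ε t)) (Ici 0) :=
        fun i hi => (mollifyL hφ (hδ i)).continuous.comp_continuousOn (hX i hi ε hε).continuousOn
      have hc' : ∀ i ∈ Icc 1 m, ContinuousOn
          (fun t => (ε ^ α i)⁻¹ • mollifyL hφ.deriv (hδ i) (X i ε t)) (Ici 0) := fun i hi =>
        ((mollifyL hφ.deriv (hδ i)).continuous.comp_continuousOn
          (hX i hi ε hε).continuousOn).fun_const_smul _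
      let b : ℝ → (ℝ →ᵇ ℝ) := fun t => ∑ q ∈ sourcePairs (m + 1), ((m + 1).choose q.1 : ℝ) •
        (((ε ^ α q.1)⁻¹ • mollifyL hφ.deriv (hδ q.1) (X q.1 ε t)) *
            mollifyL hφ (hδ q.2) (X q.2 ε t) +
          mollifyL hφ (hδ q.1) (X q.1 ε t) *
            ((ε ^ α q.2)⁻¹ • mollifyL hφ.deriv (hδ q.2) (X q.2 ε t)))
      have hb : ∀ t x, b t x = ∑ q ∈ sourcePairs (m + 1), ((m + 1).choose q.1 : ℝ) *
          ((ε ^ α q.1)⁻¹ * mollify (deriv φ) (ε ^ α q.1) (X q.1 ε t) x *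
              mollify φ (ε ^ α q.2) (X q.2 ε t) x +
            mollify φ (ε ^ α q.1) (X q.1 ε t) x *
              ((ε ^ α q.2)⁻¹ * mollify (deriv φ) (ε ^ α q.2) (X q.2 ε t) x)) := fun t x => by
        simp only [b, BoundedContinuousFunction.coe_sum, Finset.sum_apply,
          BoundedContinuousFunction.coe_smul, BoundedContinuousFunction.coe_add,
          BoundedContinuousFunction.coe_mul, Pi.add_apply, Pi.mul_apply, mollifyL_apply,
          smul_eq_mul]
      refine exists_transportSolution (b := b) hε.1 (hM ε hε) ?_ (fun t ht x => ?_)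
        (fun t ht x => ?_) (hg'.continuous ε hε) (hg'.periodic ε hε)
      · exact continuousOn_finsetSum _ fun q hq =>
          (((hc' _ (hmem q hq).1).fun_mul (hc _ (hmem q hq).2)).fun_add
            ((hc _ (hmem q hq).1).fun_mul (hc' _ (hmem q hq).2))).fun_const_smul _
      · rw [hb, hb]
        refine Finset.sum_congr rfl fun q hq => ?_
        have h1 := (hX _ (hmem q hq).1 ε hε).periodic t ht
        have h2 := (hX _ (hmem q hq).2 ε hε).periodic t ht
        simp only [mollify_periodic _ _ h1 x, mollify_periodic _ _ h2 x]
      · rw [(hasDerivAt_hierarchySource hφ hε (m + 1) t x).deriv, hb]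
        simp only [deriv_smoothed hφ hε]
        rfl
    choose! Y hY using hY
    -- Overwriting component `m + 1` leaves the sources of the equations up to `m + 1` unchanged, as
    -- these read smaller indices only.
    refine ⟨Function.update X (m + 1) Y, fun k hk ε hε => ?_⟩
    have hsrc : ∀ t, hierarchySource (hierarchyFamily φ α u (Function.update X (m + 1) Y)) k ε t =
        hierarchySource (hierarchyFamily φ α u X) k ε t := fun t =>
      hierarchySource_congr fun i hi => by
        rw [Function.update_of_ne]
        have := hi.2
        have := hk.2
        omega
    simp only [hsrc]
    rcases eq_or_ne k (m + 1) with rfl | hne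
    · rw [Function.update_self]
      exact hY ε hε
    · rw [Function.update_of_ne hne]
      have := hk.2
      exact hX k ⟨hk.1, by omega⟩ ε hε

theorem hierarchyConstruction_unique (hu : IsVelocityFamily β u₀ u)
    {X' : ℕ → ℝ → ℝ → (ℝ →ᵇ ℝ)} (h : IsHierarchyConstruction φ p α u gε X)
    (h' : IsHierarchyConstruction φ p α u gε X') (k : ℕ) (hk : k ∈ Icc 1 (p + 1)) (ε : ℝ)
    (hε : ε ∈ Ioo (0 : ℝ) 1) (t : ℝ) (ht : 0 ≤ t) : X k ε t = X' k ε t := by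
  obtain ⟨M, hM⟩ := hu.exists_isBoundedVelocity
  induction k using Nat.strong_induction_on generalizing t with
  | _ k ih =>
    refine (h k hk ε hε).unique hε.1 (hM ε hε) (fun τ hτ x => ?_) (h' k hk ε hε) t ht
    rw [hierarchySource_congr fun i hi =>
      ih i hi.2 ⟨hi.1, hi.2.le.trans hk.2⟩ τ hτ]

lemma scale_pos (h5 : ∀ k ∈ Icc 1 p, 5 * α k ≤ α (k + 1)) (h0 : 0 < α 1) {k : ℕ}
    (hk : k ∈ Icc 1 (p + 1)) : 0 < α k := by
  obtain ⟨hk1, hkp⟩ := hk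
  induction k, hk1 using Nat.le_induction with
  | base => exact h0
  | succ k hk1 ih => linarith [ih (by omega), h5 k ⟨hk1, by omega⟩]

lemma five_mul_scale_le (h5 : ∀ k ∈ Icc 1 p, 5 * α k ≤ α (k + 1)) (h0 : 0 < α 1) {i k : ℕ}
    (hi : 1 ≤ i) (hik : i < k) (hk : k ≤ p + 1) : 5 * α i ≤ α k := by
  induction k, (Nat.succ_le_of_lt hik) using Nat.le_induction with
  | base => exact h5 i ⟨hi, by omega⟩
  | succ k hk1 ih =>
    have h1 := ih (by omega) (by omega)
    have h2 := h5 k ⟨by omega, by omega⟩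
    have h3 := scale_pos h5 h0 (k := k) ⟨by omega, by omega⟩
    linarith

/-- The invariant is `‖X_k‖₁ = O(ε^(-2α_k/3))`. For `i + j = k` with `i, j ≥ 1`, differentiating
`U_i U_j` costs `α_i + α_j` on top of the growth of the factors, altogether `(5/3)(α_i + α_j)`.
Since `α_i` and `α_j` are at most `α_k / 5`, this is at most `(2/3) α_k`, and the induction closes.
-/
theorem isWeakAsymptoticHierarchy (hφ : IsMollifier φ) (hu : IsVelocityFamily β u₀ u)
    (hβ : 0 < β) (hα : β < α 1) (h5 : ∀ k ∈ Icc 1 p, 5 * α k ≤ α (k + 1)) (hα1 : α (p + 1) < 1)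
    (hg0 : g 0 = u₀) (hg : ∀ k ∈ Icc 1 (p + 1), IsRegularization (g k) (gε k))
    (h : IsHierarchyConstruction φ p α u gε X) :
    IsWeakAsymptoticHierarchy p (hierarchyFamily φ α u X) g := by
  have h01 : 0 < α 1 := hβ.trans hα
  have hpos : ∀ k ∈ Icc 1 (p + 1), 0 < α k := fun k hk => scale_pos h5 h01 hk
  have hlt1 : ∀ k ∈ Icc 1 (p + 1), α k < 1 := fun k hk => by
    rcases hk.2.eq_or_lt with rfl | hlt
    · exact hα1
    · linarith [five_mul_scale_le h5 h01 hk.1 hlt le_rfl, hpos k hk]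
  obtain ⟨C, hC0, hC⟩ := exists_smoothed_bounds hφ.1
  have hXp : ∀ k ∈ Icc 1 (p + 1), ∀ ε ∈ Ioo (0 : ℝ) 1, ∀ t, 0 ≤ t →
      Function.Periodic (X k ε t) (2 * Real.pi) := fun k hk ε hε => (h k hk ε hε).periodic
  have hmem : ∀ k ∈ Icc 1 (p + 1), ∀ q ∈ sourcePairs k,
      (q.1 ∈ Icc 1 (p + 1) ∧ q.1 < k) ∧ (q.2 ∈ Icc 1 (p + 1) ∧ q.2 < k) := fun k hk q hq => by
    obtain ⟨e0, e1, e2⟩ := mem_sourcePairs.1 hq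
    have := hk.2
    exact ⟨⟨⟨e1, by omega⟩, by omega⟩, ⟨⟨e2, by omega⟩, by omega⟩⟩
  have hcont : ∀ i, ∀ ε ∈ Ioo (0 : ℝ) 1, ∀ t, Continuous (smoothed φ (α i) (X i) ε t) :=
    fun i ε hε t => continuous_smoothed hφ.1 hε t
  have hcont' : ∀ i, ∀ ε ∈ Ioo (0 : ℝ) 1, ∀ t,
      Continuous (deriv (smoothed φ (α i) (X i) ε t)) :=
    fun i ε hε t => continuous_deriv_smoothed hφ.1 hε t
  have hderiv : ∀ k, ∀ ε ∈ Ioo (0 : ℝ) 1, ∀ t,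
      (fun x => deriv (hierarchySource (hierarchyFamily φ α u X) k ε t) x) = fun x =>
        ∑ q ∈ sourcePairs k, (k.choose q.1 : ℝ) *
          (deriv (smoothed φ (α q.1) (X q.1) ε t) x * smoothed φ (α q.2) (X q.2) ε t x +
            smoothed φ (α q.1) (X q.1) ε t x * deriv (smoothed φ (α q.2) (X q.2) ε t) x) :=
    fun k ε hε t => funext fun x => (hasDerivAt_hierarchySource hφ.1 hε k t x).deriv
  have hgrow : ∀ k ∈ Icc 1 (p + 1), ∀ T,
      IsPowBounded T (2 / 3 * α k) fun ε t => periodL1 (X k ε t) := by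
    intro k
    induction k using Nat.strong_induction_on with
    | _ k ih =>
      intro hk T
      refine isPowBounded_periodL1_solution hu (hg k hk) (h k hk)
        (by have := hpos k hk; positivity) ?_
      -- In the constant, `2 ^ k` bounds the binomial coefficients and the inner 2 counts the terms
      -- of the product rule.
      refine (isPowBounded_sum (sourcePairs k)
        (N := fun q ε t => ((ε ^ α q.1)⁻¹ * periodL1 (X q.1 ε t)) *
          ((ε ^ α q.2)⁻¹ * periodL1 (X q.2 ε t))) fun q hq => ?_).of_le
        (c := 2 ^ k * (2 * C ^ 2)) (by positivity) fun ε hε t ht => ?_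
      · obtain ⟨⟨m1, l1⟩, ⟨m2, l2⟩⟩ := hmem k hk q hq
        have e1 := five_mul_scale_le h5 h01 m1.1 l1 hk.2
        have e2 := five_mul_scale_le h5 h01 m2.1 l2 hk.2
        exact ((isPowBounded_inv_scale_mul (ih _ l1 m1 T)).mul
          (isPowBounded_inv_scale_mul (ih _ l2 m2 T))
          fun ε hε t _ => inv_scale_mul_nonneg hε).mono_exp (by linarith)
      · rw [hderiv k ε hε t, Finset.mul_sum]
        refine (periodL1_sum_le _ fun q _ => ?_).trans (Finset.sum_le_sum fun q hq => ?_)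
        · have c1 := hcont q.1 ε hε t
          have c2 := hcont q.2 ε hε t
          have c3 := hcont' q.1 ε hε t
          have c4 := hcont' q.2 ε hε t
          fun_prop
        · obtain ⟨⟨m1, l1⟩, ⟨m2, l2⟩⟩ := hmem k hk q hq
          obtain ⟨s1, -, d1⟩ := hC (α q.1) (X q.1) ε t (hpos _ m1) hε (hXp _ m1 ε hε t ht.1)
          obtain ⟨s2, -, d2⟩ := hC (α q.2) (X q.2) ε t (hpos _ m2) hε (hXp _ m2 ε hε t ht.1)
          set K₁ := (ε ^ α q.1)⁻¹ * periodL1 (X q.1 ε t)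
          set K₂ := (ε ^ α q.2)⁻¹ * periodL1 (X q.2 ε t)
          have hK₁ : 0 ≤ K₁ := inv_scale_mul_nonneg hε
          have hK₂ : 0 ≤ K₂ := inv_scale_mul_nonneg hε
          have c1 := hcont q.1 ε hε t
          have c2 := hcont q.2 ε hε t
          have c3 := hcont' q.1 ε hε t
          have c4 := hcont' q.2 ε hε t
          have hch : (k.choose q.1 : ℝ) ≤ 2 ^ k := by
            exact_mod_cast Nat.choose_le_two_pow k q.1
          rw [periodL1_const_mul, Nat.abs_cast, mul_assoc]
          refine mul_le_mul hch ?_ (periodL1_nonneg _) (by positivity)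
          refine (periodL1_add_le (c3.mul c2) (c1.mul c4)).trans ?_
          have b1 : periodL1 (fun x => deriv (smoothed φ (α q.1) (X q.1) ε t) x *
              smoothed φ (α q.2) (X q.2) ε t x) ≤ (C * K₂) * (C * K₁) := by
            simp_rw [mul_comm (deriv (smoothed φ (α q.1) (X q.1) ε t) _)]
            exact (periodL1_mul_le c2 c3 s2).trans
              (mul_le_mul_of_nonneg_left d1 (by positivity))
          have b2 : periodL1 (fun x => smoothed φ (α q.1) (X q.1) ε t x *
              deriv (smoothed φ (α q.2) (X q.2) ε t) x) ≤ (C * K₁) * (C * K₂) :=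
            (periodL1_mul_le c1 c4 s1).trans (mul_le_mul_of_nonneg_left d2 (by positivity))
          calc _ ≤ (C * K₂) * (C * K₁) + (C * K₁) * (C * K₂) := add_le_add b1 b2
            _ = _ := by ring
  have hsource : ∀ k ∈ Icc 1 (p + 1), ∀ T, IsPowBounded T (2 / 3 * α k) fun ε t =>
      periodL1 (hierarchySource (hierarchyFamily φ α u X) k ε t) := by
    intro k hk T
    -- Without the derivative one factor is measured in `L¹`, and the exponent is at most `(7/15)
    -- α_k`, well within the claim.
    refine (isPowBounded_sum (sourcePairs k)
      (N := fun q ε t => ((ε ^ α q.1)⁻¹ * periodL1 (X q.1 ε t)) * periodL1 (X q.2 ε t))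
      fun q hq => ?_).of_le (c := 2 ^ k * C ^ 2) (by positivity) fun ε hε t ht => ?_
    · obtain ⟨⟨m1, l1⟩, ⟨m2, l2⟩⟩ := hmem k hk q hq
      have e1 := five_mul_scale_le h5 h01 m1.1 l1 hk.2
      have e2 := five_mul_scale_le h5 h01 m2.1 l2 hk.2
      have e3 := hpos _ m2
      exact ((isPowBounded_inv_scale_mul (hgrow _ m1 T)).mul (hgrow _ m2 T)
        fun ε hε t _ => periodL1_nonneg _).mono_exp (by linarith)
    · rw [show hierarchySource (hierarchyFamily φ α u X) k ε t = _ from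
        funext (hierarchySource_eq k ε t), Finset.mul_sum]
      refine (periodL1_sum_le _ fun q _ => ?_).trans (Finset.sum_le_sum fun q hq => ?_)
      · exact continuous_const.mul ((hcont q.1 ε hε t).mul (hcont q.2 ε hε t))
      · obtain ⟨⟨m1, l1⟩, ⟨m2, l2⟩⟩ := hmem k hk q hq
        obtain ⟨s1, -, -⟩ := hC (α q.1) (X q.1) ε t (hpos _ m1) hε (hXp _ m1 ε hε t ht.1)
        obtain ⟨-, n2, -⟩ := hC (α q.2) (X q.2) ε t (hpos _ m2) hε (hXp _ m2 ε hε t ht.1)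
        have hK₁ : 0 ≤ (ε ^ α q.1)⁻¹ * periodL1 (X q.1 ε t) := inv_scale_mul_nonneg hε
        have hch : (k.choose q.1 : ℝ) ≤ 2 ^ k := by
          exact_mod_cast Nat.choose_le_two_pow k q.1
        rw [periodL1_const_mul, Nat.abs_cast, mul_assoc]
        refine mul_le_mul hch ?_ (periodL1_nonneg _) (by positivity)
        refine (periodL1_mul_le (hcont q.1 ε hε t) (hcont q.2 ε hε t) s1).trans ?_
        refine (mul_le_mul_of_nonneg_left n2 (by positivity)).trans_eq ?_
        ring
  have hdiff : ∀ k, ∀ ε ∈ Ioo (0 : ℝ) 1, ∀ t, 0 ≤ t →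
      Differentiable ℝ (hierarchySource (hierarchyFamily φ α u X) k ε t) :=
    fun k ε hε t _ x => (hasDerivAt_hierarchySource hφ.1 hε k t x).differentiableAt
  have hper : ∀ k ∈ Icc 1 (p + 1), ∀ ε ∈ Ioo (0 : ℝ) 1, ∀ t, 0 ≤ t → Function.Periodic
      (hierarchySource (hierarchyFamily φ α u X) k ε t) (2 * Real.pi) := by
    intro k hk ε hε t ht x
    rw [hierarchySource_eq, hierarchySource_eq]
    refine Finset.sum_congr rfl fun q hq => ?_
    obtain ⟨⟨m1, -⟩, ⟨m2, -⟩⟩ := hmem k hk q hq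
    rw [smoothed_periodic (hXp _ m1 ε hε t ht) x, smoothed_periodic (hXp _ m2 ε hε t ht) x]
  intro k hkp
  rcases Nat.eq_zero_or_pos k with rfl | hk1
  · have e : hierarchyFlux (hierarchyFamily φ α u X) 0 = fun ε t x => u ε t x ^ 2 := by
      funext ε t x
      simp [hierarchyFlux, hierarchyFamily, sq]
    rw [e, hg0]
    exact hu.weak
  have hk : k ∈ Icc 1 (p + 1) := ⟨hk1, hkp⟩
  rw [hierarchyFamily_of_pos hk1]
  obtain ⟨a, ha, ha1, haβ⟩ : ∃ a, (∀ T, IsPowBounded T a fun ε t => periodL1 (X k ε t)) ∧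
      a < 1 ∧ a + β < α k := by
    -- For `k = 1` the source is empty and the norm bounded, so `a = 0` and `β < α 1` suffices; the
    -- generic exponent would ask for `β < α 1 / 3`. For `k ≥ 2` one has `β < α k / 5`, and `2/3 +
    -- 1/5 < 1`.
    rcases (show 1 ≤ k from hk1).eq_or_lt with rfl | hk2
    · refine ⟨0, fun T => ?_, one_pos, by linarith⟩
      refine isPowBounded_periodL1_solution hu (hg 1 hk) (h 1 hk) le_rfl ?_
      refine (isPowBounded_zero T 0).of_le zero_le_one fun ε hε t ht => ?_
      have : sourcePairs 1 = ∅ := by decide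
      rw [hderiv 1 ε hε t, this]
      simp [periodL1_zero]
    · have e1 := five_mul_scale_le h5 h01 le_rfl hk2 hkp
      have e2 := hlt1 k hk
      have e3 := hpos k hk
      exact ⟨2 / 3 * α k, hgrow k hk, by linarith, by linarith⟩
  have e3 := hpos k hk
  exact isWeakAsymptotic_smoothed hφ hu (hg k hk) (h k hk) (hdiff k) (hper k hk)
    (fun ε _ t _ x => hierarchyFlux_eq hk1 ε t x) ha (hsource k hk) e3 ha1 haβ (by linarith)

end Hierarchy

/-! ### Gaussian averages -/

/-- At most exponential growth. -/
def ExpGrowth (F : ℝ → ℝ) : Prop :=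
  ∃ C K : ℝ, 0 ≤ C ∧ 0 ≤ K ∧ ∀ x, |F x| ≤ C * Real.exp (K * |x|)

/-- The (unnormalized) Gaussian average of `F` around `x` at scale `σ`. -/
def gaussAvg (F : ℝ → ℝ) (σ x : ℝ) : ℝ := ∫ y, F (x + σ * y) * Real.exp (-y ^ 2)

section GaussAvg

variable {F F' F'' : ℝ → ℝ}

/-- Half of the Gaussian absorbs the exponential growth: `(K R + 1)|y| ≤ (K R + 1)² / 2 + y² / 2`.
The factor `1 + |y|` covers the integrands with and without the weight `y` that differentiation in
`σ` brings down. -/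
lemma ExpGrowth.exists_gaussian_bound (hF : ExpGrowth F) (R : ℝ) : ∃ D : ℝ,
    ∀ σ x y : ℝ, |σ| ≤ R → |x| ≤ R →
      |F (x + σ * y)| * (1 + |y|) * Real.exp (-y ^ 2) ≤ D * Real.exp (-(1 / 2) * y ^ 2) := by
  obtain ⟨C, K, hC, hK, hb⟩ := hF
  refine ⟨C * Real.exp (K * R + (K * R + 1) ^ 2 / 2), fun σ x y hσ hx => ?_⟩
  have h1 : |x + σ * y| ≤ R + R * |y| := by
    refine (abs_add_le _ _).trans (add_le_add hx ?_)
    rw [abs_mul]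
    exact mul_le_mul_of_nonneg_right hσ (abs_nonneg y)
  have h2 : 1 + |y| ≤ Real.exp |y| := by
    rw [add_comm]; exact Real.add_one_le_exp _
  calc _ ≤ C * Real.exp (K * (R + R * |y|)) * Real.exp |y| * Real.exp (-y ^ 2) := by
        gcongr
        exact (hb _).trans (by gcongr)
    _ = C * Real.exp (K * (R + R * |y|) + |y| + -y ^ 2) := by
        rw [Real.exp_add, Real.exp_add]; ring
    _ ≤ C * Real.exp (K * R + (K * R + 1) ^ 2 / 2 + -(1 / 2) * y ^ 2) := by
        refine mul_le_mul_of_nonneg_left (Real.exp_le_exp.2 ?_) hC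
        nlinarith [sq_nonneg (K * R + 1 - |y|), sq_abs y]
    _ = _ := by rw [Real.exp_add]; ring

lemma ExpGrowth.exists_dominating (hF : ExpGrowth F) (R : ℝ) : ∃ B : ℝ → ℝ, Integrable B ∧
    ∀ σ x y : ℝ, |σ| ≤ R → |x| ≤ R → |F (x + σ * y) * Real.exp (-y ^ 2)| ≤ B y ∧
      |F (x + σ * y) * y * Real.exp (-y ^ 2)| ≤ B y := by
  obtain ⟨D, hD⟩ := hF.exists_gaussian_bound R
  refine ⟨fun y => D * Real.exp (-(1 / 2) * y ^ 2),
    (integrable_exp_neg_mul_sq (by norm_num)).const_mul D, fun σ x y hσ hx => ⟨?_, ?_⟩⟩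
  · refine le_trans ?_ (hD σ x y hσ hx)
    rw [abs_mul, abs_of_pos (Real.exp_pos _)]
    gcongr
    exact le_mul_of_one_le_right (abs_nonneg _) (by linarith [abs_nonneg y])
  · refine le_trans ?_ (hD σ x y hσ hx)
    rw [abs_mul, abs_mul, abs_of_pos (Real.exp_pos _)]
    gcongr
    linarith

lemma integrable_gauss (hF : ExpGrowth F) (hc : Continuous F) (σ x : ℝ) :
    Integrable fun y => F (x + σ * y) * Real.exp (-y ^ 2) := by
  obtain ⟨B, hB, hb⟩ := hF.exists_dominating (max |σ| |x|)
  exact hB.mono' (by fun_prop)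
    (Eventually.of_forall fun y => (hb σ x y (le_max_left _ _) (le_max_right _ _)).1)

lemma integrable_gauss_mul (hF : ExpGrowth F) (hc : Continuous F) (σ x : ℝ) :
    Integrable fun y => F (x + σ * y) * y * Real.exp (-y ^ 2) := by
  obtain ⟨B, hB, hb⟩ := hF.exists_dominating (max |σ| |x|)
  exact hB.mono' (by fun_prop)
    (Eventually.of_forall fun y => (hb σ x y (le_max_left _ _) (le_max_right _ _)).2)

lemma continuous_gaussAvg (hF : ExpGrowth F) (hc : Continuous F) :
    Continuous fun q : ℝ × ℝ => gaussAvg F q.1 q.2 := by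
  refine continuous_iff_continuousAt.2 fun q₀ => ?_
  obtain ⟨B, hB, hb⟩ := hF.exists_dominating (max |q₀.1| |q₀.2| + 1)
  have h1 : ∀ᶠ q : ℝ × ℝ in 𝓝 q₀, |q.1| < max |q₀.1| |q₀.2| + 1 :=
    (Continuous.tendsto (by fun_prop) q₀).eventually_lt_const
      ((le_max_left _ _).trans_lt (lt_add_one _))
  have h2 : ∀ᶠ q : ℝ × ℝ in 𝓝 q₀, |q.2| < max |q₀.1| |q₀.2| + 1 :=
    (Continuous.tendsto (by fun_prop) q₀).eventually_lt_const
      ((le_max_right _ _).trans_lt (lt_add_one _))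
  refine continuousAt_of_dominated (Eventually.of_forall fun q => by fun_prop) ?_ hB
    (Eventually.of_forall fun y => by fun_prop)
  filter_upwards [h1, h2] with q hq1 hq2
  exact Eventually.of_forall fun y => (hb q.1 q.2 y hq1.le hq2.le).1

lemma hasDerivAt_gaussAvg (hF : ExpGrowth F) (hc : Continuous F) (hF' : ExpGrowth F')
    (hc' : Continuous F') (hd : ∀ x, HasDerivAt F (F' x) x) (σ x : ℝ) :
    HasDerivAt (gaussAvg F σ) (gaussAvg F' σ x) x := by
  obtain ⟨B, hB, hb⟩ := hF'.exists_dominating (max |σ| (|x| + 1))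
  refine (hasDerivAt_integral_of_dominated_loc_of_deriv_le (bound := B)
    (F' := fun x y => F' (x + σ * y) * Real.exp (-y ^ 2))
    (Metric.ball_mem_nhds x one_pos) (Eventually.of_forall fun z => by fun_prop)
    (integrable_gauss hF hc σ x) (by fun_prop) (Eventually.of_forall fun y z hz => ?_) hB
    (Eventually.of_forall fun y z _ => ?_)).2
  · refine (hb σ z y (le_max_left _ _) (le_trans ?_ (le_max_right _ _))).1
    have := abs_sub_abs_le_abs_sub z x
    rw [Metric.mem_ball, Real.dist_eq] at hz
    linarith
  · exact ((hd (z + σ * y)).comp_add_const z (σ * y)).mul_const _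

/-- Differentiation in `σ` brings down `y`, and `y e^(-y²)` is the derivative of `-e^(-y²)/2`;
integrating by parts turns it into `σ/2` times the average of `F''`. For `σ = 2√(νt)` one has `σ σ'
/ 2 = ν`, which is the heat equation. -/
lemma hasDerivAt_gaussAvg_scale (hF : ExpGrowth F) (hc : Continuous F) (hF' : ExpGrowth F')
    (hc' : Continuous F') (hd : ∀ x, HasDerivAt F (F' x) x) (hF'' : ExpGrowth F'')
    (hc'' : Continuous F'') (hd' : ∀ x, HasDerivAt F' (F'' x) x) (σ x : ℝ) :
    HasDerivAt (fun σ => gaussAvg F σ x) (σ / 2 * gaussAvg F'' σ x) σ := by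
  have hlin : ∀ (τ y : ℝ), HasDerivAt (fun τ => x + τ * y) y τ := fun τ y => by
    simpa using ((hasDerivAt_id τ).mul_const y).const_add x
  have h1 : HasDerivAt (fun σ => gaussAvg F σ x)
      (∫ y, F' (x + σ * y) * y * Real.exp (-y ^ 2)) σ := by
    obtain ⟨B, hB, hb⟩ := hF'.exists_dominating (max (|σ| + 1) |x|)
    refine (hasDerivAt_integral_of_dominated_loc_of_deriv_le (bound := B)
      (F' := fun τ y => F' (x + τ * y) * y * Real.exp (-y ^ 2))
      (Metric.ball_mem_nhds σ one_pos) (Eventually.of_forall fun z => by fun_prop)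
      (integrable_gauss hF hc σ x) (by fun_prop) (Eventually.of_forall fun y z hz => ?_) hB
      (Eventually.of_forall fun y z _ => ?_)).2
    · refine (hb z x y (le_trans ?_ (le_max_left _ _)) (le_max_right _ _)).2
      have := abs_sub_abs_le_abs_sub z σ
      rw [Metric.mem_ball, Real.dist_eq] at hz
      linarith
    · exact ((hd (x + z * y)).comp z (hlin z y)).mul_const _
  have h2 : ∫ y, (F' (x + σ * y) * y * Real.exp (-y ^ 2) -
      σ / 2 * (F'' (x + σ * y) * Real.exp (-y ^ 2))) = 0 := by
    refine integral_eq_zero_of_hasDerivAt_of_integrable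
      (f := fun y => -(1 / 2) * (F' (x + σ * y) * Real.exp (-y ^ 2))) (fun y => ?_)
      ((integrable_gauss_mul hF' hc' σ x).sub ((integrable_gauss hF'' hc'' σ x).const_mul _))
      ((integrable_gauss hF' hc' σ x).const_mul _)
    have e1 : HasDerivAt (fun y => x + σ * y) σ y := by
      simpa using ((hasDerivAt_id y).const_mul σ).const_add x
    have e2 : HasDerivAt (fun y : ℝ => Real.exp (-y ^ 2)) (Real.exp (-y ^ 2) * (-(2 * y))) y := by
      have := ((hasDerivAt_pow 2 y).neg).exp
      simpa using this
    refine ((((hd' (x + σ * y)).comp y e1).mul e2).const_mul (-(1 / 2))).congr_deriv ?_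
    simp only [Function.comp]
    ring
  rw [integral_sub (integrable_gauss_mul hF' hc' σ x)
    ((integrable_gauss hF'' hc'' σ x).const_mul _), integral_const_mul, sub_eq_zero] at h2
  rwa [h2] at h1

/-- Gaussian averages at scale `2√(νt)` solve the heat equation, up to the initial time. -/
lemma hasDerivWithinAt_gaussAvg_sqrt (hF : ExpGrowth F) (hc : Continuous F) (hF' : ExpGrowth F')
    (hc' : Continuous F') (hd : ∀ x, HasDerivAt F (F' x) x) (hF'' : ExpGrowth F'')
    (hc'' : Continuous F'') (hd' : ∀ x, HasDerivAt F' (F'' x) x) {ν : ℝ} (hν : 0 < ν) (x : ℝ)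
    {t : ℝ} (ht : 0 ≤ t) :
    HasDerivWithinAt (fun s => gaussAvg F (2 * √(ν * s)) x)
      (ν * gaussAvg F'' (2 * √(ν * t)) x) (Ici 0) t := by
  have hpos : ∀ s, 0 < s → HasDerivAt (fun s => gaussAvg F (2 * √(ν * s)) x)
      (ν * gaussAvg F'' (2 * √(ν * s)) x) s := fun s hs => by
    have hνs : 0 < ν * s := by positivity
    have e1 : HasDerivAt (fun s => 2 * √(ν * s)) (2 * (ν / (2 * √(ν * s)))) s := by
      have := (((hasDerivAt_id s).const_mul ν).sqrt hνs.ne').const_mul 2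
      simpa using this
    refine ((hasDerivAt_gaussAvg_scale hF hc hF' hc' hd hF'' hc'' hd' _ x).comp s e1).congr_deriv ?_
    have := Real.sqrt_pos.2 hνs
    field_simp
  rcases ht.eq_or_lt with rfl | ht
  -- The scale is not differentiable at `t = 0`, but the derivative at positive times extends
  -- continuously to zero, which gives the one-sided derivative there.
  · have hcont : ∀ G : ℝ → ℝ, ExpGrowth G → Continuous G →
        Continuous fun s => gaussAvg G (2 * √(ν * s)) x := fun G hG hGc =>
      (continuous_gaussAvg hG hGc).comp (f := fun s => (2 * √(ν * s), x)) (by fun_prop)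
    refine hasDerivWithinAt_Ici_of_tendsto_deriv (s := Ioi 0)
      (fun s hs => (hpos s hs).differentiableAt.differentiableWithinAt)
      (hcont F hF hc).continuousWithinAt self_mem_nhdsWithin ?_
    have hlim : Tendsto (fun s => ν * gaussAvg F'' (2 * √(ν * s)) x) (𝓝[>] 0)
        (𝓝 (ν * gaussAvg F'' (2 * √(ν * 0)) x)) :=
      ((continuous_const.mul (hcont F'' hF'' hc'')).tendsto 0).mono_left nhdsWithin_le_nhds
    refine hlim.congr' ?_
    filter_upwards [self_mem_nhdsWithin] with s hs
    exact (hpos s hs).deriv.symm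
  · exact (hpos t ht).hasDerivWithinAt

lemma gaussAvg_pos (hF : ExpGrowth F) (hc : Continuous F) (hp : ∀ x, 0 < F x) (σ x : ℝ) :
    0 < gaussAvg F σ x := by
  refine (integral_pos_iff_support_of_nonneg
    (fun y => (mul_pos (hp _) (Real.exp_pos _)).le) (integrable_gauss hF hc σ x)).2 ?_
  have : (Function.support fun y => F (x + σ * y) * Real.exp (-y ^ 2)) = univ :=
    eq_univ_of_forall fun y => (mul_pos (hp _) (Real.exp_pos _)).ne'
  rw [this]
  simp

/-- A pointwise comparison survives averaging. Both the maximum principle and the slope bound of the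
viscous solution come from it. -/
lemma abs_gaussAvg_le {G : ℝ → ℝ} (hF : ExpGrowth F) (hc : Continuous F) {B : ℝ}
    (hB : ∀ x, |G x| ≤ B * F x) (σ x : ℝ) : |gaussAvg G σ x| ≤ B * gaussAvg F σ x := by
  unfold gaussAvg
  rw [← integral_const_mul, ← Real.norm_eq_abs]
  refine norm_integral_le_of_norm_le ((integrable_gauss hF hc σ x).const_mul B)
    (Eventually.of_forall fun y => ?_)
  rw [Real.norm_eq_abs, abs_mul, abs_of_pos (Real.exp_pos _), ← mul_assoc]
  exact mul_le_mul_of_nonneg_right (hB _) (Real.exp_pos _).le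

lemma gaussAvg_zero (F : ℝ → ℝ) (x : ℝ) :
    gaussAvg F 0 x = F x * ∫ y, Real.exp (-y ^ 2) := by
  simp [gaussAvg, integral_const_mul]

lemma gaussAvg_const_mul (c : ℝ) (F : ℝ → ℝ) (σ x : ℝ) :
    gaussAvg (fun z => c * F z) σ x = c * gaussAvg F σ x := by
  simp only [gaussAvg, mul_assoc, integral_const_mul]

/-- The Cole–Hopf data are periodic only up to a constant factor, unless the velocity has mean zero.
Averages keep that factor, and it cancels in the quotient. -/
lemma gaussAvg_add_right {c l : ℝ} (h : ∀ x, F (x + c) = l * F x) (σ x : ℝ) :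
    gaussAvg F σ (x + c) = l * gaussAvg F σ x := by
  rw [← gaussAvg_const_mul]
  unfold gaussAvg
  congr 1; ext y
  rw [show x + c + σ * y = x + σ * y + c by ring, h]

end GaussAvg

/-! ### The viscous equation -/

section ColeHopf

variable {a : ℝ → ℝ} {ν : ℝ}

lemma contDiff_two_of_hasDerivAt {f f' f'' : ℝ → ℝ} (h : ∀ x, HasDerivAt f (f' x) x)
    (h' : ∀ x, HasDerivAt f' (f'' x) x) (hc : Continuous f'') : ContDiff ℝ 2 f := by
  have e : deriv f = f' := funext fun x => (h x).deriv
  have e' : deriv f' = f'' := funext fun x => (h' x).deriv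
  have h1 : ContDiff ℝ 1 f' :=
    contDiff_one_iff_deriv.2 ⟨fun x => (h' x).differentiableAt, by rwa [e']⟩
  rw [show (2 : WithTop ℕ∞) = 1 + 1 by norm_num, contDiff_succ_iff_deriv, e]
  exact ⟨fun x => (h x).differentiableAt, by simp, h1⟩

lemma ExpGrowth.bdd_mul {F G : ℝ → ℝ} (hF : ExpGrowth F) {B : ℝ} (hB : ∀ x, |G x| ≤ B) :
    ExpGrowth fun x => G x * F x := by
  obtain ⟨C, K, hC, hK, hb⟩ := hF
  have hB0 : 0 ≤ B := (abs_nonneg _).trans (hB 0)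
  refine ⟨B * C, K, by positivity, hK, fun x => ?_⟩
  rw [abs_mul, mul_assoc]
  exact mul_le_mul (hB x) (hb x) (abs_nonneg _) hB0

/-- The viscous equation has a global classical solution for smooth periodic data, with the
maximum principle and a bound on the slope. -/
theorem exists_viscousSolution (ha : ContDiff ℝ ∞ a) (hp : Function.Periodic a (2 * Real.pi))
    {M M₁ : ℝ} (hM : ∀ x, |a x| ≤ M) (hM₁ : ∀ x, |deriv a x| ≤ M₁) (hν : 0 < ν) :
    ∃ u : ℝ → ℝ → ℝ, IsViscousSolution ν u ∧ u 0 = a ∧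
      Continuous (fun q : ℝ × ℝ => u q.1 q.2) ∧ (∀ t, Function.Periodic (u t) (2 * Real.pi)) ∧
      (∀ t x, |u t x| ≤ M) ∧ ∀ t x, |deriv (u t) x| ≤ M₁ + 2 * M ^ 2 / ν := by
  have hM0 : 0 ≤ M := (abs_nonneg _).trans (hM 0)
  have hac : Continuous a := ha.continuous
  have ha1 : ContDiff ℝ ∞ (deriv a) := ha.deriv'
  have ha2 : ContDiff ℝ ∞ (deriv (deriv a)) := ha1.deriv'
  have had : ∀ x, HasDerivAt a (deriv a x) x := fun x =>
    (ha.differentiable (by simp) x).hasDerivAt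
  have had1 : ∀ x, HasDerivAt (deriv a) (deriv (deriv a) x) x := fun x =>
    (ha1.differentiable (by simp) x).hasDerivAt
  have hac1 := ha1.continuous
  have hper1 : ∀ {f : ℝ → ℝ}, Function.Periodic f (2 * Real.pi) →
      Function.Periodic (deriv f) (2 * Real.pi) := fun {f} hf x => by
    rw [← deriv_comp_add_const, show (fun y => f (y + 2 * Real.pi)) = f from funext hf]
  set P : ℝ → ℝ := fun x => ∫ y in (0 : ℝ)..x, a y with hPdef
  have hPd : ∀ x, HasDerivAt P (a x) x := fun x =>
    intervalIntegral.integral_hasDerivAt_right (hac.intervalIntegrable _ _)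
      (hac.stronglyMeasurableAtFilter _ _) hac.continuousAt
  have hPb : ∀ x, |P x| ≤ M * |x| := fun x => by
    have := intervalIntegral.norm_integral_le_of_norm_le_const (a := 0) (b := x) (f := a) (C := M)
      fun y _ => hM y
    simpa using this
  have hPp : ∀ x, P (x + 2 * Real.pi) = P x + P (2 * Real.pi) := fun x => by
    have h1 := intervalIntegral.integral_add_adjacent_intervals
      (hac.intervalIntegrable (μ := volume) 0 x)
      (hac.intervalIntegrable x (x + 2 * Real.pi))
    have h2 := hp.intervalIntegral_add_eq x 0
    rw [zero_add] at h2
    simp only [hPdef]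
    rw [← h1, h2]
  -- Cole–Hopf data: `-ν θ' / θ = a`. The prefactor is `ν`, not `2ν`, because the flux is `u²`
  -- rather than `u²/2`.
  set θ : ℝ → ℝ := fun x => Real.exp (-(P x / ν)) with hθ
  have hPc : Continuous P := continuous_iff_continuousAt.2 fun x => (hPd x).continuousAt
  have hθc : Continuous θ := by fun_prop
  have hθpos : ∀ x, 0 < θ x := fun x => Real.exp_pos _
  have hθd : ∀ x, HasDerivAt θ (-(a x / ν) * θ x) x := fun x => by
    have := ((hPd x).div_const ν).neg.exp
    refine this.congr_deriv ?_
    simp only [hθ, Pi.neg_apply]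
    ring
  have hθg : ExpGrowth θ := by
    refine ⟨1, M / ν, zero_le_one, by positivity, fun x => ?_⟩
    rw [abs_of_pos (hθpos x), one_mul]
    refine Real.exp_le_exp.2 ?_
    rw [← neg_div, div_mul_eq_mul_div]
    exact div_le_div_of_nonneg_right ((neg_le_abs _).trans (hPb x)) hν.le
  -- The first three derivatives of `θ` are `b₁ θ`, `b₂ θ`, `b₃ θ`, with periodic, hence bounded,
  -- coefficients; so they inherit its exponential growth bound.
  set b₁ : ℝ → ℝ := fun x => -(a x / ν) with hb₁
  set b₂ : ℝ → ℝ := fun x => a x ^ 2 / ν ^ 2 - deriv a x / ν with hb₂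
  set b₃ : ℝ → ℝ := fun x => 2 * a x * deriv a x / ν ^ 2 - deriv (deriv a) x / ν
    - a x / ν * (a x ^ 2 / ν ^ 2 - deriv a x / ν) with hb₃
  have hb₁c : Continuous b₁ := by fun_prop
  have hb₂c : Continuous b₂ := by fun_prop
  have hb₃c : Continuous b₃ := by fun_prop
  have hbp : ∀ x, a (x + 2 * Real.pi) = a x ∧ deriv a (x + 2 * Real.pi) = deriv a x ∧
      deriv (deriv a) (x + 2 * Real.pi) = deriv (deriv a) x := fun x =>
    ⟨hp x, hper1 hp x, hper1 (hper1 hp) x⟩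
  obtain ⟨B₁, -, hB₁⟩ := exists_abs_bound_of_periodic hb₁c fun x => by
    simp only [hb₁, hbp x]
  obtain ⟨B₂, -, hB₂⟩ := exists_abs_bound_of_periodic hb₂c fun x => by
    simp only [hb₂, hbp x]
  obtain ⟨B₃, -, hB₃⟩ := exists_abs_bound_of_periodic hb₃c fun x => by
    simp only [hb₃, hbp x]
  set θ₁ : ℝ → ℝ := fun x => b₁ x * θ x with hθ₁
  set θ₂ : ℝ → ℝ := fun x => b₂ x * θ x with hθ₂
  set θ₃ : ℝ → ℝ := fun x => b₃ x * θ x with hθ₃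
  have hθ₁c : Continuous θ₁ := hb₁c.mul hθc
  have hθ₂c : Continuous θ₂ := hb₂c.mul hθc
  have hθ₃c : Continuous θ₃ := hb₃c.mul hθc
  have g₁ : ExpGrowth θ₁ := hθg.bdd_mul hB₁
  have g₂ : ExpGrowth θ₂ := hθg.bdd_mul hB₂
  have g₃ : ExpGrowth θ₃ := hθg.bdd_mul hB₃
  have d₁ : ∀ x, HasDerivAt θ₁ (θ₂ x) x := fun x => by
    refine ((((had x).div_const ν).neg).mul (hθd x)).congr_deriv ?_
    simp only [hθ₂, hb₂, Pi.neg_apply]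
    ring
  have d₂ : ∀ x, HasDerivAt θ₂ (θ₃ x) x := fun x => by
    refine (((((had x).pow 2).div_const (ν ^ 2)).sub ((had1 x).div_const ν)).mul
      (hθd x)).congr_deriv ?_
    simp only [hθ₃, hb₃, Pi.sub_apply, Pi.pow_apply]
    push_cast
    ring
  set σ : ℝ → ℝ := fun t => 2 * √(ν * t) with hσ
  set h₀ : ℝ → ℝ → ℝ := fun t => gaussAvg θ (σ t) with hh₀
  set h₁ : ℝ → ℝ → ℝ := fun t => gaussAvg θ₁ (σ t) with hh₁
  set h₂ : ℝ → ℝ → ℝ := fun t => gaussAvg θ₂ (σ t) with hh₂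
  set h₃ : ℝ → ℝ → ℝ := fun t => gaussAvg θ₃ (σ t) with hh₃
  have pos : ∀ t x, 0 < h₀ t x := fun t x => gaussAvg_pos hθg hθc hθpos _ _
  have x₀ : ∀ t x, HasDerivAt (h₀ t) (h₁ t x) x := fun t x =>
    hasDerivAt_gaussAvg hθg hθc g₁ hθ₁c hθd _ x
  have x₁ : ∀ t x, HasDerivAt (h₁ t) (h₂ t x) x := fun t x =>
    hasDerivAt_gaussAvg g₁ hθ₁c g₂ hθ₂c d₁ _ x
  have x₂ : ∀ t x, HasDerivAt (h₂ t) (h₃ t x) x := fun t x =>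
    hasDerivAt_gaussAvg g₂ hθ₂c g₃ hθ₃c d₂ _ x
  have t₀ : ∀ t, 0 ≤ t → ∀ x, HasDerivWithinAt (fun s => h₀ s x) (ν * h₂ t x) (Ici 0) t :=
    fun t ht x => hasDerivWithinAt_gaussAvg_sqrt hθg hθc g₁ hθ₁c hθd g₂ hθ₂c d₁ hν x ht
  have t₁ : ∀ t, 0 ≤ t → ∀ x, HasDerivWithinAt (fun s => h₁ s x) (ν * h₃ t x) (Ici 0) t :=
    fun t ht x => hasDerivWithinAt_gaussAvg_sqrt g₁ hθ₁c g₂ hθ₂c d₁ g₃ hθ₃c d₂ hν x ht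
  have cont : ∀ G : ℝ → ℝ, ExpGrowth G → Continuous G →
      Continuous fun q : ℝ × ℝ => gaussAvg G (σ q.1) q.2 := fun G hG hGc =>
    (continuous_gaussAvg hG hGc).comp (f := fun q : ℝ × ℝ => (σ q.1, q.2)) (by fun_prop)
  set u : ℝ → ℝ → ℝ := fun t x => -ν * h₁ t x / h₀ t x with hu
  have ux : ∀ t x, HasDerivAt (u t)
      (-ν * (h₂ t x * h₀ t x - h₁ t x ^ 2) / h₀ t x ^ 2) x := fun t x => by
    refine (((x₁ t x).const_mul (-ν)).div (x₀ t x) (pos t x).ne').congr_deriv ?_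
    ring
  have uxx : ∀ t x, HasDerivAt
      (fun x => -ν * (h₂ t x * h₀ t x - h₁ t x ^ 2) / h₀ t x ^ 2)
      (-ν * ((h₃ t x * h₀ t x - h₂ t x * h₁ t x) * h₀ t x ^ 2
        - (h₂ t x * h₀ t x - h₁ t x ^ 2) * (2 * h₀ t x * h₁ t x)) / h₀ t x ^ 4) x := fun t x => by
    have hne := (pos t x).ne'
    refine (((((x₂ t x).mul (x₀ t x)).sub ((x₁ t x).pow 2)).const_mul (-ν)).div
      ((x₀ t x).pow 2) (pow_ne_zero 2 hne)).congr_deriv ?_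
    simp only [Pi.mul_apply, Pi.sub_apply, Pi.pow_apply]
    push_cast
    field_simp
    ring
  -- This exhibits `u t x` as an average of `a` with positive weights, whence the bound `M`.
  have hlim : ∀ t x, h₁ t x = -(1 / ν) * gaussAvg (fun z => a z * θ z) (σ t) x := fun t x => by
    rw [← gaussAvg_const_mul]
    simp only [hh₁, hθ₁, hb₁]
    congr 1
    ext z
    ring
  have uM : ∀ t x, |u t x| ≤ M := fun t x => by
    have h := abs_gaussAvg_le (G := fun z => a z * θ z) (B := M) hθg hθc (fun z => by
      rw [abs_mul, abs_of_pos (hθpos z)]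
      exact mul_le_mul_of_nonneg_right (hM z) (hθpos z).le) (σ t) x
    have e : -ν * h₁ t x = gaussAvg (fun z => a z * θ z) (σ t) x := by
      rw [hlim]; field_simp
    simp only [hu]
    rw [e, abs_div, abs_of_pos (pos t x), div_le_iff₀ (pos t x)]
    exact h
  refine ⟨u, fun t ht => ⟨?_, fun x => ?_⟩, ?_, ?_, fun t x => ?_, uM, fun t x => ?_⟩
  · have c₀ : ContDiff ℝ 2 (h₀ t) := contDiff_two_of_hasDerivAt (x₀ t) (x₁ t)
      (continuous_iff_continuousAt.2 fun x => (x₂ t x).continuousAt)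
    have c₁ : ContDiff ℝ 2 (h₁ t) := contDiff_two_of_hasDerivAt (x₁ t) (x₂ t)
      ((cont θ₃ g₃ hθ₃c).comp (Continuous.prodMk_right t))
    exact (contDiff_const.mul c₁).div c₀ fun x => (pos t x).ne'
  · have hne := (pos t x).ne'
    have e1 : deriv (u t) = fun x => -ν * (h₂ t x * h₀ t x - h₁ t x ^ 2) / h₀ t x ^ 2 :=
      funext fun x => (ux t x).deriv
    rw [iteratedDeriv_succ, iteratedDeriv_one, e1, (uxx t x).deriv,
      ((ux t x).fun_pow 2).deriv]
    refine (((t₁ t ht x).const_mul (-ν)).div (t₀ t ht x) hne).congr_deriv ?_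
    simp only [hu]
    push_cast
    field_simp
    ring
  · funext x
    have hI : 0 < ∫ y : ℝ, Real.exp (-y ^ 2) := by
      have := pos 0 x
      simp only [hh₀, hσ, mul_zero, Real.sqrt_zero, gaussAvg_zero] at this
      exact pos_of_mul_pos_right this (hθpos x).le
    simp only [hu, hh₀, hh₁, hσ, mul_zero, Real.sqrt_zero, gaussAvg_zero, hθ₁, hb₁]
    have := (hθpos x).ne'
    have := hI.ne'
    field_simp
  · exact (continuous_const.mul (cont θ₁ g₁ hθ₁c)).div (cont θ hθg hθc) fun q => (pos _ _).ne'
  · have hl : ∀ x, θ (x + 2 * Real.pi) = Real.exp (-(P (2 * Real.pi) / ν)) * θ x := fun x => by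
      simp only [hθ]
      rw [hPp, ← Real.exp_add]
      congr 1
      ring
    have hl₁ : ∀ x, θ₁ (x + 2 * Real.pi) = Real.exp (-(P (2 * Real.pi) / ν)) * θ₁ x := fun x => by
      simp only [hθ₁, hl, hb₁, hbp x]
      ring
    simp only [hu, hh₀, hh₁]
    rw [gaussAvg_add_right hl, gaussAvg_add_right hl₁, mul_left_comm]
    exact mul_div_mul_left _ _ (Real.exp_pos _).ne'
  · rw [(ux t x).deriv]
    have hne := (pos t x).ne'
    -- The slope splits into an average of `-ν θ'' / θ`, bounded by `M₁ + M² / ν`, and `u² / ν`.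
    have e : -ν * (h₂ t x * h₀ t x - h₁ t x ^ 2) / h₀ t x ^ 2 =
        -ν * h₂ t x / h₀ t x + u t x ^ 2 / ν := by
      simp only [hu]
      field_simp
      ring
    have k1 : |u t x ^ 2 / ν| ≤ M ^ 2 / ν := by
      rw [abs_div, abs_of_pos hν, abs_pow]
      gcongr
      exact uM t x
    have k2 : |-ν * h₂ t x / h₀ t x| ≤ M₁ + M ^ 2 / ν := by
      have h := abs_gaussAvg_le (G := θ₂) (B := M ^ 2 / ν ^ 2 + M₁ / ν) hθg hθc (fun z => by
        simp only [hθ₂]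
        rw [abs_mul, abs_of_pos (hθpos z)]
        refine mul_le_mul_of_nonneg_right ?_ (hθpos z).le
        simp only [hb₂]
        refine (abs_sub _ _).trans ?_
        rw [abs_div, abs_div, abs_of_pos hν, abs_of_pos (by positivity : 0 < ν ^ 2), abs_pow]
        gcongr
        · exact hM z
        · exact hM₁ z) (σ t) x
      rw [abs_div, abs_mul, abs_neg, abs_of_pos hν, abs_of_pos (pos t x), div_le_iff₀ (pos t x)]
      calc ν * |h₂ t x| ≤ ν * ((M ^ 2 / ν ^ 2 + M₁ / ν) * h₀ t x) := by gcongr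
        _ = _ := by field_simp; ring
    rw [e]
    refine (abs_add_le _ _).trans ((add_le_add k2 k1).trans_eq ?_)
    ring

end ColeHopf

/-- The residual of a viscous solution is `ν ∫ u ψ''`. -/
lemma weakResidual_viscous {ν : ℝ} {U : ℝ → ℝ → ℝ → ℝ} {ψ : ℝ → ℝ} (hψ : IsTest ψ) {ε t : ℝ}
    (ht : 0 ≤ t) (hU : IsViscousSolution ν (U ε)) :
    weakResidual U (fun ε t x => U ε t x ^ 2) ψ ε t =
      ν * ∫ x, U ε t x * deriv (deriv ψ) x := by
  obtain ⟨hc, hd⟩ := hU t ht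
  have hdiff : Differentiable ℝ (U ε t) := hc.differentiable (by norm_num)
  have hc1 : ContDiff ℝ 1 (deriv (U ε t)) := by
    have := hc
    rw [show (2 : WithTop ℕ∞) = 1 + 1 by norm_num, contDiff_succ_iff_deriv] at this
    exact this.2.2
  have hdiff1 : Differentiable ℝ (deriv (U ε t)) := hc1.differentiable (by norm_num)
  have hcdd : Continuous (deriv (deriv (U ε t))) := (contDiff_one_iff_deriv.1 hc1).2
  have hsq : Differentiable ℝ fun y => U ε t y ^ 2 := hdiff.pow 2
  have hsqc : Continuous (deriv fun y => U ε t y ^ 2) :=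
    (hc.pow 2).continuous_deriv (by norm_num)
  have i1 := integrable_mul_test hcdd hψ
  have i2 := integrable_mul_test hsqc hψ
  have i3 := integrable_mul_test hsq.continuous hψ.deriv
  have e1 := integral_deriv_mul_test hsq hsqc hψ
  have e2 := integral_deriv_mul_test hdiff1 hcdd hψ
  have e3 := integral_deriv_mul_test hdiff hc1.continuous hψ.deriv
  unfold weakResidual
  have e : ∀ x, derivWithin (fun s => U ε s x) (Ici 0) t * ψ x - U ε t x ^ 2 * deriv ψ x =
      ν * (deriv (deriv (U ε t)) x * ψ x) - deriv (fun y => U ε t y ^ 2) x * ψ x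
        - U ε t x ^ 2 * deriv ψ x := fun x => by
    rw [(hd x).derivWithin (uniqueDiffOn_Ici 0 t ht), iteratedDeriv_succ, iteratedDeriv_one]
    ring
  simp_rw [e]
  rw [integral_sub ((i1.const_mul ν).sub' i2) i3, integral_sub (i1.const_mul ν) i2,
    integral_const_mul, e1, e2, e3]
  ring

/-- The residual is at most `|ν| M ∫ |ψ''|`, uniformly in time; no compactness and no limit of the
`U ε` is involved. -/
lemma isWeakAsymptotic_viscous {ν : ℝ → ℝ} {U : ℝ → ℝ → ℝ → ℝ} {g : ℝ → ℝ} {M : ℝ}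
    (hν : Tendsto ν (𝓝[>] 0) (𝓝 0))
    (hU : ∀ ε ∈ Ioo (0 : ℝ) 1, IsViscousSolution (ν ε) (U ε))
    (hM : ∀ ε ∈ Ioo (0 : ℝ) 1, ∀ t x, |U ε t x| ≤ M)
    (hg : TendstoDistrib (fun ε => U ε 0) g) :
    IsWeakAsymptotic U (fun ε t x => U ε t x ^ 2) g := by
  refine ⟨fun ε hε t ht x => ((hU ε hε t ht).2 x).differentiableWithinAt, fun ε hε t ht => ?_,
    fun ε hε t ht => ?_, fun ψ hψ T => ?_, hg⟩
  · obtain ⟨hc, hd⟩ := hU ε hε t ht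
    rw [show (fun x => derivWithin (fun s => U ε s x) (Ici 0) t) = fun x =>
        ν ε * iteratedDeriv 2 (U ε t) x - deriv (fun y => U ε t y ^ 2) x from
      funext fun x => (hd x).derivWithin (uniqueDiffOn_Ici 0 t ht)]
    have h1 : Continuous (iteratedDeriv 2 (U ε t)) := hc.continuous_iteratedDeriv 2 (by norm_num)
    have h2 : Continuous (deriv fun y => U ε t y ^ 2) :=
      (hc.pow 2).continuous_deriv (by norm_num)
    exact (by fun_prop : Continuous _).locallyIntegrable
  · exact ((hU ε hε t ht).1.continuous.pow 2).locallyIntegrable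
  · set J := ∫ x, |deriv (deriv ψ) x| with hJ
    have hlim : Tendsto (fun ε => |ν ε| * (M * J)) (𝓝[>] 0) (𝓝 0) := by
      simpa using hν.abs.mul_const (M * J)
    rw [Metric.tendstoUniformlyOn_iff]
    intro e he
    filter_upwards [eventually_mem_Ioo, hlim.eventually (gt_mem_nhds he)] with ε hε h2 t ht
    rw [dist_zero_left, Real.norm_eq_abs, weakResidual_viscous hψ ht.1 (hU ε hε), abs_mul]
    refine lt_of_le_of_lt (mul_le_mul_of_nonneg_left ?_ (abs_nonneg _)) h2
    rw [hJ, ← integral_const_mul, ← Real.norm_eq_abs]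
    refine norm_integral_le_of_norm_le (hψ.deriv.deriv.integrable.norm.const_mul M)
      (Eventually.of_forall fun x => ?_)
    rw [Real.norm_eq_abs, abs_mul]
    exact mul_le_mul_of_nonneg_right (hM ε hε t x) (abs_nonneg _)

lemma IsTorusLinfty.exists_bound {u₀ : ℝ → ℝ} (h : IsTorusLinfty u₀) :
    ∃ M : ℝ, 0 ≤ M ∧ ∀ᵐ x, |u₀ x| ≤ M := by
  refine ⟨(eLpNorm u₀ ⊤ volume).toReal, ENNReal.toReal_nonneg, ?_⟩
  have hfin : eLpNorm u₀ ⊤ volume ≠ ⊤ := h.2.2.ne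
  filter_upwards [ae_le_eLpNormEssSup (f := u₀) (μ := volume)] with x hx
  rw [← eLpNorm_exponent_top] at hx
  have := ENNReal.toReal_mono hfin hx
  simpa using this

/-- Data mollified at scale `ν` have slope `O(1/ν)`, the same order as the loss in the Cole–Hopf
bound, so one small parameter suffices. -/
theorem exists_viscous_velocityFamily {φ u₀ : ℝ → ℝ} (hφ : IsMollifier φ)
    (hu₀ : IsTorusLinfty u₀) :
    ∃ (ν : ℝ → ℝ) (u : ℝ → ℝ → ℝ → ℝ),
      (∀ ε ∈ Ioo (0 : ℝ) 1, 0 < ν ε ∧ IsViscousSolution (ν ε) (u ε)) ∧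
      Tendsto ν (𝓝[>] 0) (𝓝 0) ∧ ∀ β : ℝ, 0 < β → IsVelocityFamily β u₀ u := by
  obtain ⟨M, hM0, hM⟩ := hu₀.exists_bound
  have hloc : LocallyIntegrable u₀ volume := hu₀.2.locallyIntegrable le_top
  set I := ∫ z, |φ z| with hI
  set I' := ∫ z, |deriv φ z| with hI'
  have hI0 : 0 ≤ I := integral_nonneg fun _ => abs_nonneg _
  have hI'0 : 0 ≤ I' := integral_nonneg fun _ => abs_nonneg _
  -- Logarithmic decay makes `1/ν` smaller than every power `ε^(-β)` up to a constant, so that one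
  -- family serves all `β`. The summand 1 keeps `ν` in `(0, 1]`.
  set ν : ℝ → ℝ := fun ε => (1 - Real.log ε)⁻¹ with hν
  have hlog : ∀ ε ∈ Ioo (0 : ℝ) 1, 1 < 1 - Real.log ε := fun ε hε => by
    linarith [Real.log_neg hε.1 hε.2]
  have hνpos : ∀ ε ∈ Ioo (0 : ℝ) 1, 0 < ν ε := fun ε hε =>
    inv_pos.2 (zero_lt_one.trans (hlog ε hε))
  have hν1 : ∀ ε ∈ Ioo (0 : ℝ) 1, ν ε ≤ 1 := fun ε hε => inv_le_one_of_one_le₀ (hlog ε hε).le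
  have hνlim : Tendsto ν (𝓝[>] 0) (𝓝 0) := by
    refine tendsto_inv_atTop_zero.comp ?_
    simp only [sub_eq_add_neg]
    exact tendsto_const_nhds.add_atTop (tendsto_neg_atBot_atTop.comp Real.tendsto_log_nhdsGT_zero)
  have hsol : ∀ ε ∈ Ioo (0 : ℝ) 1, ∃ u : ℝ → ℝ → ℝ, IsViscousSolution (ν ε) u ∧
      u 0 = mollify φ (ν ε) u₀ ∧
      Continuous (fun q : ℝ × ℝ => u q.1 q.2) ∧ (∀ t, Function.Periodic (u t) (2 * Real.pi)) ∧
      (∀ t x, |u t x| ≤ M * I) ∧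
      ∀ t x, |deriv (u t) x| ≤ (ν ε)⁻¹ * (M * I') + 2 * (M * I) ^ 2 / ν ε := fun ε hε =>
    exists_viscousSolution (contDiff_mollify hφ.1 (hνpos ε hε) hloc)
      (mollify_periodic φ _ hu₀.1) (abs_mollify_le hφ.1 (hνpos ε hε) hM)
      (fun x => by
        have hp := hνpos ε hε
        rw [(hasDerivAt_mollify hφ.1 hp hloc x).deriv, abs_mul, abs_of_pos (inv_pos.2 hp)]
        exact mul_le_mul_of_nonneg_left (abs_mollify_le hφ.1.deriv hp hM x) (inv_pos.2 hp).le)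
      (hνpos ε hε)
  choose! u hvis hini hcont hper hbd hder using hsol
  refine ⟨ν, u, fun ε hε => ⟨hνpos ε hε, hvis ε hε⟩, hνlim, fun β hβ => ?_⟩
  refine ⟨fun ε hε => (hcont ε hε).continuousOn, fun ε hε t _ => hper ε hε t,
    fun ε hε t ht => (hvis ε hε t ht).1.differentiable (by norm_num),
    ⟨M * I, fun ε hε t _ => hbd ε hε t⟩, fun T => ?_, ?_⟩
  · refine ⟨(M * I' + 2 * (M * I) ^ 2) * (1 + 1 / β), fun ε hε t _ x => ?_⟩
    have hpos := Real.rpow_pos_of_pos hε.1 β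
    have hε1 : ε ^ β ≤ 1 := Real.rpow_le_one hε.1.le hε.2.le hβ.le
    -- The inequality `log x ≤ x ^ β / β` at `x = 1/ε`.
    have h1 : -Real.log ε ≤ 1 / β / ε ^ β := by
      have := Real.log_le_rpow_div (inv_nonneg.2 hε.1.le) hβ
      rw [Real.log_inv, Real.inv_rpow hε.1.le] at this
      refine this.trans_eq ?_
      field_simp
    have h2 : 1 ≤ 1 / ε ^ β := by rwa [one_le_div hpos]
    have h3 : 1 - Real.log ε ≤ (1 + 1 / β) / ε ^ β := by
      rw [add_div]; linarith
    calc _ ≤ (ν ε)⁻¹ * (M * I') + 2 * (M * I) ^ 2 / ν ε := hder ε hε t x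
      _ = (M * I' + 2 * (M * I) ^ 2) * (1 - Real.log ε) := by
        simp only [hν, inv_inv, div_inv_eq_mul]; ring
      _ ≤ (M * I' + 2 * (M * I) ^ 2) * ((1 + 1 / β) / ε ^ β) := by gcongr
      _ = _ := by ring
  · refine isWeakAsymptotic_viscous hνlim hvis hbd fun ψ hψ => ?_
    obtain ⟨C, hC0, hC⟩ := exists_mollify_pairing_bound hφ hψ
    have hlim : Tendsto (fun ε => C * ν ε * periodL1 u₀) (𝓝[>] 0) (𝓝 0) := by
      simpa using (hνlim.const_mul C).mul_const (periodL1 u₀)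
    refine tendsto_iff_norm_sub_tendsto_zero.2 (squeeze_zero' (Eventually.of_forall fun ε =>
      norm_nonneg _) ?_ hlim)
    filter_upwards [eventually_mem_Ioo] with ε hε
    rw [hini ε hε]
    exact hC _ _ (hνpos ε hε) (hν1 ε hε) hloc hu₀.1

end WeakAsymptotic

end

theorem theorem2 (φ : ℝ → ℝ) (hφ : WeakAsymptotic.IsMollifier φ)
    (u₀ : ℝ → ℝ) (hu₀ : WeakAsymptotic.IsTorusLinfty u₀) :
    -- suitable velocities exist: viscous solutions with viscosity tending to zero
    (∃ (ν : ℝ → ℝ) (u : ℝ → ℝ → ℝ → ℝ),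
      (∀ ε ∈ Set.Ioo (0 : ℝ) 1, 0 < ν ε ∧ WeakAsymptotic.IsViscousSolution (ν ε) (u ε)) ∧
      Filter.Tendsto ν (nhdsWithin 0 (Set.Ioi 0)) (nhds 0) ∧
      ∀ β : ℝ, 0 < β → WeakAsymptotic.IsVelocityFamily β u₀ u) ∧
    -- for every suitable velocity:
    (∀ (β : ℝ) (u : ℝ → ℝ → ℝ → ℝ), 0 < β → WeakAsymptotic.IsVelocityFamily β u₀ u →
      -- the system with four components
      (∀ (n : ℕ) (α γ : ℝ), β < α → (n + 2) * α < γ → 2 * γ + (n + 2) * α < 1 →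
        ∀ (v₀ w₀ Z₀ : ℝ → ℝ) (v₀ε w₀ε Z₀ε : ℝ → ℝ → ℝ),
          WeakAsymptotic.IsTorusL1 v₀ → WeakAsymptotic.IsRegularization v₀ v₀ε →
          WeakAsymptotic.IsTorusL1 w₀ → WeakAsymptotic.IsRegularization w₀ w₀ε →
          WeakAsymptotic.IsTorusL1 Z₀ → WeakAsymptotic.IsRegularization Z₀ Z₀ε →
          (∃ X w Z : ℝ → ℝ → BoundedContinuousFunction ℝ ℝ,
            WeakAsymptotic.IsFourConstruction φ n α γ u v₀ε w₀ε Z₀ε X w Z) ∧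
          (∀ X w Z X' w' Z' : ℝ → ℝ → BoundedContinuousFunction ℝ ℝ,
            WeakAsymptotic.IsFourConstruction φ n α γ u v₀ε w₀ε Z₀ε X w Z →
            WeakAsymptotic.IsFourConstruction φ n α γ u v₀ε w₀ε Z₀ε X' w' Z' →
            ∀ ε ∈ Set.Ioo (0 : ℝ) 1, ∀ t, 0 ≤ t →
              X ε t = X' ε t ∧ w ε t = w' ε t ∧ Z ε t = Z' ε t) ∧
          (∀ X w Z : ℝ → ℝ → BoundedContinuousFunction ℝ ℝ,
            WeakAsymptotic.IsFourConstruction φ n α γ u v₀ε w₀ε Z₀ε X w Z →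
            WeakAsymptotic.IsWeakAsymptoticFour n u (WeakAsymptotic.smoothed φ α X)
              (fun ε t x => w ε t x) (fun ε t x => Z ε t x) u₀ v₀ w₀ Z₀)) ∧
      -- the systems with `p + 2` components
      (∀ (p : ℕ) (α : ℕ → ℝ), β < α 1 → (∀ k ∈ Set.Icc 1 p, 5 * α k ≤ α (k + 1)) →
        α (p + 1) < 1 →
        ∀ (g : ℕ → ℝ → ℝ) (gε : ℕ → ℝ → ℝ → ℝ), g 0 = u₀ →
          (∀ k ∈ Set.Icc 1 (p + 1), WeakAsymptotic.IsTorusL1 (g k) ∧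
            WeakAsymptotic.IsRegularization (g k) (gε k)) →
          (∃ X : ℕ → ℝ → ℝ → BoundedContinuousFunction ℝ ℝ,
            WeakAsymptotic.IsHierarchyConstruction φ p α u gε X) ∧
          (∀ X X' : ℕ → ℝ → ℝ → BoundedContinuousFunction ℝ ℝ,
            WeakAsymptotic.IsHierarchyConstruction φ p α u gε X →
            WeakAsymptotic.IsHierarchyConstruction φ p α u gε X' →
            ∀ k ∈ Set.Icc 1 (p + 1), ∀ ε ∈ Set.Ioo (0 : ℝ) 1, ∀ t, 0 ≤ t →
              X k ε t = X' k ε t) ∧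
          (∀ X : ℕ → ℝ → ℝ → BoundedContinuousFunction ℝ ℝ,
            WeakAsymptotic.IsHierarchyConstruction φ p α u gε X →
            WeakAsymptotic.IsWeakAsymptoticHierarchy p
              (WeakAsymptotic.hierarchyFamily φ α u X) g))) := by
  refine ⟨WeakAsymptotic.exists_viscous_velocityFamily hφ hu₀, fun β u hβ hu => ⟨?_, ?_⟩⟩
  · intro n α γ hα hγ hγ1 v₀ w₀ Z₀ v₀ε w₀ε Z₀ε _ hv _ hw _ hZ
    exact ⟨WeakAsymptotic.exists_fourConstruction hφ.1 hu hv hw hZ n α γ,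
      fun _ _ _ _ _ _ h h' => WeakAsymptotic.fourConstruction_unique hu h h',
      fun _ _ _ h => WeakAsymptotic.isWeakAsymptoticFour hφ hu hβ hα hγ hγ1 hv hw hZ h⟩
  · intro p α hα h5 hα1 g gε hg0 hg
    have hreg := fun k hk => (hg k hk).2
    exact ⟨WeakAsymptotic.exists_hierarchyConstruction hφ.1 hu α hreg,
      fun _ _ h h' => WeakAsymptotic.hierarchyConstruction_unique hu h h',
      fun _ h => WeakAsymptotic.isWeakAsymptoticHierarchy hφ hu hβ hα h5 hα1 hg0 hreg h⟩
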